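/- **Theorem (Product formula).** Let $\mathfrak g$ be a finite-dimensional simple complex Lie algebra of rank $r$ with Cartan decomposition $\mathfrak g=\mathfrak n\oplus\mathfrak h\oplus\mathfrak n_+$, simple roots $\alpha_1,\dots,\alpha_r$, and Chevalley generators $f_i\in\mathfrak n_{\alpha_i}$, where $\mathfrak n=\bigoplus_{\beta>0}\mathfrak n_\beta$ and $\mathfrak n_\beta$ is the root space of $-\beta$. *The spaces $\mathcal A(k)$.* For $k\in\mathbb N^r$ let $|k|=\sum k_i$ and $\mathcal T(k)=\{t^{(i)}_j: 1\le i\le r,\ 1\le j\le k_i\}$. Consider the complex vector space generated by the acyclic graphs with $|k|$ edges numbered $1,\dots,|k|$ (ordered trees) on the vertex set $\mathcal T(k)\cup\{z\}$, modulo: (R1) $T_1=-T_2$ if $T_1,T_2$ have the same graph and numberings differing by a transposition; (R2) $T_1+T_2+T_3=0$ if, for distinct vertices $u,v,w$ and distinct numbers $a,b$, the edges numbered $(a,b)$ are $(uv,uw)$ in $T_1$, $(vw,uv)$ in $T_2$, $(uw,vw)$ in $T_3$, and all other edges agree. The group $G_k=\prod_i\Sigma_{k_i}$ permutes the $t^{(i)}_j$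 with equal $i$; $\mathcal A(k)$ is the subspace of the $x$ with $\pi x=\operatorname{sgn}(\pi)x$ for all $\pi\in G_k$. *The star-product.* For an ordered tree $T$ let $\epsilon(T)=\pm1$ be defined by $\bigwedge_{a=1}^{|k|} d\,h(e_a)=\epsilon(T)\bigwedge_{i}\bigwedge_{j} d\,t^{(i)}_j$, where $h(e)$ is the end of the edge $e$ farther from $z$. For ordered trees $T_1,T_2$ on $\mathcal T(k)\cup\{z\}$, $\mathcal T(l)\cup\{z\}$ let $T$ be their union after replacing $t^{(i)}_j$ by $t^{(i)}_{k_i+j}$ and the edge number $a$ by $|k|+a$ in $T_2$ and identifying the vertices $z$, and put $$T_1*T_2=\frac{\epsilon(T_1)\epsilon(T_2)\epsilon(T)}{\prod_i k_i!\,l_i!}\sum_{\pi\in G_{k+l}}\operatorname{sgn}(\pi)\,\pi(T).$$ This induces bilinear maps $\mathcal A(k)\times\mathcal A(l)\to\mathcal A(k+l)$; the empty product is the class of the edgeless graph $T_0$. *The canonical element.* Let $U_r$ be the free associative algebra on $\tilde f_1,\dots,\tilde f_r$, and $U[k]$ its part of degree $k$, with basis $\tilde f_J=\tilde f_{J(|k|)}\cdots\tilde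 f_{J(1)}$ for the maps $J:\{1,\dots,|k|\}\to\{1,\dots,r\}$ with $\#J^{-1}(i)=k_i$. The residue $\operatorname{res}^{(i)}_j T$ of an ordered tree is $0$ if $z\,t^{(i)}_j$ is not an edge; if it is the edge with number $a$, it is $(-1)^{a-1}$ times the tree obtained by contracting this edge to $z$ and lowering the numbers greater than $a$ by one. For $x\in\mathcal A(k)$ let $\langle\tilde f_J,x\rangle$ be the constant with $$(-1)^{\operatorname{inv}(J)}\operatorname{res}^{(J(|k|))}_{c(|k|)}\cdots\operatorname{res}^{(J(1))}_{c(1)}x=\langle\tilde f_J,x\rangle\,T_0,$$ where $c(a)=\#\{b\le a: J(b)=J(a)\}$ and $\operatorname{inv}(J)$ is the number of inversions of the list $J(1),\dots,J(|k|)$. Then for every $k\in\mathbb N^r$ there is a unique canonical element $\Omega_k\in\mathcal A(k)\otimes U[k]$, that is, an element with $(\langle u,\cdot\rangle\otimes\mathrm{id})\,\Omega_k=u$ for all $u\in U[k]$. Let $\Omega^{\mathfrak g}_k$ be its image in $\mathcal A(k)\otimes U(\mathfrak n)$ under $\mathrm{id}\otimes q$, where $q:U_r\to U(\mathfrak n)$,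 $\tilde f_i\mapsto f_i$. *The formula.* Choose a linear ordering $\beta_1<\dots<\beta_m$ of the positive roots and nonzero vectors $F_{\beta_j}\in\mathfrak n_{\beta_j}$, and write $\beta_j=\sum_i k^{(j)}_i\alpha_i$. There are unique $T_p\in\mathcal A\bigl(\sum_j p_jk^{(j)}\bigr)$, $p\in\mathbb N^m$, such that for all $k\in\mathbb N^r$ $$\Omega^{\mathfrak g}_k=\sum_{p:\ \sum_j p_jk^{(j)}=k}T_p\otimes F_{\beta_1}^{p_1}\cdots F_{\beta_m}^{p_m},$$ and there are unique elements $\eta_{\beta_j}\in\mathcal A(k^{(j)})$, $j=1,\dots,m$, such that for all $p\in\mathbb N^m$ $$T_p=\frac1{\prod_l p_l!}\;\underbrace{\eta_{\beta_1}*\cdots*\eta_{\beta_1}}_{p_1}*\cdots*\underbrace{\eta_{\beta_m}*\cdots*\eta_{\beta_m}}_{p_m}.$$ Moreover $\eta_{\beta_j}=T_{1_j}$, where $1_j$ is the $j$-th unit vector. -/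

import Mathlib

open scoped TensorProduct DirectSum

noncomputable section

namespace CanonicalElement

/-! ### Ordered forests -/

/-- An ordered `p`-forest on the vertex set `V`: a graph without cycles with exactly `p` edges,
the edges being numbered by `Fin p`. -/
@[ext]
structure OrderedForest (V : Type*) (p : ℕ) where
  edge : Fin p → Sym2 V
  edge_injective : Function.Injective edge
  not_isDiag : ∀ a, ¬ (edge a).IsDiag
  isAcyclic : (SimpleGraph.fromEdgeSet (Set.range edge)).IsAcyclic

/-- If all edges of `G` join vertices that are mapped by `φ` to connected vertices of `H`, then
`φ` preserves reachability. -/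
theorem reachable_of_adj {V W : Type*} {G : SimpleGraph V} {H : SimpleGraph W} (φ : V → W)
    (h : ∀ x y, G.Adj x y → H.Reachable (φ x) (φ y)) {x y : V} (hxy : G.Reachable x y) :
    H.Reachable (φ x) (φ y) := by
  obtain ⟨w⟩ := hxy
  induction w with
  | nil => exact .rfl
  | cons hadj _ ih => exact (h _ _ hadj).trans ih

namespace OrderedForest

variable {V W : Type*} {p : ℕ}

/-- The underlying graph of an ordered forest. -/
def graph (T : OrderedForest V p) : SimpleGraph V :=
  SimpleGraph.fromEdgeSet (Set.range T.edge)

theorem graph_adj (T : OrderedForest V p) {x y : V} :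
    T.graph.Adj x y ↔ ∃ a, T.edge a = s(x, y) := by
  simp only [graph, SimpleGraph.fromEdgeSet_adj, Set.mem_range, and_iff_left_iff_imp]
  rintro ⟨a, ha⟩ rfl
  exact T.not_isDiag a (by simp [ha])

theorem not_reachable (T : OrderedForest V p) {a : Fin p} {x y : V} (h : T.edge a = s(x, y)) :
    ¬ (SimpleGraph.fromEdgeSet (T.edge '' {a}ᶜ)).Reachable x y := by
  have hb := SimpleGraph.isAcyclic_iff_forall_isBridge.1 T.isAcyclic (e := s(x, y)) (by
    have := T.not_isDiag a
    simp only [h, Sym2.mk_isDiag_iff] at this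
    simp only [SimpleGraph.mem_edgeSet, SimpleGraph.fromEdgeSet_adj]
    exact ⟨⟨a, h⟩, this⟩)
  rw [SimpleGraph.isBridge_iff] at hb
  refine fun hr => hb (hr.mono ?_)
  intro u v huv
  simp only [SimpleGraph.fromEdgeSet_adj, Set.mem_image] at huv
  obtain ⟨⟨c, hc, hcu⟩, hne⟩ := huv
  simp only [SimpleGraph.deleteEdges_adj, SimpleGraph.fromEdgeSet_adj, Set.mem_range,
    Set.mem_singleton_iff]
  refine ⟨⟨⟨c, hcu⟩, hne⟩, fun h' => hc ?_⟩
  exact T.edge_injective (by rw [hcu, h', h])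

/-- A numbered family of edges is an ordered forest as soon as no edge joins vertices that are
connected by the other edges. -/
def ofNotReachable (e : Fin p → Sym2 V)
    (he : ∀ a x y, e a = s(x, y) → ¬ (SimpleGraph.fromEdgeSet (e '' {a}ᶜ)).Reachable x y) :
    OrderedForest V p where
  edge := e
  edge_injective := by
    intro a b hab
    by_contra hne
    induction h : e a with
    | h x y =>
      refine he a x y h ?_
      by_cases hxy : x = y
      · subst hxy; exact .rfl
      · refine SimpleGraph.Adj.reachable ?_
        simp only [SimpleGraph.fromEdgeSet_adj]
        exact ⟨⟨b, fun hb => hne hb.symm, by rw [← hab, h]⟩, hxy⟩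
  not_isDiag := by
    intro a
    induction h : e a with
    | h x y =>
      intro hd
      rw [Sym2.mk_isDiag_iff] at hd
      subst hd
      exact he a x x h .rfl
  isAcyclic := by
    refine SimpleGraph.isAcyclic_iff_forall_isBridge.2 ?_
    intro s
    induction s with
    | h x y =>
      intro hs
      simp only [SimpleGraph.mem_edgeSet, SimpleGraph.fromEdgeSet_adj] at hs
      obtain ⟨⟨a, ha⟩, hxy⟩ := hs
      rw [SimpleGraph.isBridge_iff]
      refine fun hr => he a x y ha (hr.mono ?_)
      intro u v huv
      simp only [SimpleGraph.deleteEdges_adj, SimpleGraph.fromEdgeSet_adj, Set.mem_range,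
        Set.mem_singleton_iff] at huv
      obtain ⟨⟨⟨c, hc⟩, hne⟩, h⟩ := huv
      simp only [SimpleGraph.fromEdgeSet_adj]
      refine ⟨⟨c, ?_, hc⟩, hne⟩
      rintro rfl
      exact h (by rw [← hc, ha])

@[simp] theorem ofNotReachable_edge (e : Fin p → Sym2 V) (he) : (ofNotReachable e he).edge = e :=
  rfl

/-- Renaming the vertices of a forest along a bijection. -/
def map (g : V ≃ W) (T : OrderedForest V p) : OrderedForest W p :=
  ofNotReachable (fun a => (T.edge a).map g) (by
    intro a x y h hr
    have h1 : T.edge a = s(g.symm x, g.symm y) := by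
      have := congrArg (Sym2.map g.symm) h
      simpa [Sym2.map_map] using this
    refine T.not_reachable h1 (reachable_of_adj g.symm ?_ hr)
    intro u v huv
    simp only [SimpleGraph.fromEdgeSet_adj, Set.mem_image] at huv
    obtain ⟨⟨c, hc, hcu⟩, hne⟩ := huv
    refine SimpleGraph.Adj.reachable ?_
    simp only [SimpleGraph.fromEdgeSet_adj]
    refine ⟨⟨c, hc, ?_⟩, fun h => hne (g.symm.injective h)⟩
    have := congrArg (Sym2.map g.symm) hcu
    simpa [Sym2.map_map] using this)

@[simp] theorem map_edge (g : V ≃ W) (T : OrderedForest V p) (a : Fin p) :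
    (T.map g).edge a = (T.edge a).map g := rfl

/-- Renumbering the edges of a forest. -/
def reorder (σ : Equiv.Perm (Fin p)) (T : OrderedForest V p) : OrderedForest V p where
  edge := T.edge ∘ σ
  edge_injective := T.edge_injective.comp σ.injective
  not_isDiag a := T.not_isDiag (σ a)
  isAcyclic := by rw [σ.surjective.range_comp]; exact T.isAcyclic

@[simp] theorem reorder_edge (σ : Equiv.Perm (Fin p)) (T : OrderedForest V p) (a : Fin p) :
    (T.reorder σ).edge a = T.edge (σ a) := rfl

/-- The situation of the first relation: the same underlying graph, with the orders of the edges
differing by the transposition of the numbers `a` and `b`. -/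
def IsSwap (T₁ T₂ : OrderedForest V p) : Prop :=
  ∃ a b : Fin p, a ≠ b ∧ ∀ c, T₂.edge c = T₁.edge (Equiv.swap a b c)

/-- The situation of the second (triangle) relation: three forests which only differ in the edges
with the numbers `a` and `b`, these being two of the three sides of the triangle `u, v, w`:
`uv` and `uw` in the first forest, `vw` and `uv` in the second, `uw` and `vw` in the third. -/
def IsTriangle (T₁ T₂ T₃ : OrderedForest V p) : Prop :=
  ∃ (a b : Fin p) (u v w : V), a ≠ b ∧
    (T₁.edge a = s(u, v) ∧ T₁.edge b = s(u, w)) ∧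
    (T₂.edge a = s(v, w) ∧ T₂.edge b = s(u, v)) ∧
    (T₃.edge a = s(u, w) ∧ T₃.edge b = s(v, w)) ∧
    ∀ c, c ≠ a → c ≠ b → T₂.edge c = T₁.edge c ∧ T₃.edge c = T₁.edge c

end OrderedForest

/-! ### The space spanned by ordered forests modulo the relations -/

/-- The span of the two kinds of relations between ordered `p`-forests. -/
def forestRelations (V : Type*) (p : ℕ) : Submodule ℂ (OrderedForest V p →₀ ℂ) :=
  Submodule.span ℂ
    ({x | ∃ T₁ T₂ : OrderedForest V p, T₁.IsSwap T₂ ∧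
        x = Finsupp.single T₁ 1 + Finsupp.single T₂ 1} ∪
     {x | ∃ T₁ T₂ T₃ : OrderedForest V p, T₁.IsTriangle T₂ T₃ ∧
        x = Finsupp.single T₁ 1 + Finsupp.single T₂ 1 + Finsupp.single T₃ 1})

/-- The complex vector space generated by the ordered `p`-forests on `V`, modulo the two kinds of
relations. -/
abbrev ForestSpace (V : Type*) (p : ℕ) : Type _ :=
  (OrderedForest V p →₀ ℂ) ⧸ forestRelations V p

namespace ForestSpace

variable {V W : Type*} {p : ℕ} {M : Type*} [AddCommGroup M] [Module ℂ M]

/-- The class of an ordered forest. -/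
def mk (T : OrderedForest V p) : ForestSpace V p :=
  (forestRelations V p).mkQ (Finsupp.single T 1)

theorem mk_swap {T₁ T₂ : OrderedForest V p} (h : T₁.IsSwap T₂) : mk T₁ + mk T₂ = 0 := by
  rw [mk, mk, ← map_add, Submodule.mkQ_apply, Submodule.Quotient.mk_eq_zero]
  exact Submodule.subset_span (.inl ⟨_, _, h, rfl⟩)

theorem mk_triangle {T₁ T₂ T₃ : OrderedForest V p} (h : T₁.IsTriangle T₂ T₃) :
    mk T₁ + mk T₂ + mk T₃ = 0 := by
  rw [mk, mk, mk, ← map_add, ← map_add, Submodule.mkQ_apply, Submodule.Quotient.mk_eq_zero]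
  exact Submodule.subset_span (.inr ⟨_, _, _, h, rfl⟩)

/-- A function on ordered forests that respects the two kinds of relations extends to a linear
map. -/
def lift (φ : OrderedForest V p → M)
    (h₁ : ∀ T₁ T₂ : OrderedForest V p, T₁.IsSwap T₂ → φ T₁ + φ T₂ = 0)
    (h₂ : ∀ T₁ T₂ T₃ : OrderedForest V p, T₁.IsTriangle T₂ T₃ → φ T₁ + φ T₂ + φ T₃ = 0) :
    ForestSpace V p →ₗ[ℂ] M :=
  (forestRelations V p).liftQ (Finsupp.linearCombination ℂ φ) (by
    rw [forestRelations, Submodule.span_le]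
    rintro x (⟨T₁, T₂, h, rfl⟩ | ⟨T₁, T₂, T₃, h, rfl⟩)
    · simpa using h₁ _ _ h
    · simpa using h₂ _ _ _ h)

@[simp] theorem lift_mk (φ : OrderedForest V p → M) (h₁) (h₂) (T : OrderedForest V p) :
    lift φ h₁ h₂ (mk T) = φ T := by
  simp [lift, mk]

theorem hom_ext {f g : ForestSpace V p →ₗ[ℂ] M} (h : ∀ T, f (mk T) = g (mk T)) : f = g := by
  refine Submodule.linearMap_qext _ (Finsupp.lhom_ext' fun T => LinearMap.ext_ring ?_)
  exact h T

/-- The map induced by renaming the vertices. -/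
def rename (g : V ≃ W) : ForestSpace V p →ₗ[ℂ] ForestSpace W p :=
  lift (fun T => mk (T.map g))
    (by
      rintro T₁ T₂ ⟨a, b, hab, h⟩
      exact mk_swap ⟨a, b, hab, fun c => by simp [h]⟩)
    (by
      rintro T₁ T₂ T₃ ⟨a, b, u, v, w, hab, ⟨h1, h2⟩, ⟨h3, h4⟩, ⟨h5, h6⟩, h⟩
      refine mk_triangle ⟨a, b, g u, g v, g w, hab, ?_, ?_, ?_, fun c hca hcb => ?_⟩
      · simp [h1, h2]
      · simp [h3, h4]
      · simp [h5, h6]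
      · simp [h c hca hcb])

@[simp] theorem rename_mk (g : V ≃ W) (T : OrderedForest V p) :
    rename g (mk T) = mk (T.map g) := by
  simp [rename]

end ForestSpace

/-! ### Residues -/

section Residue

variable {V : Type*} [DecidableEq V] {p : ℕ}

/-- Contraction of the edge with number `a`, when this edge is `z t`: the edge is deleted, the
vertex `t` is identified with `z` (so that no edge meets `t` any more), and the numbers greater
than `a` are decreased by one. -/
def OrderedForest.contract {z t : V} (T : OrderedForest V (p + 1)) (a : Fin (p + 1))
    (h : T.edge a = s(z, t)) : OrderedForest V p :=
  .ofNotReachable (fun c => (T.edge (a.succAbove c)).map (Function.update id t z)) (by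
    have hzt : ∀ {c : Fin (p + 1)}, c ≠ a → ∀ x,
        (SimpleGraph.fromEdgeSet (T.edge '' {c}ᶜ)).Reachable x (Function.update id t z x) := by
      intro c hc x
      by_cases hx : x = t
      · subst hx
        simp only [Function.update_self]
        refine SimpleGraph.Adj.reachable ?_
        simp only [SimpleGraph.fromEdgeSet_adj]
        refine ⟨⟨a, fun h => hc h.symm, by rw [h, Sym2.eq_swap]⟩, ?_⟩
        rintro rfl
        exact T.not_isDiag a (by simp [h])
      · simp [hx]
    intro c x y hc hr
    induction hT : T.edge (a.succAbove c) with
    | h u v =>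
    have hca := a.succAbove_ne c
    rw [hT, Sym2.map_mk] at hc
    have key : ∀ x y, (SimpleGraph.fromEdgeSet
        ((fun c => (T.edge (a.succAbove c)).map (Function.update id t z)) '' {c}ᶜ)).Reachable x y →
        (SimpleGraph.fromEdgeSet (T.edge '' {a.succAbove c}ᶜ)).Reachable x y := by
      intro x y
      refine reachable_of_adj id ?_
      intro x y hxy
      simp only [SimpleGraph.fromEdgeSet_adj, Set.mem_image] at hxy
      obtain ⟨⟨d, hd, hdx⟩, hne⟩ := hxy
      induction hT' : T.edge (a.succAbove d) with
      | h u' v' =>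
      have hr' : (SimpleGraph.fromEdgeSet (T.edge '' {a.succAbove c}ᶜ)).Reachable u' v' := by
        refine SimpleGraph.Adj.reachable ?_
        simp only [SimpleGraph.fromEdgeSet_adj]
        refine ⟨⟨_, fun h => hd (a.succAbove_right_injective h), hT'⟩, ?_⟩
        rintro rfl
        exact T.not_isDiag (a.succAbove d) (by simp [hT'])
      have hr'' := ((hzt hca u').symm.trans hr').trans (hzt hca v')
      rw [hT', Sym2.map_mk, Sym2.eq_iff] at hdx
      rcases hdx with ⟨rfl, rfl⟩ | ⟨rfl, rfl⟩
      · exact hr''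
      · exact hr''.symm
    refine T.not_reachable hT (((hzt hca u).trans ?_).trans (hzt hca v).symm)
    rw [Sym2.eq_iff] at hc
    rcases hc with ⟨rfl, rfl⟩ | ⟨rfl, rfl⟩
    · exact key _ _ hr
    · exact (key _ _ hr).symm)

@[simp] theorem OrderedForest.contract_edge {z t : V} (T : OrderedForest V (p + 1))
    (a : Fin (p + 1)) (h : T.edge a = s(z, t)) (c : Fin p) :
    (T.contract a h).edge c = (T.edge (a.succAbove c)).map (Function.update id t z) := rfl

open Classical in
/-- The residue at `t` of a forest: if `z t` is the edge with number `a` (counted from `0`), the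
contraction of this edge with the sign `(-1) ^ a`, and zero if `z t` is not an edge. -/
def forestResidue (z t : V) (T : OrderedForest V (p + 1)) : ForestSpace V p :=
  if h : ∃ a, T.edge a = s(z, t) then
    (-1 : ℂ) ^ (h.choose : ℕ) • ForestSpace.mk (T.contract h.choose h.choose_spec)
  else 0

theorem forestResidue_eq {z t : V} {T : OrderedForest V (p + 1)} {a : Fin (p + 1)}
    (h : T.edge a = s(z, t)) :
    forestResidue z t T = (-1 : ℂ) ^ (a : ℕ) • ForestSpace.mk (T.contract a h) := by
  have h' : ∃ a, T.edge a = s(z, t) := ⟨a, h⟩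
  have : h'.choose = a := T.edge_injective (h'.choose_spec.trans h.symm)
  rw [forestResidue, dif_pos h']
  subst this
  rfl

theorem forestResidue_eq_zero {z t : V} {T : OrderedForest V (p + 1)}
    (h : ∀ a, T.edge a ≠ s(z, t)) : forestResidue z t T = 0 := by
  rw [forestResidue, dif_neg (by simpa using h)]

theorem swap_succAbove_succ {p : ℕ} (i c : Fin p) :
    Equiv.swap i.castSucc i.succ (i.succ.succAbove c) = i.castSucc.succAbove c := by
  rw [Equiv.swap_apply_def]
  simp only [Fin.succAbove, Fin.ext_iff, Fin.lt_def]
  split_ifs <;> simp_all <;> omega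

theorem swap_succAbove_castSucc {p : ℕ} (i c : Fin p) :
    Equiv.swap i.castSucc i.succ (i.castSucc.succAbove c) = i.succ.succAbove c := by
  rw [← swap_succAbove_succ, Equiv.swap_apply_self]

theorem forestResidue_reorder_adjacent (z t : V) (T : OrderedForest V (p + 1)) (i : Fin p) :
    forestResidue z t (T.reorder (Equiv.swap i.castSucc i.succ)) = - forestResidue z t T := by
  by_cases h : ∃ a, T.edge a = s(z, t)
  swap
  · push Not at h
    rw [forestResidue_eq_zero h, forestResidue_eq_zero (fun a => by simpa using h _), neg_zero]
  obtain ⟨a, ha⟩ := h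
  rw [forestResidue_eq ha]
  have ha' : (T.reorder (Equiv.swap i.castSucc i.succ)).edge
      (Equiv.swap i.castSucc i.succ a) = s(z, t) := by simpa using ha
  by_cases h1 : a = i.castSucc
  · subst h1
    have : ((T.reorder (Equiv.swap i.castSucc i.succ)).contract _ ha') = T.contract _ ha := by
      ext c
      simp only [OrderedForest.contract_edge, OrderedForest.reorder_edge]
      rw [Equiv.swap_apply_left, swap_succAbove_succ]
    rw [forestResidue_eq ha', this]
    simp [pow_succ]
  by_cases h2 : a = i.succ
  · subst h2
    have : ((T.reorder (Equiv.swap i.castSucc i.succ)).contract _ ha') = T.contract _ ha := by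
      ext c
      simp only [OrderedForest.contract_edge, OrderedForest.reorder_edge]
      rw [Equiv.swap_apply_right, swap_succAbove_castSucc]
    rw [forestResidue_eq ha', this]
    simp [pow_succ]
  have h3 : Equiv.swap i.castSucc i.succ a = a := Equiv.swap_apply_of_ne_of_ne h1 h2
  obtain ⟨x, hx⟩ := Fin.exists_succAbove_eq (Ne.symm h1)
  obtain ⟨y, hy⟩ := Fin.exists_succAbove_eq (Ne.symm h2)
  have hxy : x ≠ y := by
    rintro rfl
    have := hx.symm.trans hy
    simp [Fin.ext_iff] at this
  rw [h3] at ha'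
  rw [forestResidue_eq ha', ← smul_neg]
  congr 1
  refine eq_neg_of_add_eq_zero_right (ForestSpace.mk_swap ⟨x, y, hxy, fun c => ?_⟩)
  simp only [OrderedForest.contract_edge, OrderedForest.reorder_edge]
  congr 2
  rw [← hx, ← hy]
  have hinj := a.succAbove_right_injective
  by_cases hcx : c = x
  · subst hcx; simp
  by_cases hcy : c = y
  · subst hcy; simp
  rw [Equiv.swap_apply_of_ne_of_ne hcx hcy,
    Equiv.swap_apply_of_ne_of_ne (fun h => hcx (hinj h)) (fun h => hcy (hinj h))]

theorem forestResidue_reorder (z t : V) (T : OrderedForest V (p + 1))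
    (σ : Equiv.Perm (Fin (p + 1))) :
    forestResidue z t (T.reorder σ) = (Equiv.Perm.sign σ : ℤ) • forestResidue z t T := by
  have hσ : σ ∈ Submonoid.closure
      (Set.range fun i : Fin p => Equiv.swap i.castSucc i.succ) := by
    rw [Equiv.Perm.mclosure_swap_castSucc_succ]; trivial
  induction hσ using Submonoid.closure_induction generalizing T with
  | mem x hx =>
    obtain ⟨i, rfl⟩ := hx
    rw [forestResidue_reorder_adjacent, Equiv.Perm.sign_swap (by simp [Fin.ext_iff])]
    simp
  | one => simp [OrderedForest.reorder]
  | mul x y _ _ hx hy =>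
    have : T.reorder (x * y) = (T.reorder x).reorder y := rfl
    rw [this, hy, hx, smul_smul, map_mul, mul_comm]
    simp

/-- The residue at `t`, as a linear map. -/
def residue (z t : V) : ForestSpace V (p + 1) →ₗ[ℂ] ForestSpace V p :=
  ForestSpace.lift (forestResidue z t)
    (by
      rintro T₁ T₂ ⟨a, b, hab, h⟩
      have : T₂ = T₁.reorder (Equiv.swap a b) := by ext1; funext c; exact h c
      rw [this, forestResidue_reorder, Equiv.Perm.sign_swap hab]
      simp)
    (by
      -- two forests with the edge `z t` at `a` resp. `b` and equal contractions cancel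
      have key : ∀ (T T' : OrderedForest V (p + 1)) (a b : Fin (p + 1)), a ≠ b →
          T.edge a = s(z, t) → T'.edge b = s(z, t) →
          (T.edge b).map (Function.update id t z) = (T'.edge a).map (Function.update id t z) →
          (∀ c, c ≠ a → c ≠ b → T'.edge c = T.edge c) →
          forestResidue z t T + forestResidue z t T' = 0 := by
        intro T T' a b hab hT hT' hTT' hc
        have h1 : forestResidue z t T' = - forestResidue z t (T'.reorder (Equiv.swap a b)) := by
          rw [forestResidue_reorder, Equiv.Perm.sign_swap hab]; simp
        have hT'' : (T'.reorder (Equiv.swap a b)).edge a = s(z, t) := by simpa using hT'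
        rw [h1, forestResidue_eq hT, forestResidue_eq hT'']
        have : T.contract a hT = (T'.reorder (Equiv.swap a b)).contract a hT'' := by
          ext c
          simp only [OrderedForest.contract_edge, OrderedForest.reorder_edge]
          by_cases hcb : a.succAbove c = b
          · rw [hcb, Equiv.swap_apply_right, hTT']
          · rw [Equiv.swap_apply_of_ne_of_ne (a.succAbove_ne c) hcb,
              hc _ (a.succAbove_ne c) hcb]
        rw [this, add_neg_cancel]
      have kmap : ∀ x y w : V, s(x, y) = s(z, t) →
          Sym2.map (Function.update id t z) s(x, w) =
            Sym2.map (Function.update id t z) s(y, w) := by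
        intro x y w h
        rw [Sym2.eq_iff] at h
        have hz : Function.update id t z z = z := by
          by_cases hzt : z = t
          · subst hzt; simp
          · simp [hzt]
        rcases h with ⟨rfl, rfl⟩ | ⟨rfl, rfl⟩ <;> simp [hz]
      rintro T₁ T₂ T₃ ⟨a, b, u, v, w, hab, ⟨h1, h2⟩, ⟨h3, h4⟩, ⟨h5, h6⟩, h⟩
      by_cases huv : s(u, v) = s(z, t)
      · rw [key T₁ T₂ a b hab (h1.trans huv) (h4.trans huv)
          (by rw [h2, h3]; exact kmap _ _ _ huv) (fun c hca hcb => (h c hca hcb).1), zero_add]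
        refine forestResidue_eq_zero fun c hc => ?_
        have e1 : T₁.edge c ≠ s(z, t) ∨ c = a := by
          by_cases hca : c = a
          · exact .inr hca
          · exact .inl fun h' => hca (T₁.edge_injective (h'.trans (h1.trans huv).symm))
        have huw : u ≠ w := by
          rintro rfl; exact T₁.not_isDiag b (by simp [h2])
        have hvw : v ≠ w := by
          rintro rfl; exact T₂.not_isDiag a (by simp [h3])
        by_cases hca : c = a
        · subst hca
          rw [h5, ← huv, Sym2.eq_iff] at hc
          grind
        by_cases hcb : c = b
        · subst hcb
          rw [h6, ← huv, Sym2.eq_iff] at hc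
          grind
        rw [(h c hca hcb).2] at hc
        exact e1.elim (fun h => h hc) hca
      by_cases huw : s(u, w) = s(z, t)
      · have k13 := key T₃ T₁ a b hab (h5.trans huw) (h2.trans huw)
          (by rw [h6, h1, Sym2.eq_swap (a := v)]; exact (kmap _ _ _ huw).symm)
          (fun c hca hcb => ((h c hca hcb).2).symm)
        have k2 : forestResidue z t T₂ = 0 := by
          refine forestResidue_eq_zero fun c hc => ?_
          by_cases hca : c = a
          · subst hca
            have hne : u ≠ v := by rintro rfl; exact T₁.not_isDiag c (by simp [h1])
            rw [h3, ← huw, Sym2.eq_iff] at hc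
            grind
          by_cases hcb : c = b
          · subst hcb
            exact huv (h4.symm.trans hc)
          rw [(h c hca hcb).1] at hc
          exact hcb (T₁.edge_injective (hc.trans (h2.trans huw).symm))
        rw [k2, add_zero, add_comm, k13]
      by_cases hvw : s(v, w) = s(z, t)
      · have k23 := key T₂ T₃ a b hab (h3.trans hvw) (h6.trans hvw)
          (by
            rw [h4, h5, Sym2.eq_swap (a := u) (b := v), Sym2.eq_swap (a := u) (b := w)]
            exact kmap _ _ _ hvw)
          (fun c hca hcb => ((h c hca hcb).2).trans (h c hca hcb).1.symm)
        have k1 : forestResidue z t T₁ = 0 := by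
          refine forestResidue_eq_zero fun c hc => ?_
          by_cases hca : c = a
          · subst hca
            exact huv (h1.symm.trans hc)
          by_cases hcb : c = b
          · subst hcb
            exact huw (h2.symm.trans hc)
          rw [← (h c hca hcb).1] at hc
          exact hca (T₂.edge_injective (hc.trans (h3.trans hvw).symm))
        rw [k1, zero_add, k23]
      by_cases hex : ∃ c, T₁.edge c = s(z, t)
      · obtain ⟨c, hc⟩ := hex
        have hca : c ≠ a := by rintro rfl; exact huv (h1.symm.trans hc)
        have hcb : c ≠ b := by rintro rfl; exact huw (h2.symm.trans hc)
        have hc2 : T₂.edge c = s(z, t) := (h c hca hcb).1.trans hc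
        have hc3 : T₃.edge c = s(z, t) := (h c hca hcb).2.trans hc
        rw [forestResidue_eq hc, forestResidue_eq hc2, forestResidue_eq hc3, ← smul_add,
          ← smul_add]
        obtain ⟨a', rfl⟩ := Fin.exists_succAbove_eq hca.symm
        obtain ⟨b', rfl⟩ := Fin.exists_succAbove_eq hcb.symm
        rw [ForestSpace.mk_triangle, smul_zero]
        refine ⟨a', b', Function.update id t z u, Function.update id t z v,
          Function.update id t z w, fun h => hab (by rw [h]), ?_, ?_, ?_, fun d hda hdb => ?_⟩
        · simp [h1, h2]
        · simp [h3, h4]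
        · simp [h5, h6]
        · have := h (c.succAbove d) (fun h => hda (c.succAbove_right_injective h))
            (fun h => hdb (c.succAbove_right_injective h))
          simp [this]
      · push Not at hex
        rw [forestResidue_eq_zero hex, forestResidue_eq_zero, forestResidue_eq_zero]
        · simp
        · intro c hc
          by_cases hca : c = a
          · subst hca; exact huw (h5.symm.trans hc)
          by_cases hcb : c = b
          · subst hcb; exact hvw (h6.symm.trans hc)
          exact hex c ((h c hca hcb).2.symm.trans hc)
        · intro c hc
          by_cases hca : c = a
          · subst hca; exact hvw (h3.symm.trans hc)
          by_cases hcb : c = b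
          · subst hcb; exact huv (h4.symm.trans hc)
          exact hex c ((h c hca hcb).1.symm.trans hc))

@[simp] theorem residue_mk (z t : V) (T : OrderedForest V (p + 1)) :
    residue z t (ForestSpace.mk T) = forestResidue z t T := by
  simp [residue]

/-- The constant `c` with `x = c T₀`, where `T₀` is the forest without edges. -/
def constantTerm (V : Type*) : ForestSpace V 0 →ₗ[ℂ] ℂ :=
  ForestSpace.lift (fun _ => 1) (fun _ _ ⟨a, _⟩ => a.elim0) (fun _ _ _ ⟨a, _⟩ => a.elim0)

/-- The constant by which `T₀` is multiplied in the iterated residue of a forest with `p` edges,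
first at `t 0`, then at `t 1`, and so on. -/
def iteratedResidue (z : V) : (p : ℕ) → (Fin p → V) → ForestSpace V p →ₗ[ℂ] ℂ
  | 0, _ => constantTerm V
  | p + 1, t => iteratedResidue z p (fun i => t i.succ) ∘ₗ residue z (t 0)

end Residue

end CanonicalElement

namespace CanonicalElement

/-! ### The spaces `A(k)` -/

variable {r : ℕ}

/-- The set `T(k)` of the symbols `t_j^{(i)}` with `j ≤ k i`. -/
abbrev Var (k : Fin r → ℕ) : Type := Σ i : Fin r, Fin (k i)

/-- The vertex set `T(k) ∪ {z}`; the vertex `z` is `none`. -/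
abbrev Vertex (k : Fin r → ℕ) : Type := Option (Var k)

/-- The number `|k|`. -/
abbrev size (k : Fin r → ℕ) : ℕ := ∑ i, k i

/-- The group `G_k`, a product of symmetric groups. -/
abbrev PermGroup (k : Fin r → ℕ) : Type := ∀ i, Equiv.Perm (Fin (k i))

/-- The action of `G_k` on the vertices, permuting the symbols with the same upper index. -/
def vertexPerm {k : Fin r → ℕ} (π : PermGroup k) : Vertex k ≃ Vertex k :=
  Equiv.optionCongr (Equiv.sigmaCongrRight π)

/-- The sign of an element of `G_k`. -/
def permSign {k : Fin r → ℕ} (π : PermGroup k) : ℂ :=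
  ∏ i, ((Equiv.Perm.sign (π i) : ℤ) : ℂ)

/-- The space generated by the ordered `|k|`-forests on `T(k) ∪ {z}`, modulo the relations. Since
there are `|k| + 1` vertices, these forests are the ordered spanning trees. -/
abbrev TreeSpace (k : Fin r → ℕ) : Type := ForestSpace (Vertex k) (size k)

/-- The action of an element of `G_k` on the space of trees. -/
def permute {k : Fin r → ℕ} (π : PermGroup k) : TreeSpace k →ₗ[ℂ] TreeSpace k :=
  ForestSpace.rename (vertexPerm π)

theorem permSign_mul {k : Fin r → ℕ} (π ρ : PermGroup k) :
    permSign (π * ρ) = permSign π * permSign ρ := by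
  simp [permSign, Finset.prod_mul_distrib]

theorem permSign_mul_self {k : Fin r → ℕ} (π : PermGroup k) : permSign π * permSign π = 1 := by
  rw [permSign, ← Finset.prod_mul_distrib]
  refine Finset.prod_eq_one fun i _ => ?_
  rw [← Int.cast_mul, ← Units.val_mul, Int.units_mul_self]
  simp

theorem permute_mul {k : Fin r → ℕ} (π ρ : PermGroup k) :
    permute (π * ρ) = permute π ∘ₗ permute ρ := by
  refine ForestSpace.hom_ext fun T => ?_
  simp only [permute, ForestSpace.rename_mk, LinearMap.comp_apply]
  congr 1
  ext1
  funext a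
  simp only [OrderedForest.map_edge, Sym2.map_map]
  congr 1
  funext v
  rcases v with _ | ⟨i, j⟩ <;> rfl

/-- The space `A(k)` of the skew-invariants of `G_k`. -/
def A (k : Fin r → ℕ) : Submodule ℂ (TreeSpace k) where
  carrier := {x | ∀ π : PermGroup k, permute π x = permSign π • x}
  add_mem' hx hy π := by rw [map_add, hx π, hy π, smul_add]
  zero_mem' π := by simp
  smul_mem' c x hx π := by rw [map_smul, hx π, smul_comm]

/-- Antisymmetrization. -/
def asym (k : Fin r → ℕ) : TreeSpace k →ₗ[ℂ] TreeSpace k :=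
  ∑ π : PermGroup k, permSign π • permute π

theorem asym_mem (k : Fin r → ℕ) (x : TreeSpace k) : asym k x ∈ A k := by
  intro π
  simp only [asym, LinearMap.sum_apply, LinearMap.smul_apply, map_sum, map_smul, Finset.smul_sum]
  rw [← Equiv.sum_comp (Equiv.mulLeft π) (fun ρ => permSign π • permSign ρ • permute ρ x)]
  refine Finset.sum_congr rfl fun ρ _ => ?_
  rw [Equiv.coe_mulLeft, permSign_mul, permute_mul, smul_smul, ← mul_assoc, permSign_mul_self,
    one_mul, LinearMap.comp_apply]

/-! ### The sign of a tree -/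

/-- The vertex `v` is the head of the edge with number `a`, i.e. the end of this edge that is
farther from the root `z`. -/
def IsHead {k : Fin r → ℕ} {p : ℕ} (T : OrderedForest (Vertex k) p) (a : Fin p) (v : Vertex k) :
    Prop :=
  ∃ u, T.edge a = s(u, v) ∧ T.graph.dist none u < T.graph.dist none v

open Classical in
/-- The matrix expressing the heads of the edges of a tree, in their order, through the symbols
`t_j^{(i)}` in lexicographic order (first by `i`, then by `j`). -/
def headMatrix {k : Fin r → ℕ} (T : OrderedForest (Vertex k) (size k)) :
    Matrix (Fin (size k)) (Fin (size k)) ℂ :=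
  Matrix.of fun a b => if IsHead T a (some (finSigmaFinEquiv.symm b)) then 1 else 0

/-- The sign `ε(T)` of an ordered tree: the exterior product of the differentials of the heads of
the edges, in their order, is `ε(T)` times the exterior product of the `d t_j^{(i)}` in
lexicographic order; that is, `ε(T)` is the determinant of the matrix of heads. -/
def treeSign {k : Fin r → ℕ} (T : OrderedForest (Vertex k) (size k)) : ℂ :=
  (headMatrix T).det

theorem isTree_graph {k : Fin r → ℕ} (T : OrderedForest (Vertex k) (size k)) :
    T.graph.IsTree := by
  classical
  obtain ⟨F, hTF, -, hF⟩ := SimpleGraph.connected_top.exists_isTree_le_of_le_of_isAcyclic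
    (le_top : T.graph ≤ ⊤) T.isAcyclic
  have hcard := hF.card_edgeFinset
  have hT : T.graph.edgeFinset.card = size k := by
    have : T.graph.edgeFinset = Finset.univ.image T.edge := by
      ext e
      induction e with
      | h x y => simp [T.graph_adj]
    rw [this, Finset.card_image_of_injective _ T.edge_injective, Finset.card_univ, Fintype.card_fin]
  have hV : Fintype.card (Vertex k) = size k + 1 := by simp [size]
  have : T.graph = F := by
    rw [← SimpleGraph.edgeFinset_inj]
    refine Finset.eq_of_subset_of_card_le (SimpleGraph.edgeFinset_mono hTF) ?_
    omega
  rw [this]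
  exact hF

theorem existsUnique_head {k : Fin r → ℕ} (T : OrderedForest (Vertex k) (size k))
    (a : Fin (size k)) : ∃! b, IsHead T a (some (finSigmaFinEquiv.symm b)) := by
  have h : ∃! v : Vertex k, IsHead T a v := by
    induction h : T.edge a with
    | h x y =>
    have hadj : T.graph.Adj x y := T.graph_adj.2 ⟨a, h⟩
    have hne := (isTree_graph T).dist_ne_of_adj none hadj
    rcases lt_or_gt_of_ne hne with hlt | hlt
    · refine ⟨y, ⟨x, h, hlt⟩, ?_⟩
      rintro v ⟨u, hu, huv⟩
      rw [h, Sym2.eq_iff] at hu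
      rcases hu with ⟨rfl, rfl⟩ | ⟨rfl, rfl⟩
      · rfl
      · omega
    · refine ⟨x, ⟨y, by rw [h, Sym2.eq_swap], hlt⟩, ?_⟩
      rintro v ⟨u, hu, huv⟩
      rw [h, Sym2.eq_iff] at hu
      rcases hu with ⟨rfl, rfl⟩ | ⟨rfl, rfl⟩
      · omega
      · rfl
  obtain ⟨v, hv, huniq⟩ := h
  rcases v with _ | v
  · obtain ⟨u, -, hu⟩ := hv
    simp at hu
  · refine ⟨finSigmaFinEquiv v, by simpa using hv, fun b hb => ?_⟩
    have := huniq _ hb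
    rw [Option.some_inj] at this
    simp [← this]

theorem isHead_inj {k : Fin r → ℕ} (T : OrderedForest (Vertex k) (size k))
    {a b : Fin (size k)} {v : Vertex k} (ha : IsHead T a v) (hb : IsHead T b v) : a = b := by
  classical
  obtain ⟨u, hu, hlt⟩ := ha
  obtain ⟨u', hu', hlt'⟩ := hb
  have hT := isTree_graph T
  have key : ∀ w : Vertex k, T.graph.Adj w v → T.graph.dist none w < T.graph.dist none v →
      ∃ q : T.graph.Walk none v, q.IsPath ∧ q.penultimate = w := by
    intro w hadj hw
    obtain ⟨p, hp, hlen⟩ := (hT.connected none w).exists_path_of_dist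
    have hv : v ∉ p.support := by
      intro hmem
      have h1 := SimpleGraph.dist_le (p.takeUntil v hmem)
      have h2 := p.length_takeUntil_le_length hmem
      omega
    exact ⟨p.concat hadj, hp.concat hv hadj, by simp⟩
  obtain ⟨q, hq, rfl⟩ := key u (T.graph_adj.2 ⟨a, hu⟩) hlt
  obtain ⟨q', hq', rfl⟩ := key u' (T.graph_adj.2 ⟨b, hu'⟩) hlt'
  have := (hT.isAcyclic.subsingleton_path none v).elim ⟨q, hq⟩ ⟨q', hq'⟩
  have hqq : q = q' := congrArg Subtype.val this
  subst hqq
  exact T.edge_injective (hu.trans hu'.symm)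

theorem treeSign_mul_self {k : Fin r → ℕ} (T : OrderedForest (Vertex k) (size k)) :
    treeSign T * treeSign T = 1 := by
  classical
  have : headMatrix T * (headMatrix T).transpose = 1 := by
    ext a b
    rw [Matrix.mul_apply, Matrix.one_apply]
    obtain ⟨c, hc, huniq⟩ := existsUnique_head T a
    rw [Finset.sum_eq_single c]
    · by_cases hab : a = b
      · subst hab
        simp [headMatrix, hc]
      · have : ¬ IsHead T b (some (finSigmaFinEquiv.symm c)) :=
          fun h => hab (isHead_inj T hc h)
        simp [headMatrix, this, hab]
    · intro d _ hd
      have : ¬ IsHead T a (some (finSigmaFinEquiv.symm d)) := fun h => hd (huniq d h)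
      simp [headMatrix, this]
    · simp
  have h := congrArg Matrix.det this
  rwa [Matrix.det_mul, Matrix.det_transpose, Matrix.det_one] at h

/-! ### The star-product -/

section Star

variable {k l : Fin r → ℕ}

/-- The symbol `t_j^{(i)}` of `T(k)` as an element of `T(k + l)`. -/
def varLeft (k l : Fin r → ℕ) (v : Var k) : Var (k + l) := ⟨v.1, Fin.castAdd (l v.1) v.2⟩

/-- The symbol `t_{k_i + j}^{(i)}` of `T(k + l)` that replaces the symbol `t_j^{(i)}` of `T(l)`. -/
def varRight (k l : Fin r → ℕ) (v : Var l) : Var (k + l) := ⟨v.1, Fin.natAdd (k v.1) v.2⟩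

/-- `T(k + l)` is the disjoint union of `T(k)` and `T(l)`. -/
def varEquiv (k l : Fin r → ℕ) : Var k ⊕ Var l ≃ Var (k + l) :=
  (Equiv.sigmaSumDistrib (fun i => Fin (k i)) (fun i => Fin (l i))).symm.trans
    (Equiv.sigmaCongrRight fun _ => finSumFinEquiv)

@[simp] theorem varEquiv_inl (v : Var k) : varEquiv k l (.inl v) = varLeft k l v := rfl

@[simp] theorem varEquiv_inr (v : Var l) : varEquiv k l (.inr v) = varRight k l v := rfl

theorem size_add (k l : Fin r → ℕ) : size (k + l) = size k + size l := by
  simp [size, Finset.sum_add_distrib]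

/-- The collapse of the second part of the vertices of `T(k + l) ∪ {z}` to `z`. -/
def collapseRight (k l : Fin r → ℕ) (v : Vertex (k + l)) : Vertex k :=
  v.bind fun w => ((varEquiv k l).symm w).getLeft?

/-- The collapse of the first part of the vertices of `T(k + l) ∪ {z}` to `z`. -/
def collapseLeft (k l : Fin r → ℕ) (v : Vertex (k + l)) : Vertex l :=
  v.bind fun w => ((varEquiv k l).symm w).getRight?

@[simp] theorem collapseRight_left (v : Vertex k) :
    collapseRight k l (v.map (varLeft k l)) = v := by
  rcases v with _ | v
  · rfl
  · simp [collapseRight, ← varEquiv_inl]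

@[simp] theorem collapseRight_right (v : Vertex l) :
    collapseRight k l (v.map (varRight k l)) = none := by
  rcases v with _ | v
  · rfl
  · simp [collapseRight, ← varEquiv_inr]

@[simp] theorem collapseLeft_right (v : Vertex l) :
    collapseLeft k l (v.map (varRight k l)) = v := by
  rcases v with _ | v
  · rfl
  · simp [collapseLeft, ← varEquiv_inr]

@[simp] theorem collapseLeft_left (v : Vertex k) :
    collapseLeft k l (v.map (varLeft k l)) = none := by
  rcases v with _ | v
  · rfl
  · simp [collapseLeft, ← varEquiv_inl]

/-- The edges of the union of two trees: first the edges of `T₁`, then the edges of `T₂` with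
their numbers increased by `|k|` and their vertices renamed; the vertices `z` are identified. -/
def glueEdge (T₁ : OrderedForest (Vertex k) (size k)) (T₂ : OrderedForest (Vertex l) (size l))
    (a : Fin (size (k + l))) : Sym2 (Vertex (k + l)) :=
  Fin.append (fun c => (T₁.edge c).map (Option.map (varLeft k l)))
    (fun c => (T₂.edge c).map (Option.map (varRight k l))) (Fin.cast (size_add k l) a)

/-- The number in the union of the edge of `T₁` with number `a`. -/
def idxLeft (k l : Fin r → ℕ) (a : Fin (size k)) : Fin (size (k + l)) :=
  Fin.cast (size_add k l).symm (Fin.castAdd (size l) a)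

/-- The number in the union of the edge of `T₂` with number `a`. -/
def idxRight (k l : Fin r → ℕ) (a : Fin (size l)) : Fin (size (k + l)) :=
  Fin.cast (size_add k l).symm (Fin.natAdd (size k) a)

theorem idx_cases (a : Fin (size (k + l))) :
    (∃ c, a = idxLeft k l c) ∨ (∃ c, a = idxRight k l c) := by
  have h : a = Fin.cast (size_add k l).symm (Fin.cast (size_add k l) a) := by simp
  generalize Fin.cast (size_add k l) a = b at h
  subst h
  induction b using Fin.addCases with
  | left c => exact .inl ⟨c, rfl⟩
  | right c => exact .inr ⟨c, rfl⟩

@[simp] theorem glueEdge_left (T₁ : OrderedForest (Vertex k) (size k))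
    (T₂ : OrderedForest (Vertex l) (size l)) (c : Fin (size k)) :
    glueEdge T₁ T₂ (idxLeft k l c) = (T₁.edge c).map (Option.map (varLeft k l)) := by
  simp [glueEdge, idxLeft]

@[simp] theorem glueEdge_right (T₁ : OrderedForest (Vertex k) (size k))
    (T₂ : OrderedForest (Vertex l) (size l)) (c : Fin (size l)) :
    glueEdge T₁ T₂ (idxRight k l c) = (T₂.edge c).map (Option.map (varRight k l)) := by
  simp [glueEdge, idxRight]

theorem glueEdge_collapseRight (T₁ : OrderedForest (Vertex k) (size k))
    (T₂ : OrderedForest (Vertex l) (size l)) (a : Fin (size (k + l))) {x y : Vertex (k + l)}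
    (h : glueEdge T₁ T₂ a = s(x, y)) :
    (∃ c, a = idxLeft k l c ∧ T₁.edge c = s(collapseRight k l x, collapseRight k l y)) ∨
      collapseRight k l x = collapseRight k l y := by
  rcases idx_cases a with ⟨c, rfl⟩ | ⟨c, rfl⟩
  · left
    refine ⟨c, rfl, ?_⟩
    rw [glueEdge_left] at h
    induction hc : T₁.edge c with
    | h u v =>
    rw [hc] at h
    simpa using congrArg (Sym2.map (collapseRight k l)) h
  · right
    rw [glueEdge_right] at h
    induction hc : T₂.edge c with
    | h u v =>
    rw [hc] at h
    have := congrArg (Sym2.map (collapseRight k l)) h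
    rw [Sym2.map_mk, Sym2.map_mk, Sym2.map_mk] at this
    simp only [collapseRight_right, Sym2.eq_iff] at this
    rcases this with ⟨h1, h2⟩ | ⟨h1, h2⟩
    · exact h1.symm.trans h2
    · exact h2.symm.trans h1

theorem glueEdge_collapseLeft (T₁ : OrderedForest (Vertex k) (size k))
    (T₂ : OrderedForest (Vertex l) (size l)) (a : Fin (size (k + l))) {x y : Vertex (k + l)}
    (h : glueEdge T₁ T₂ a = s(x, y)) :
    (∃ c, a = idxRight k l c ∧ T₂.edge c = s(collapseLeft k l x, collapseLeft k l y)) ∨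
      collapseLeft k l x = collapseLeft k l y := by
  rcases idx_cases a with ⟨c, rfl⟩ | ⟨c, rfl⟩
  · right
    rw [glueEdge_left] at h
    induction hc : T₁.edge c with
    | h u v =>
    rw [hc] at h
    have := congrArg (Sym2.map (collapseLeft k l)) h
    rw [Sym2.map_mk, Sym2.map_mk, Sym2.map_mk] at this
    simp only [collapseLeft_left, Sym2.eq_iff] at this
    rcases this with ⟨h1, h2⟩ | ⟨h1, h2⟩
    · exact h1.symm.trans h2
    · exact h2.symm.trans h1
  · left
    refine ⟨c, rfl, ?_⟩
    rw [glueEdge_right] at h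
    induction hc : T₂.edge c with
    | h u v =>
    rw [hc] at h
    simpa using congrArg (Sym2.map (collapseLeft k l)) h

/-- The union of two trees with identified vertices `z`. -/
def glue (T₁ : OrderedForest (Vertex k) (size k)) (T₂ : OrderedForest (Vertex l) (size l)) :
    OrderedForest (Vertex (k + l)) (size (k + l)) :=
  .ofNotReachable (glueEdge T₁ T₂) (by
    intro a x y h hr
    rcases idx_cases a with ⟨c, rfl⟩ | ⟨c, rfl⟩
    · have hc : T₁.edge c = s(collapseRight k l x, collapseRight k l y) := by
        rw [glueEdge_left] at h
        simpa [Sym2.map_map, Function.comp_def] using congrArg (Sym2.map (collapseRight k l)) h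
      refine T₁.not_reachable hc (reachable_of_adj (collapseRight k l) ?_ hr)
      intro u v huv
      simp only [SimpleGraph.fromEdgeSet_adj, Set.mem_image] at huv
      obtain ⟨⟨d, hd, hduv⟩, -⟩ := huv
      rcases glueEdge_collapseRight T₁ T₂ d hduv with ⟨e, rfl, he⟩ | heq
      · refine SimpleGraph.Adj.reachable ?_
        simp only [SimpleGraph.fromEdgeSet_adj]
        refine ⟨⟨e, fun hec => hd (by rw [hec]; rfl), he⟩, fun h => ?_⟩
        exact T₁.not_isDiag e (by simp [he, h])
      · rw [heq]
    · have hc : T₂.edge c = s(collapseLeft k l x, collapseLeft k l y) := by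
        rw [glueEdge_right] at h
        simpa [Sym2.map_map, Function.comp_def] using congrArg (Sym2.map (collapseLeft k l)) h
      refine T₂.not_reachable hc (reachable_of_adj (collapseLeft k l) ?_ hr)
      intro u v huv
      simp only [SimpleGraph.fromEdgeSet_adj, Set.mem_image] at huv
      obtain ⟨⟨d, hd, hduv⟩, -⟩ := huv
      rcases glueEdge_collapseLeft T₁ T₂ d hduv with ⟨e, rfl, he⟩ | heq
      · refine SimpleGraph.Adj.reachable ?_
        simp only [SimpleGraph.fromEdgeSet_adj]
        refine ⟨⟨e, fun hec => hd (by rw [hec]; rfl), he⟩, fun h => ?_⟩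
        exact T₂.not_isDiag e (by simp [he, h])
      · rw [heq])

@[simp] theorem glue_edge (T₁ : OrderedForest (Vertex k) (size k))
    (T₂ : OrderedForest (Vertex l) (size l)) : (glue T₁ T₂).edge = glueEdge T₁ T₂ := rfl

/-- A map between vertex sets that sends edges to edges or to single vertices does not increase
distances. -/
theorem dist_map_le {V W : Type*} {G : SimpleGraph V} {H : SimpleGraph W} (f : V → W)
    (h : ∀ x y, G.Adj x y → f x = f y ∨ H.Adj (f x) (f y)) {x y : V} (hxy : G.Reachable x y) :
    H.dist (f x) (f y) ≤ G.dist x y := by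
  have key : ∀ {x y : V} (w : G.Walk x y), ∃ w' : H.Walk (f x) (f y), w'.length ≤ w.length := by
    intro x y w
    induction w with
    | nil => exact ⟨.nil, le_rfl⟩
    | cons hadj q ih =>
      obtain ⟨w', hw'⟩ := ih
      rcases h _ _ hadj with heq | hadj'
      · refine ⟨w'.copy heq.symm rfl, ?_⟩
        simp only [SimpleGraph.Walk.length_copy, SimpleGraph.Walk.length_cons]
        omega
      · exact ⟨.cons hadj' w', by simpa using hw'⟩
  obtain ⟨w, hw⟩ := hxy.exists_walk_length_eq_dist
  obtain ⟨w', hw'⟩ := key w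
  exact (SimpleGraph.dist_le w').trans (hw'.trans hw.le)

theorem dist_glue_left (T₁ : OrderedForest (Vertex k) (size k))
    (T₂ : OrderedForest (Vertex l) (size l)) (v : Vertex k) :
    (glue T₁ T₂).graph.dist none (v.map (varLeft k l)) = T₁.graph.dist none v := by
  refine le_antisymm ?_ ?_
  · have := dist_map_le (G := T₁.graph) (H := (glue T₁ T₂).graph) (Option.map (varLeft k l))
      (fun x y hxy => ?_) ((isTree_graph T₁).connected none v)
    · simpa using this
    · right
      obtain ⟨a, ha⟩ := T₁.graph_adj.1 hxy
      exact (glue T₁ T₂).graph_adj.2 ⟨idxLeft k l a, by simp [ha]⟩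
  · have := dist_map_le (G := (glue T₁ T₂).graph) (H := T₁.graph) (collapseRight k l)
      (fun x y hxy => ?_) ((isTree_graph (glue T₁ T₂)).connected none (v.map (varLeft k l)))
    · rw [collapseRight_left] at this
      exact this
    · obtain ⟨a, ha⟩ := (glue T₁ T₂).graph_adj.1 hxy
      rcases glueEdge_collapseRight T₁ T₂ a ha with ⟨c, -, hc⟩ | h
      · exact .inr (T₁.graph_adj.2 ⟨c, hc⟩)
      · exact .inl h

theorem dist_glue_right (T₁ : OrderedForest (Vertex k) (size k))
    (T₂ : OrderedForest (Vertex l) (size l)) (v : Vertex l) :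
    (glue T₁ T₂).graph.dist none (v.map (varRight k l)) = T₂.graph.dist none v := by
  refine le_antisymm ?_ ?_
  · have := dist_map_le (G := T₂.graph) (H := (glue T₁ T₂).graph) (Option.map (varRight k l))
      (fun x y hxy => ?_) ((isTree_graph T₂).connected none v)
    · simpa using this
    · right
      obtain ⟨a, ha⟩ := T₂.graph_adj.1 hxy
      exact (glue T₁ T₂).graph_adj.2 ⟨idxRight k l a, by simp [ha]⟩
  · have := dist_map_le (G := (glue T₁ T₂).graph) (H := T₂.graph) (collapseLeft k l)
      (fun x y hxy => ?_) ((isTree_graph (glue T₁ T₂)).connected none (v.map (varRight k l)))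
    · rw [collapseLeft_right] at this
      exact this
    · obtain ⟨a, ha⟩ := (glue T₁ T₂).graph_adj.1 hxy
      rcases glueEdge_collapseLeft T₁ T₂ a ha with ⟨c, -, hc⟩ | h
      · exact .inr (T₂.graph_adj.2 ⟨c, hc⟩)
      · exact .inl h

theorem isHead_glue_left (T₁ : OrderedForest (Vertex k) (size k))
    (T₂ : OrderedForest (Vertex l) (size l)) (a : Fin (size k)) {v : Vertex k}
    (h : IsHead T₁ a v) : IsHead (glue T₁ T₂) (idxLeft k l a) (v.map (varLeft k l)) := by
  obtain ⟨u, hu, hlt⟩ := h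
  exact ⟨u.map (varLeft k l), by simp [hu], by rwa [dist_glue_left, dist_glue_left]⟩

theorem isHead_glue_right (T₁ : OrderedForest (Vertex k) (size k))
    (T₂ : OrderedForest (Vertex l) (size l)) (a : Fin (size l)) {v : Vertex l}
    (h : IsHead T₂ a v) : IsHead (glue T₁ T₂) (idxRight k l a) (v.map (varRight k l)) := by
  obtain ⟨u, hu, hlt⟩ := h
  exact ⟨u.map (varRight k l), by simp [hu], by rwa [dist_glue_right, dist_glue_right]⟩

/-- The numbers of the edges of the union. -/
def rowEquiv (k l : Fin r → ℕ) : Fin (size k) ⊕ Fin (size l) ≃ Fin (size (k + l)) :=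
  finSumFinEquiv.trans (finCongr (size_add k l).symm)

/-- The positions of the symbols of `T(k)` and `T(l)` in `T(k + l)`. -/
def colEquiv (k l : Fin r → ℕ) : Fin (size k) ⊕ Fin (size l) ≃ Fin (size (k + l)) :=
  ((Equiv.sumCongr finSigmaFinEquiv finSigmaFinEquiv).symm.trans (varEquiv k l)).trans
    finSigmaFinEquiv

/-- The sign of the permutation that moves the symbols of `T(k)`, followed by those of `T(l)`, to
their places in `T(k + l)`. -/
def shuffleSign (k l : Fin r → ℕ) : ℂ :=
  ((Equiv.Perm.sign ((colEquiv k l).trans (rowEquiv k l).symm) : ℤ) : ℂ)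

theorem headMatrix_glue (T₁ : OrderedForest (Vertex k) (size k))
    (T₂ : OrderedForest (Vertex l) (size l)) :
    (headMatrix (glue T₁ T₂)).submatrix (rowEquiv k l) (colEquiv k l) =
      Matrix.fromBlocks (headMatrix T₁) 0 0 (headMatrix T₂) := by
  classical
  have huniq : ∀ {a : Fin (size (k + l))} {v w : Vertex (k + l)},
      IsHead (glue T₁ T₂) a v → IsHead (glue T₁ T₂) a w → v = w := by
    rintro a v w ⟨u, hu, hlt⟩ ⟨u', hu', hlt'⟩
    rw [hu, Sym2.eq_iff] at hu'
    rcases hu' with ⟨rfl, rfl⟩ | ⟨rfl, rfl⟩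
    · rfl
    · omega
  have hrow : ∀ a, rowEquiv k l (.inl a) = idxLeft k l a := fun a => rfl
  have hrow' : ∀ a, rowEquiv k l (.inr a) = idxRight k l a := fun a => rfl
  have hcol : ∀ b, finSigmaFinEquiv.symm (colEquiv k l (.inl b)) =
      varLeft k l (finSigmaFinEquiv.symm b) := fun b => by simp [colEquiv]
  have hcol' : ∀ b, finSigmaFinEquiv.symm (colEquiv k l (.inr b)) =
      varRight k l (finSigmaFinEquiv.symm b) := fun b => by simp [colEquiv]
  ext a b
  rcases a with a | a
  · obtain ⟨c, hc, -⟩ := existsUnique_head T₁ a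
    have hg := isHead_glue_left T₁ T₂ a hc
    rcases b with b | b
    · simp only [Matrix.submatrix_apply, headMatrix, Matrix.of_apply, Matrix.fromBlocks_apply₁₁,
        hrow, hcol]
      refine if_congr ⟨fun h => ?_, fun h => isHead_glue_left T₁ T₂ a h⟩ rfl rfl
      have := congrArg (collapseRight k l) (huniq hg h)
      rw [collapseRight_left] at this
      rw [show some (varLeft k l (finSigmaFinEquiv.symm b)) =
        (some (finSigmaFinEquiv.symm b)).map (varLeft k l) from rfl, collapseRight_left] at this
      rwa [← this]
    · simp only [Matrix.submatrix_apply, headMatrix, Matrix.of_apply, Matrix.fromBlocks_apply₁₂,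
        hrow, hcol', Matrix.zero_apply]
      refine if_neg fun h => ?_
      have := congrArg (collapseRight k l) (huniq hg h)
      rw [collapseRight_left] at this
      rw [show some (varRight k l (finSigmaFinEquiv.symm b)) =
        (some (finSigmaFinEquiv.symm b)).map (varRight k l) from rfl, collapseRight_right] at this
      simp at this
  · obtain ⟨c, hc, -⟩ := existsUnique_head T₂ a
    have hg := isHead_glue_right T₁ T₂ a hc
    rcases b with b | b
    · simp only [Matrix.submatrix_apply, headMatrix, Matrix.of_apply, Matrix.fromBlocks_apply₂₁,
        hrow', hcol, Matrix.zero_apply]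
      refine if_neg fun h => ?_
      have := congrArg (collapseLeft k l) (huniq hg h)
      rw [collapseLeft_right] at this
      rw [show some (varLeft k l (finSigmaFinEquiv.symm b)) =
        (some (finSigmaFinEquiv.symm b)).map (varLeft k l) from rfl, collapseLeft_left] at this
      simp at this
    · simp only [Matrix.submatrix_apply, headMatrix, Matrix.of_apply, Matrix.fromBlocks_apply₂₂,
        hrow', hcol']
      refine if_congr ⟨fun h => ?_, fun h => isHead_glue_right T₁ T₂ a h⟩ rfl rfl
      have := congrArg (collapseLeft k l) (huniq hg h)
      rw [collapseLeft_right] at this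
      rw [show some (varRight k l (finSigmaFinEquiv.symm b)) =
        (some (finSigmaFinEquiv.symm b)).map (varRight k l) from rfl, collapseLeft_right] at this
      rwa [← this]

theorem treeSign_glue (T₁ : OrderedForest (Vertex k) (size k))
    (T₂ : OrderedForest (Vertex l) (size l)) :
    treeSign T₁ * treeSign T₂ * treeSign (glue T₁ T₂) = shuffleSign k l := by
  have h1 : (headMatrix (glue T₁ T₂)).submatrix (rowEquiv k l) (colEquiv k l) =
      ((headMatrix (glue T₁ T₂)).submatrix (rowEquiv k l) (rowEquiv k l)).submatrix id
        ((colEquiv k l).trans (rowEquiv k l).symm) := by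
    ext a b
    simp
  have h2 := congrArg Matrix.det (headMatrix_glue T₁ T₂)
  rw [h1, Matrix.det_permute', Matrix.det_submatrix_equiv_self, Matrix.det_fromBlocks_zero₂₁] at h2
  change shuffleSign k l * treeSign (glue T₁ T₂) = treeSign T₁ * treeSign T₂ at h2
  rw [← h2, mul_assoc, treeSign_mul_self, mul_one]

/-- The star-product of two trees. -/
def starTree (T₁ : OrderedForest (Vertex k) (size k)) (T₂ : OrderedForest (Vertex l) (size l)) :
    TreeSpace (k + l) :=
  (treeSign T₁ * treeSign T₂ * treeSign (glue T₁ T₂) /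
    ∏ i, (((k i).factorial * (l i).factorial : ℕ) : ℂ)) •
      asym (k + l) (ForestSpace.mk (glue T₁ T₂))

/-- The bilinear extension of the star-product of trees. -/
def starBilin (k l : Fin r → ℕ) : TreeSpace k →ₗ[ℂ] TreeSpace l →ₗ[ℂ] TreeSpace (k + l) :=
  ForestSpace.lift
    (fun T₁ => ForestSpace.lift (fun T₂ => starTree T₁ T₂)
      (by
        rintro S₁ S₂ ⟨a, b, hab, h⟩
        rw [starTree, starTree, treeSign_glue, treeSign_glue, ← smul_add, ← map_add,
          ForestSpace.mk_swap, map_zero, smul_zero]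
        refine ⟨idxRight k l a, idxRight k l b, fun h => hab ?_, fun c => ?_⟩
        · simpa [idxRight, Fin.ext_iff] using h
        · rw [glue_edge, glue_edge]
          rcases idx_cases c with ⟨d, rfl⟩ | ⟨d, rfl⟩
          · rw [Equiv.swap_apply_of_ne_of_ne, glueEdge_left, glueEdge_left] <;>
              simp [idxLeft, idxRight, Fin.ext_iff] <;> omega
          · have hi : Function.Injective (idxRight k l) := fun x y hxy => by
              simpa [idxRight, Fin.ext_iff] using hxy
            rw [← hi.map_swap, glueEdge_right, glueEdge_right, h])
      (by
        rintro S₁ S₂ S₃ ⟨a, b, u, v, w, hab, ⟨h1, h2⟩, ⟨h3, h4⟩, ⟨h5, h6⟩, h⟩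
        rw [starTree, starTree, starTree, treeSign_glue, treeSign_glue, treeSign_glue, ← smul_add,
          ← smul_add, ← map_add, ← map_add, ForestSpace.mk_triangle, map_zero, smul_zero]
        refine ⟨idxRight k l a, idxRight k l b, u.map (varRight k l), v.map (varRight k l),
          w.map (varRight k l), fun h => hab ?_, ?_, ?_, ?_, fun c hca hcb => ?_⟩
        · simpa [idxRight, Fin.ext_iff] using h
        · simp [h1, h2]
        · simp [h3, h4]
        · simp [h5, h6]
        · rcases idx_cases c with ⟨d, rfl⟩ | ⟨d, rfl⟩
          · simp
          · have := h d (fun h => hca (by rw [h])) (fun h => hcb (by rw [h]))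
            simp [this]))
    (by
      rintro S₁ S₂ ⟨a, b, hab, h⟩
      refine ForestSpace.hom_ext fun T => ?_
      rw [LinearMap.add_apply, ForestSpace.lift_mk, ForestSpace.lift_mk, LinearMap.zero_apply]
      rw [starTree, starTree, treeSign_glue, treeSign_glue, ← smul_add, ← map_add,
        ForestSpace.mk_swap, map_zero, smul_zero]
      refine ⟨idxLeft k l a, idxLeft k l b, fun h => hab ?_, fun c => ?_⟩
      · simpa [idxLeft, Fin.ext_iff] using h
      · rw [glue_edge, glue_edge]
        rcases idx_cases c with ⟨d, rfl⟩ | ⟨d, rfl⟩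
        · have hi : Function.Injective (idxLeft k l) := fun x y hxy => by
            simpa [idxLeft, Fin.ext_iff] using hxy
          rw [← hi.map_swap, glueEdge_left, glueEdge_left, h]
        · rw [Equiv.swap_apply_of_ne_of_ne, glueEdge_right, glueEdge_right] <;>
            simp [idxLeft, idxRight, Fin.ext_iff] <;> omega)
    (by
      rintro S₁ S₂ S₃ ⟨a, b, u, v, w, hab, ⟨h1, h2⟩, ⟨h3, h4⟩, ⟨h5, h6⟩, h⟩
      refine ForestSpace.hom_ext fun T => ?_
      rw [LinearMap.add_apply, LinearMap.add_apply, ForestSpace.lift_mk, ForestSpace.lift_mk,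
        ForestSpace.lift_mk, LinearMap.zero_apply]
      rw [starTree, starTree, starTree, treeSign_glue, treeSign_glue, treeSign_glue, ← smul_add,
        ← smul_add, ← map_add, ← map_add, ForestSpace.mk_triangle, map_zero, smul_zero]
      refine ⟨idxLeft k l a, idxLeft k l b, u.map (varLeft k l), v.map (varLeft k l),
        w.map (varLeft k l), fun h => hab ?_, ?_, ?_, ?_, fun c hca hcb => ?_⟩
      · simpa [idxLeft, Fin.ext_iff] using h
      · simp [h1, h2]
      · simp [h3, h4]
      · simp [h5, h6]
      · rcases idx_cases c with ⟨d, rfl⟩ | ⟨d, rfl⟩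
        · have := h d (fun h => hca (by rw [h])) (fun h => hcb (by rw [h]))
          simp [this]
        · simp)

@[simp] theorem starBilin_mk (T₁ : OrderedForest (Vertex k) (size k))
    (T₂ : OrderedForest (Vertex l) (size l)) :
    starBilin k l (ForestSpace.mk T₁) (ForestSpace.mk T₂) = starTree T₁ T₂ := by
  simp [starBilin]

theorem starBilin_mem (x : TreeSpace k) (y : TreeSpace l) : starBilin k l x y ∈ A (k + l) := by
  have : (A (k + l)).mkQ ∘ₗ starBilin k l x = 0 := by
    have h2 : (LinearMap.compRight ℂ (A (k + l)).mkQ) ∘ₗ starBilin k l = 0 := by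
      refine ForestSpace.hom_ext fun T₁ => ForestSpace.hom_ext fun T₂ => ?_
      simp only [LinearMap.comp_apply, LinearMap.compRight_apply, starBilin_mk,
        LinearMap.zero_apply, Submodule.mkQ_apply, Submodule.Quotient.mk_eq_zero]
      exact (A (k + l)).smul_mem _ (asym_mem _ _)
    exact LinearMap.congr_fun h2 x
  have := LinearMap.congr_fun this y
  simpa using this

/-- The star-product of elements of `A(k)` and `A(l)`. -/
def starMul (x : A k) (y : A l) : A (k + l) :=
  ⟨starBilin k l x y, starBilin_mem _ _⟩

end Star

/-- The star-product on the direct sum of all `A(k)`. -/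
instance : DirectSum.GNonUnitalNonAssocSemiring (fun k : Fin r → ℕ => A k) where
  mul x y := starMul x y
  mul_zero x := Subtype.ext (by simp [starMul])
  zero_mul y := Subtype.ext (by simp [starMul])
  mul_add x y z := Subtype.ext (by simp [starMul])
  add_mul x y z := Subtype.ext (by simp [starMul])

instance : IsEmpty (Fin (size (0 : Fin r → ℕ))) := by
  simp only [size, Pi.zero_apply, Finset.sum_const_zero]
  infer_instance

/-- The graph `T₀` with the single vertex `z` and without edges. -/
def emptyTree : OrderedForest (Vertex (0 : Fin r → ℕ)) (size (0 : Fin r → ℕ)) :=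
  .ofNotReachable (fun a => isEmptyElim a) (fun a => isEmptyElim a)

/-- The empty star-product is the class of `T₀`. -/
instance : GradedMonoid.GOne (fun k : Fin r → ℕ => A k) where
  one := ⟨ForestSpace.mk emptyTree, by
    intro π
    have : π = 1 := funext fun i => Equiv.ext fun j => j.elim0
    subst this
    have h : (emptyTree (r := r)).map (vertexPerm 1) = emptyTree := by
      ext1
      funext a
      exact isEmptyElim a
    simp [permute, permSign, h]⟩

end CanonicalElement

namespace CanonicalElement

/-! ### The free algebra, the pairing and the canonical element -/

section Pairing

variable {r : ℕ}

/-- The `k`-multiindices: maps `J` from `{1, …, |k|}` to `{1, …, r}` taking each value `i` exactly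
`k i` times. -/
abbrev Multiindex (k : Fin r → ℕ) : Type :=
  {J : Fin (size k) → Fin r // ∀ i, (Finset.univ.filter fun a => J a = i).card = k i}

variable {k : Fin r → ℕ}

namespace Multiindex

/-- The function `c` (with values counted from `0`), whose restriction to each fibre `J⁻¹(i)` is
the increasing function onto `{0, …, k i - 1}`. -/
def count (J : Multiindex k) (a : Fin (size k)) : Fin (k (J.1 a)) :=
  ⟨(Finset.univ.filter fun b => b < a ∧ J.1 b = J.1 a).card, by
    refine lt_of_lt_of_eq (Finset.card_lt_card ?_) (J.2 (J.1 a))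
    rw [Finset.ssubset_iff_of_subset (fun b hb => by simp_all)]
    exact ⟨a, by simp, by simp⟩⟩

/-- The sign of a multiindex: `(-1) ^ m`, with `m` the minimal number of transpositions of
neighbours that sort the list `J(1), …, J(|k|)`, i.e. its number of inversions. -/
def sgn (J : Multiindex k) : ℂ :=
  (-1) ^ (Finset.univ.filter fun ab : Fin (size k) × Fin (size k) =>
    ab.1 < ab.2 ∧ J.1 ab.2 < J.1 ab.1).card

/-- The word `J(|k|), …, J(2), J(1)`. -/
def word (J : Multiindex k) : List (Fin r) := (List.ofFn J.1).reverse

/-- The monomial `f̃_J = f̃_{J(|k|)} ⋯ f̃_{J(2)} f̃_{J(1)}`. -/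
def monomial (J : Multiindex k) : FreeAlgebra ℂ (Fin r) :=
  (J.word.map (FreeAlgebra.ι ℂ)).prod

/-- The linear form `⟨f̃_J, -⟩` on `A(k)`: the sign of `J` times the constant of the iterated
residue, first at `t_{c(1)}^{(J(1))}`, then at `t_{c(2)}^{(J(2))}`, and so on. -/
def form (J : Multiindex k) : A k →ₗ[ℂ] ℂ :=
  J.sgn • iteratedResidue (none : Vertex k) (size k) (fun a => some ⟨J.1 a, J.count a⟩) ∘ₗ
    (A k).subtype

end Multiindex

/-- The subspace `U[k]` of the elements of degree `k` in the free associative algebra `U_r`. -/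
def freePart (k : Fin r → ℕ) : Submodule ℂ (FreeAlgebra ℂ (Fin r)) :=
  Submodule.span ℂ (Set.range (Multiindex.monomial (k := k)))

theorem basisFreeMonoid_word (J : Multiindex k) :
    FreeAlgebra.basisFreeMonoid ℂ (Fin r) (FreeMonoid.ofList J.word) = J.monomial := by
  simp [FreeAlgebra.basisFreeMonoid, Multiindex.monomial, FreeAlgebra.equivMonoidAlgebraFreeMonoid]

/-- The pairing between `U[k]` and `A(k)`: the linear extension of `f̃_J ↦ ⟨f̃_J, -⟩`. -/
def pairing (k : Fin r → ℕ) : freePart k →ₗ[ℂ] Module.Dual ℂ (A k) :=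
  (∑ J : Multiindex k,
    ((FreeAlgebra.basisFreeMonoid ℂ (Fin r)).coord (FreeMonoid.ofList J.word)).smulRight J.form) ∘ₗ
    (freePart k).subtype

theorem monomial_mem (J : Multiindex k) : J.monomial ∈ freePart k :=
  Submodule.subset_span ⟨J, rfl⟩

theorem pairing_monomial (J : Multiindex k) : pairing k ⟨J.monomial, monomial_mem J⟩ = J.form := by
  classical
  have hinj : ∀ J' : Multiindex k, FreeMonoid.ofList J.word = FreeMonoid.ofList J'.word →
      J' = J := by
    intro J' h
    have h2 := FreeMonoid.ofList.injective h
    rw [Multiindex.word, Multiindex.word, List.reverse_inj, List.ofFn_inj] at h2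
    exact Subtype.ext h2.symm
  simp only [pairing, LinearMap.comp_apply, Submodule.subtype_apply, LinearMap.sum_apply,
    LinearMap.smulRight_apply, ← basisFreeMonoid_word, Module.Basis.coord_apply,
    Module.Basis.repr_self]
  rw [Finset.sum_eq_single J]
  · simp
  · intro J' _ hJ'
    rw [Finsupp.single_eq_of_ne (fun h => hJ' (hinj J' h.symm)), zero_smul]
  · simp

/-- `ω` is the canonical element of `A(k) ⊗ U[k]`: under the map that sends `x ⊗ u` to the
endomorphism `u' ↦ ⟨u', x⟩ u` of `U[k]` it corresponds to the identity. -/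
def IsCanonicalElement (ω : A k ⊗[ℂ] freePart k) : Prop :=
  ∀ u : freePart k,
    TensorProduct.lid ℂ (freePart k) ((pairing k u).rTensor (freePart k) ω) = u

end Pairing

/-! ### The nilpotent part of a simple Lie algebra and PBW expansions -/

section Lie

open LieAlgebra LieAlgebra.IsKilling

variable {L : Type*} [LieRing L] [LieAlgebra ℂ L] [FiniteDimensional ℂ L] [LieAlgebra.IsSimple ℂ L]
  {H : LieSubalgebra ℂ L} [H.IsCartanSubalgebra]

/-- The positive roots with respect to a base. -/
abbrev PositiveRoot (b : (rootSystem H).Base) : Type _ := {γ : H.root // b.IsPos γ}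

/-- The nilpotent subalgebra `𝔫` of the Cartan decomposition `𝔤 = 𝔫 ⊕ 𝔥 ⊕ 𝔫₊`: the sum of the
root spaces `𝔫_γ` of the roots `-γ`, where `γ` runs through the positive roots. -/
def nilpotentPart (b : (rootSystem H).Base) : LieSubalgebra ℂ L where
  __ := ⨆ γ : PositiveRoot b, (rootSpace H (-(γ.1.1 : H → ℂ))).toSubmodule
  lie_mem' := by
    intro x y hx hy
    simp only [AddSubsemigroup.mem_carrier, AddSubmonoid.mem_toSubsemigroup,
      Submodule.mem_toAddSubmonoid] at hx hy ⊢
    induction hx using Submodule.iSup_induction' with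
    | zero => simp
    | add x₁ x₂ _ _ h₁ h₂ => rw [add_lie]; exact add_mem h₁ h₂
    | mem γ x hx =>
    induction hy using Submodule.iSup_induction' with
    | zero => simp
    | add y₁ y₂ _ _ h₁ h₂ => rw [lie_add]; exact add_mem h₁ h₂
    | mem δ y hy =>
    have hxy : ⁅x, y⁆ ∈ rootSpace H (-(γ.1.1 : H → ℂ) + -(δ.1.1 : H → ℂ)) :=
      lie_mem_genWeightSpace_of_mem_genWeightSpace hx hy
    by_cases hbot : rootSpace H (-(γ.1.1 : H → ℂ) + -(δ.1.1 : H → ℂ)) = ⊥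
    · rw [hbot, LieSubmodule.mem_bot] at hxy
      rw [hxy]
      exact zero_mem _
    let w : LieModule.Weight ℂ H L := ⟨_, hbot⟩
    have hw : ∀ h : H, (-w) h = γ.1.1 h + δ.1.1 h := by
      intro h
      rw [LieModule.Weight.coe_neg]
      change -(-(γ.1.1 h) + -(δ.1.1 h)) = _
      ring
    have hw0 : (-w).IsNonZero := by
      intro h0
      have h1 : (rootSystem H).root γ.1 = -(rootSystem H).root δ.1 := by
        ext h
        have h2 := hw h
        rw [h0] at h2
        simpa [eq_neg_iff_add_eq_zero] using h2.symm
      let := (rootSystem H).indexNeg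
      have h3 : γ.1 = -δ.1 := by
        apply (rootSystem H).root.injective
        rw [h1, RootPairing.indexNeg_neg, RootPairing.root_reflectionPerm,
          RootPairing.reflection_apply_self]
      have h4 := (RootPairing.Base.IsPos.neg_iff_not b δ.1).1 (h3 ▸ γ.2)
      exact h4 δ.2
    let w' : H.root := ⟨-w, by simpa using hw0⟩
    have hpos : b.IsPos w' := by
      refine γ.2.add δ.2 ?_
      ext h
      simpa [w'] using hw h
    refine Submodule.mem_iSup_of_mem (⟨w', hpos⟩ : PositiveRoot b) ?_
    have : -((⟨w', hpos⟩ : PositiveRoot b).1.1 : H → ℂ) =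
        -(γ.1.1 : H → ℂ) + -(δ.1.1 : H → ℂ) := by
      funext h
      have h2 := hw h
      simp only [w', Pi.neg_apply, Pi.add_apply, h2]
      ring
    rw [this]
    exact hxy

variable {b : (rootSystem H).Base} {r m : ℕ}

/-- The map `q` from the free algebra `U_r` to `U(𝔫)` sending the generator `f̃_i` to `f_i`. -/
def quotientMap (f : Fin r → nilpotentPart b) :
    FreeAlgebra ℂ (Fin r) →ₐ[ℂ] UniversalEnvelopingAlgebra ℂ (nilpotentPart b) :=
  FreeAlgebra.lift ℂ fun i => UniversalEnvelopingAlgebra.ι ℂ (f i)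

/-- The image of an element of `A(k) ⊗ U[k]` under `id ⊗ q`, in `A(k) ⊗ U(𝔫)`. -/
def projectTensor (f : Fin r → nilpotentPart b) {k : Fin r → ℕ} (ω : A k ⊗[ℂ] freePart k) :
    A k ⊗[ℂ] UniversalEnvelopingAlgebra ℂ (nilpotentPart b) :=
  ((quotientMap f).toLinearMap ∘ₗ (freePart k).subtype).lTensor (A k) ω

/-- The PBW monomial `F^p = F_1^{p_1} ⋯ F_m^{p_m}` in `U(𝔫)`. -/
def pbwMonomial (F : Fin m → nilpotentPart b) (p : Fin m → ℕ) :
    UniversalEnvelopingAlgebra ℂ (nilpotentPart b) :=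
  (List.ofFn fun j => UniversalEnvelopingAlgebra.ι ℂ (F j) ^ p j).prod

/-- The degree `∑ⱼ pⱼ d⁽ʲ⁾` of a PBW monomial whose factors have the degrees `d⁽ʲ⁾`. -/
def pbwDegree (d : Fin m → Fin r → ℕ) (p : Fin m → ℕ) : Fin r → ℕ := ∑ j, p j • d j

/-- For every `k`, the image of `Ω k` under `id ⊗ q` is the sum of the `T k p ⊗ F^p` over the
exponents `p` of degree `k`. The family `T k` is finitely supported and is taken to vanish at the
exponents of other degrees. -/
def IsPBWExpansion (f : Fin r → nilpotentPart b) (F : Fin m → nilpotentPart b)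
    (d : Fin m → Fin r → ℕ) (Ω : ∀ k : Fin r → ℕ, A k ⊗[ℂ] freePart k)
    (T : ∀ k : Fin r → ℕ, (Fin m → ℕ) →₀ A k) : Prop :=
  ∀ k, (∀ p, pbwDegree d p ≠ k → T k p = 0) ∧
    projectTensor f (Ω k) = (T k).sum fun p t => t ⊗ₜ[ℂ] pbwMonomial F p

/-- The star-product of `p₁` copies of `η₁`, …, `p_m` copies of `η_m`, in this order, in the direct
sum of all `A(k)` (bracketed from the right and ending with the class of `T₀`; the star-product is
associative with unit `T₀`). -/
def starMonomial {d : Fin m → Fin r → ℕ} (η : ∀ j, A (d j)) (p : Fin m → ℕ) :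
    ⨁ k : Fin r → ℕ, A k :=
  (List.ofFn fun j =>
    List.replicate (p j) (DirectSum.of (fun k : Fin r → ℕ => A k) (d j) (η j))).flatten.prod

/-- The product formula for the coefficients `T` in terms of the elements `η`. -/
def ProductFormula {d : Fin m → Fin r → ℕ} (T : ∀ k : Fin r → ℕ, (Fin m → ℕ) →₀ A k)
    (η : ∀ j, A (d j)) : Prop :=
  ∀ p : Fin m → ℕ,
    DirectSum.of (fun k : Fin r → ℕ => A k) (pbwDegree d p) (T (pbwDegree d p) p) =
      (1 / ∏ j, ((p j).factorial : ℂ)) • starMonomial η p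

end Lie

end CanonicalElement

end

open CanonicalElement

/-!
Modulo the relations, every ordered tree is a combination of paths that start at `z`
(`mk_mem_span_pathTree`): if two vertices have the same parent, the triangle relation attaches one
of them to the other. For a numbering `s` of the variables, the iterated residue along `s` is, up
to a sign that depends only on the tree, the indicator function of the trees of which `s` is a
linear extension (`orderForm_ofParent`). A path has exactly one linear extension, so the paths and
the iterated residues are dual bases. On `A(k)` it follows that the forms `⟨f̃_J, -⟩` separate the
points and have a dual family, given by antisymmetrized paths (`A.ext_form`,
`Multiindex.form_dual`). This gives the existence and the uniqueness of the canonical element, and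
it identifies the elements of `A(k)` with linear forms of degree `k` on the free algebra
(`functional`).

Under this identification the star-product is the convolution product for the coproduct of the
free algebra with primitive generators (`functional_starMul`): the linear extensions of the union
of two trees are the shuffles of the linear extensions of the two trees.

The elements `F_{β_j}` are linearly independent primitive elements of `U(𝔫)`, for which the
coproduct is the usual one. In characteristic zero the ordered monomials in such elements are
linearly independent (`linearIndependent_dividedMonomial`). Products of the generators straighten
to ordered monomials of the same degree, since `[F_β, F_γ]` is a multiple of `F_{β+γ}` or zero
(`prod_map_mem_span_orderedMonomial`, `commutator_mem_span`). Hence `T_p` exists and is unique: as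
a linear form on the free algebra it sends `u` to the coefficient of `F^p` in `q(u)`.

The divided monomials `F^{(p)} = F^p / ∏ p_j!` satisfy `Δ(F^{(n)}) = ∑_{p + p' = n} F^{(p)} ⊗
F^{(p')}`. The forms that take their coefficients, which are represented by the elements `(∏ p_j!)
T_p`, are therefore multiplicative in `p` for the convolution product
(`convolution_dividedCoeff`). So `(∏ p_j!) T_p` is the star-product of the elements `T_{1_j}`,
which is the product formula. At `p = 1_j` the formula reads `T_{1_j} = η_j`, so the `η_j` are
unique.
-/

noncomputable section

namespace CanonicalElement

/-! ### Iterated residues of trees -/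

theorem ForestSpace.mk_reorder {V : Type*} {p : ℕ} (σ : Equiv.Perm (Fin p))
    (T : OrderedForest V p) :
    mk (T.reorder σ) = ((Equiv.Perm.sign σ : ℤ) : ℂ) • mk T := by
  induction σ using Equiv.Perm.swap_induction_on' with
  | one => simp [OrderedForest.reorder]
  | mul_swap f x y hxy ih =>
    have h : mk (T.reorder f) + mk (T.reorder (f * Equiv.swap x y)) = 0 :=
      mk_swap ⟨x, y, hxy, fun c => rfl⟩
    rw [eq_neg_of_add_eq_zero_right h, ih, Equiv.Perm.sign_mul, Equiv.Perm.sign_swap hxy]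
    simp

/-- The iterated residue along the vertices `t 0, t 1, …` of a forest whose edge with number `a`
joins `t a` to `Q a` detects whether each `t a` is attached to `z` or to an earlier vertex. -/
theorem iteratedResidue_mk {V : Type*} [DecidableEq V] {z : V} {p : ℕ} (T : OrderedForest V p)
    (t Q : Fin p → V) (ht : Function.Injective t) (hz : ∀ a, t a ≠ z)
    (hT : ∀ a, T.edge a = s(Q a, t a)) [Decidable (∀ a, Q a = z ∨ ∃ b < a, Q a = t b)] :
    iteratedResidue z p t (ForestSpace.mk T) =
      if ∀ a, Q a = z ∨ ∃ b < a, Q a = t b then 1 else 0 := by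
  classical
  induction p with
  | zero => simp [iteratedResidue, constantTerm]
  | succ p ih =>
    rw [iteratedResidue, LinearMap.comp_apply, residue_mk]
    by_cases h0 : Q 0 = z
    · have hE : T.edge 0 = s(z, t 0) := by rw [hT, h0]
      have hne : ∀ a : Fin p, t a.succ ≠ t 0 := fun a h => Fin.succ_ne_zero a (ht h)
      rw [forestResidue_eq hE, Fin.val_zero, pow_zero, one_smul,
        ih (T.contract 0 hE) (fun i => t i.succ) (fun i => Function.update id (t 0) z (Q i.succ))
          (fun x y h => Fin.succ_injective _ (ht h)) (fun a => hz _)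
          (fun a => by simp [hT, hne])]
      refine if_congr ?_ rfl rfl
      rw [Fin.forall_fin_succ]
      simp only [h0, true_or, true_and]
      refine forall_congr' fun a => ?_
      rw [Fin.exists_fin_succ]
      by_cases hQ : Q a.succ = t 0
      · simp [hQ]
      · simp [hQ]
    · rw [forestResidue_eq_zero, map_zero, if_neg]
      · intro h
        rcases h 0 with h | ⟨b, hb, -⟩
        · exact h0 h
        · exact absurd hb (Fin.not_lt_zero b)
      · intro b hb
        rw [hT, Sym2.eq_iff] at hb
        rcases hb with ⟨h1, h2⟩ | ⟨h1, h2⟩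
        · have := ht h2
          subst this
          exact h0 h1
        · exact hz _ h2

/-! ### Trees as parent functions -/

section Parent

variable {X : Type*} {n : ℕ}

/-- `P` is the parent function of a tree on `X ∪ {z}` rooted at `z`, and `D` is the depth of the
vertices. -/
structure IsParent (P : X → Option X) (D : Option X → ℕ) : Prop where
  depth_none : D none = 0
  depth_some : ∀ x, D (some x) = D (P x) + 1

/-- The vertices that have `x` among their ancestors, where `x` is an ancestor of itself. -/
def Descends (P : X → Option X) (x : X) (v : Option X) : Prop :=
  ∃ i, (fun o : Option X => o.bind P)^[i] v = some x

theorem descends_self (P : X → Option X) (x : X) : Descends P x (some x) := ⟨0, rfl⟩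

theorem descends_parent_iff {P : X → Option X} {x y : X} (h : y ≠ x) :
    Descends P x (P y) ↔ Descends P x (some y) := by
  constructor
  · rintro ⟨i, hi⟩
    exact ⟨i + 1, hi⟩
  · rintro ⟨i, hi⟩
    cases i with
    | zero => exact absurd (Option.some_injective _ hi) h
    | succ i => exact ⟨i, hi⟩

theorem not_descends_none (P : X → Option X) (x : X) : ¬ Descends P x none := by
  rintro ⟨i, hi⟩
  rw [Function.iterate_fixed (by rfl)] at hi
  simp at hi

theorem IsParent.depth_le {P : X → Option X} {D : Option X → ℕ} (h : IsParent P D) {x : X}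
    {v : Option X} (hv : Descends P x v) : D (some x) ≤ D v := by
  obtain ⟨i, hi⟩ := hv
  induction i generalizing v with
  | zero => exact (congrArg D hi).ge
  | succ i ih =>
    rcases v with _ | y
    · exact absurd ⟨i, hi⟩ (not_descends_none P x)
    · have := ih (v := P y) hi
      rw [h.depth_some y]
      omega

theorem IsParent.not_descends_parent {P : X → Option X} {D : Option X → ℕ} (h : IsParent P D)
    (x : X) : ¬ Descends P x (P x) := fun hx => by
  have := h.depth_le hx
  rw [h.depth_some] at this
  omega

/-- The tree with a given parent function, whose edges are numbered by their heads. -/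
def ofParent (P : X → Option X) {D : Option X → ℕ} (h : IsParent P D) (E : Fin n ≃ X) :
    OrderedForest (Option X) n :=
  .ofNotReachable (fun a => s(P (E a), some (E a))) (by
    intro a x y hxy hr
    have key : ∀ {x y}, (SimpleGraph.fromEdgeSet
        ((fun a => s(P (E a), some (E a))) '' {a}ᶜ)).Reachable x y →
        (Descends P (E a) x ↔ Descends P (E a) y) := by
      rintro x y ⟨w⟩
      induction w with
      | nil => rfl
      | cons hadj _ ih =>
        refine Iff.trans ?_ ih
        simp only [SimpleGraph.fromEdgeSet_adj, Set.mem_image] at hadj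
        obtain ⟨⟨c, hc, hcu⟩, -⟩ := hadj
        have hne : E c ≠ E a := fun h => hc (E.injective h)
        rw [Sym2.eq_iff] at hcu
        rcases hcu with ⟨rfl, rfl⟩ | ⟨rfl, rfl⟩
        · exact descends_parent_iff hne
        · exact (descends_parent_iff hne).symm
    have h1 := key hr
    have h2 := h.not_descends_parent (E a)
    have h3 := descends_self P (E a)
    rw [Sym2.eq_iff] at hxy
    rcases hxy with ⟨rfl, rfl⟩ | ⟨rfl, rfl⟩ <;> tauto)

@[simp] theorem ofParent_edge (P : X → Option X) {D : Option X → ℕ} (h : IsParent P D)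
    (E : Fin n ≃ X) (a : Fin n) : (ofParent P h E).edge a = s(P (E a), some (E a)) := rfl

theorem IsParent.exists_depth_eq {P : X → Option X} {D : Option X → ℕ} (h : IsParent P D) (x : X)
    {j : ℕ} (hj : 1 ≤ j) (hjx : j ≤ D (some x)) : ∃ y, D (some y) = j := by
  induction hN : D (some x) generalizing x with
  | zero => omega
  | succ N ih =>
    by_cases hjN : j = N + 1
    · exact ⟨x, by omega⟩
    · have h1 := h.depth_some x
      rcases hP : P x with _ | y
      · rw [hP, h.depth_none] at h1
        omega
      · rw [hP] at h1
        exact ih y (by omega) (by omega)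

theorem IsParent.depth_le_card [Fintype X] {P : X → Option X} {D : Option X → ℕ}
    (h : IsParent P D) (x : X) : D (some x) ≤ Fintype.card X := by
  classical
  have : Finset.Icc 1 (D (some x)) ⊆ Finset.univ.image fun y => D (some y) := by
    intro j hj
    rw [Finset.mem_Icc] at hj
    simpa using h.exists_depth_eq x hj.1 hj.2
  have := (Finset.card_le_card this).trans Finset.card_image_le
  simpa using this

theorem IsParent.depth_injective {P : X → Option X} {D : Option X → ℕ} (h : IsParent P D)
    (hP : Function.Injective P) : Function.Injective D := by
  have key : ∀ N (x y : Option X), D x = N → D y = N → x = y := by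
    intro N
    induction N with
    | zero =>
      rintro (_ | x) (_ | y) hx hy
      · rfl
      · rw [h.depth_some] at hy; omega
      · rw [h.depth_some] at hx; omega
      · rw [h.depth_some] at hy; omega
    | succ N ih =>
      rintro (_ | x) (_ | y) hx hy
      · rfl
      · rw [h.depth_none] at hx; omega
      · rw [h.depth_none] at hy; omega
      · rw [h.depth_some] at hx hy
        rw [hP (ih (P x) (P y) (by omega) (by omega))]
  exact fun x y hxy => key _ x y hxy rfl

/-- Attaching the vertex `w` to its sibling `v` increases the depth of the vertices that descend
from `w` by one. -/
theorem IsParent.update [DecidableEq X] {P : X → Option X} {D : Option X → ℕ} (h : IsParent P D)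
    {v w : X} (hvw : v ≠ w) (hP : P v = P w) [DecidablePred (Descends P w)] :
    IsParent (Function.update P w (some v))
      (fun x => D x + if Descends P w x then 1 else 0) where
  depth_none := by simp [h.depth_none, not_descends_none]
  depth_some x := by
    have hD : D (some v) = D (some w) := by rw [h.depth_some, h.depth_some, hP]
    by_cases hx : x = w
    · subst hx
      have : ¬ Descends P x (some v) := by
        rw [← descends_parent_iff hvw, hP]
        exact h.not_descends_parent x
      simp [descends_self, this, hD]
    · rw [Function.update_of_ne hx, h.depth_some, ← if_congr (descends_parent_iff hx) rfl rfl]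
      omega

/-- The path that starts at the root `z` and visits the vertices in the order `s`: the parent of a
vertex is the preceding one. -/
def pathParent (s : Fin n ≃ X) (x : X) : Option X :=
  if h : (s.symm x : ℕ) = 0 then none
  else some (s ⟨(s.symm x : ℕ) - 1, by have := (s.symm x).2; omega⟩)

theorem isParent_pathParent (s : Fin n ≃ X) :
    IsParent (pathParent s) (fun v => v.elim 0 fun x => (s.symm x : ℕ) + 1) where
  depth_none := rfl
  depth_some x := by
    simp only [pathParent, Option.elim_some]
    split_ifs with h
    · simp [h]
    · simp only [Option.elim_some, Equiv.symm_apply_apply]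
      omega

/-- The path starting at `z` that visits the vertices in the order `s`, with its edges numbered in
this order. -/
def pathTree (s : Fin n ≃ X) : OrderedForest (Option X) n :=
  ofParent (pathParent s) (isParent_pathParent s) s

theorem mk_mem_span_pathTree_of_injective [Fintype X] {P : X → Option X} {D : Option X → ℕ}
    (h : IsParent P D) (hP : Function.Injective P) (E : Fin n ≃ X) :
    ForestSpace.mk (ofParent P h E) ∈
      Submodule.span ℂ (Set.range fun s : Fin n ≃ X => ForestSpace.mk (pathTree s)) := by
  have hcard : Fintype.card X = n := by simpa using (Fintype.card_congr E).symm
  have hD := h.depth_injective hP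
  let g : X → Fin n := fun x => ⟨D (some x) - 1, by
    have := h.depth_le_card x
    have := h.depth_some x
    omega⟩
  have hg : Function.Injective g := by
    intro x y hxy
    simp only [g, Fin.mk.injEq] at hxy
    have h1 := h.depth_some x
    have h2 := h.depth_some y
    exact Option.some_injective _ (hD (by omega))
  have hg' : Function.Bijective g := by
    rw [Fintype.bijective_iff_injective_and_card]
    exact ⟨hg, by simpa using hcard⟩
  let s : Fin n ≃ X := (Equiv.ofBijective g hg').symm
  have hs : ∀ x, (s.symm x : ℕ) = D (P x) := fun x => by
    change D (some x) - 1 = _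
    rw [h.depth_some]
    omega
  have hPs : P = pathParent s := by
    funext x
    rw [pathParent]
    split_ifs with h0
    · rw [hs] at h0
      exact hD (h0.trans h.depth_none.symm)
    · refine hD ?_
      have h1 := hs x
      have h2 := h.depth_some (s ⟨(s.symm x : ℕ) - 1, by have := (s.symm x).2; omega⟩)
      have h3 := hs (s ⟨(s.symm x : ℕ) - 1, by have := (s.symm x).2; omega⟩)
      simp only [Equiv.symm_apply_apply] at h3
      omega
  have : ofParent P h E = (pathTree s).reorder (E.trans s.symm) := by
    ext1
    funext a
    simp [pathTree, ← hPs]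
  rw [this, ForestSpace.mk_reorder]
  exact Submodule.smul_mem _ _ (Submodule.subset_span ⟨s, rfl⟩)

/-- The paths span: if two vertices have the same parent, then the triangle relation expresses the
tree through two trees in which one of them is attached to the other, and this increases the sum of
the depths. -/
theorem mk_mem_span_pathTree [Fintype X] {P : X → Option X} {D : Option X → ℕ}
    (h : IsParent P D) (E : Fin n ≃ X) :
    ForestSpace.mk (ofParent P h E) ∈
      Submodule.span ℂ (Set.range fun s : Fin n ≃ X => ForestSpace.mk (pathTree s)) := by
  classical
  induction hN : Fintype.card X * Fintype.card X - ∑ x, D (some x) using Nat.strong_induction_on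
    generalizing P D E with
  | _ N ih =>
  -- an injective parent function belongs to a path
  by_cases hP : Function.Injective P
  · exact mk_mem_span_pathTree_of_injective h hP E
  simp only [Function.Injective, not_forall] at hP
  obtain ⟨v, w, hvw, hne⟩ := hP
  have bound : ∀ {P : X → Option X} {D : Option X → ℕ}, IsParent P D →
      ∑ x, D (some x) ≤ Fintype.card X * Fintype.card X := fun h => by
    refine (Finset.sum_le_card_nsmul _ _ _ fun x _ => h.depth_le_card x).trans ?_
    simp
  have incr : ∀ v, ∑ x, D (some x) < ∑ x, (D (some x) + if Descends P v (some x) then 1 else 0) :=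
    fun v => by
      refine Finset.sum_lt_sum (fun x _ => by omega) ⟨v, Finset.mem_univ _, ?_⟩
      simp [descends_self]
  have h2 := h.update hne hvw
  have h3 := h.update (Ne.symm hne) hvw.symm
  -- in both other terms of the triangle relation the heads of the two edges are exchanged
  let E' : Fin n ≃ X := (Equiv.swap (E.symm v) (E.symm w)).trans E
  have m2 := ih _ (by have := bound h; have := bound h2; have := incr w; omega) h2 E' rfl
  have m3 := ih _ (by have := bound h; have := bound h3; have := incr v; omega) h3 E' rfl
  have htri : (ofParent P h E).IsTriangle (ofParent _ h2 E') (ofParent _ h3 E') := by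
    refine ⟨E.symm v, E.symm w, P v, some v, some w, fun h => hne (E.symm.injective h),
      ?_, ?_, ?_, fun c hcv hcw => ?_⟩
    · simp [hvw]
    · simp [E', hne]
    · simp [E', hvw, Ne.symm hne]
    · have hv : E c ≠ v := fun h => hcv (by simp [← h])
      have hw : E c ≠ w := fun h => hcw (by simp [← h])
      simp [E', Equiv.swap_apply_of_ne_of_ne hcv hcw, hv, hw]
  have := ForestSpace.mk_triangle htri
  rw [add_assoc] at this
  rw [eq_neg_of_add_eq_zero_left this]
  exact neg_mem (add_mem m2 m3)

end Parent

/-! ### Linear forms given by orderings of the vertices -/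

section Ordering

variable {r : ℕ} {k : Fin r → ℕ}

theorem OrderedForest.exists_eq_ofParent (T : OrderedForest (Vertex k) (size k)) :
    ∃ (P : Var k → Option (Var k)) (D : Option (Var k) → ℕ) (h : IsParent P D)
      (E : Fin (size k) ≃ Var k), T = ofParent P h E := by
  choose e he _ using fun a => existsUnique_head T a
  have hinj : Function.Injective e := fun a b hab => isHead_inj T (he a) (hab ▸ he b)
  let E : Fin (size k) ≃ Var k :=
    (Equiv.ofBijective e (Finite.injective_iff_bijective.1 hinj)).trans finSigmaFinEquiv.symm
  have hE : ∀ a, IsHead T a (some (E a)) := he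
  choose u hu hlt using hE
  let P : Var k → Option (Var k) := fun x => u (E.symm x)
  have hP : ∀ a, T.edge a = s(P (E a), some (E a)) := fun a => by simp [P, hu]
  refine ⟨P, T.graph.dist none, ⟨SimpleGraph.dist_self, fun x => ?_⟩, E, ?_⟩
  · have h1 := hlt (E.symm x)
    rw [Equiv.apply_symm_apply] at h1
    have hadj : T.graph.Adj (P x) (some x) :=
      T.graph_adj.2 ⟨E.symm x, by simpa using hP (E.symm x)⟩
    have h2 := hadj.diff_dist_adj (u := none)
    change T.graph.dist none (P x) < _ at h1
    omega
  · ext1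
    funext a
    rw [ofParent_edge, hP]

theorem TreeSpace.hom_ext {M : Type*} [AddCommGroup M] [Module ℂ M] {f g : TreeSpace k →ₗ[ℂ] M}
    (h : ∀ (P : Var k → Option (Var k)) (D : Option (Var k) → ℕ) (hP : IsParent P D)
      (E : Fin (size k) ≃ Var k),
      f (ForestSpace.mk (ofParent P hP E)) = g (ForestSpace.mk (ofParent P hP E))) : f = g := by
  refine ForestSpace.hom_ext fun T => ?_
  obtain ⟨P, D, hP, E, rfl⟩ := T.exists_eq_ofParent
  exact h P D hP E

theorem span_pathTree :
    Submodule.span ℂ (Set.range fun s : Fin (size k) ≃ Var k => ForestSpace.mk (pathTree s)) =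
      ⊤ := by
  have h0 : Submodule.mkQ (Submodule.span ℂ
      (Set.range fun s : Fin (size k) ≃ Var k => ForestSpace.mk (pathTree s))) = 0 := by
    refine TreeSpace.hom_ext fun P D hP E => ?_
    rw [LinearMap.zero_apply, Submodule.mkQ_apply, Submodule.Quotient.mk_eq_zero]
    exact mk_mem_span_pathTree hP E
  rw [← Submodule.ker_mkQ (Submodule.span ℂ _), h0, LinearMap.ker_zero]

/-- The sign of an ordering of the symbols `t_j^{(i)}`, relative to the lexicographic order. -/
def orderSign (s : Fin (size k) ≃ Var k) : ℂ :=
  ((Equiv.Perm.sign (s.trans finSigmaFinEquiv) : ℤ) : ℂ)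

theorem orderSign_mul_self (s : Fin (size k) ≃ Var k) : orderSign s * orderSign s = 1 := by
  rw [orderSign, ← Int.cast_mul, ← Units.val_mul, Int.units_mul_self]
  simp

theorem orderSign_ne_zero (s : Fin (size k) ≃ Var k) : orderSign s ≠ 0 := fun h => by
  simpa [h] using orderSign_mul_self s

/-- The iterated residue along an ordering of the vertices, multiplied by the sign of the
ordering. -/
def orderForm (s : Fin (size k) ≃ Var k) : TreeSpace k →ₗ[ℂ] ℂ :=
  orderSign s • iteratedResidue (none : Vertex k) (size k) (fun a => some (s a))

/-- The ordering `s` is a linear extension of the tree order: parents come first. -/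
def IsLinearExtension (P : Var k → Option (Var k)) (s : Fin (size k) ≃ Var k) : Prop :=
  ∀ x y, P x = some y → s.symm y < s.symm x

open Classical in
/-- Up to a sign that depends only on the tree, `orderForm s` is the indicator function of the trees
of which `s` is a linear extension. -/
theorem orderForm_ofParent (s : Fin (size k) ≃ Var k) {P : Var k → Option (Var k)}
    {D : Option (Var k) → ℕ} (h : IsParent P D) (E : Fin (size k) ≃ Var k) :
    orderForm s (ForestSpace.mk (ofParent P h E)) =
      orderSign E * if IsLinearExtension P s then 1 else 0 := by
  have h1 : ofParent P h E = (ofParent P h s).reorder (E.trans s.symm) := by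
    ext1
    funext a
    simp
  rw [h1, ForestSpace.mk_reorder, map_smul, orderForm, LinearMap.smul_apply,
    iteratedResidue_mk _ _ (fun a => P (s a))
      (fun a b hab => s.injective (Option.some_injective _ hab)) (by simp) (fun a => rfl),
    smul_eq_mul, smul_eq_mul, ← mul_assoc]
  congr 1
  · rw [orderSign, orderSign, ← Int.cast_mul, ← Units.val_mul, mul_comm, ← Equiv.Perm.sign_trans]
    congr 3
    ext a
    simp
  · refine if_congr ⟨fun H x y hxy => ?_, fun H a => ?_⟩ rfl rfl
    · have := H (s.symm x)
      rw [Equiv.apply_symm_apply, hxy] at this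
      obtain ⟨b, hb, hb'⟩ := this.resolve_left (by simp)
      rwa [Option.some_injective _ hb', Equiv.symm_apply_apply]
    · rcases hP : P (s a) with _ | y
      · exact .inl rfl
      · exact .inr ⟨s.symm y, by simpa using H _ _ hP, by simp⟩

/-- A path has exactly one linear extension. -/
theorem isLinearExtension_pathParent {s s' : Fin (size k) ≃ Var k} :
    IsLinearExtension (pathParent s') s ↔ s = s' := by
  constructor
  · intro h
    have key : ∀ (N : ℕ) (i j : Fin (size k)), (i : ℕ) = N → j < i →
        s.symm (s' j) < s.symm (s' i) := by
      intro N
      induction N with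
      | zero => intro i j hi hj; rw [Fin.lt_def] at hj; omega
      | succ N ih =>
        intro i j hi hj
        have h1 := h (s' i) (s' ⟨N, by omega⟩) (by
          rw [pathParent, dif_neg (by simp [hi])]
          simp [hi])
        by_cases hjN : (j : ℕ) = N
        · have : j = ⟨N, by omega⟩ := Fin.ext hjN
          rwa [this]
        · rw [Fin.lt_def] at hj
          exact (ih ⟨N, by omega⟩ j rfl (by rw [Fin.lt_def]; simp; omega)).trans h1
    have hmono : StrictMono (s'.trans s.symm) := fun j i hji => key _ i j rfl hji
    have : hmono.orderIsoOfSurjective _ (s'.trans s.symm).surjective = OrderIso.refl _ :=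
      Subsingleton.elim _ _
    ext1 a
    have h2 := DFunLike.congr_fun this a
    simp only [StrictMono.coe_orderIsoOfSurjective, Equiv.trans_apply, OrderIso.refl_apply] at h2
    rw [← h2, Equiv.apply_symm_apply, h2]
  · rintro rfl x y hxy
    rw [pathParent] at hxy
    split_ifs at hxy with h
    rw [← Option.some_injective _ hxy, Equiv.symm_apply_apply, Fin.lt_def]
    simp only
    omega

open Classical in
theorem orderForm_pathTree (s s' : Fin (size k) ≃ Var k) :
    orderForm s (ForestSpace.mk (pathTree s')) = if s = s' then orderSign s' else 0 := by
  rw [pathTree, orderForm_ofParent, mul_ite, mul_one, mul_zero]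
  exact if_congr isLinearExtension_pathParent rfl rfl

/-- The iterated residues separate trees, as they are dual, up to signs, to the spanning paths. -/
theorem TreeSpace.eq_zero_of_orderForm {x : TreeSpace k} (h : ∀ s, orderForm s x = 0) :
    x = 0 := by
  classical
  have hx : x ∈ Submodule.span ℂ
      (Set.range fun s : Fin (size k) ≃ Var k => ForestSpace.mk (pathTree s)) := by
    rw [span_pathTree]; trivial
  obtain ⟨c, rfl⟩ := (Submodule.mem_span_range_iff_exists_fun ℂ).1 hx
  refine Finset.sum_eq_zero fun s _ => ?_
  have := h s
  simp only [map_sum, map_smul, orderForm_pathTree, smul_eq_mul, mul_ite, mul_zero,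
    Finset.sum_ite_eq, Finset.mem_univ, if_true, mul_eq_zero, orderSign_ne_zero, or_false] at this
  rw [this, zero_smul]

theorem sign_sigmaCongrRight (π : PermGroup k) :
    Equiv.Perm.sign (Equiv.sigmaCongrRight π) = ∏ i, Equiv.Perm.sign (π i) := by
  classical
  let f : PermGroup k →* ℤˣ :=
    Equiv.Perm.sign.comp (Equiv.Perm.sigmaCongrRightHom fun i : Fin r => Fin (k i))
  let g : PermGroup k →* ℤˣ :=
    { toFun π := ∏ i, Equiv.Perm.sign (π i)
      map_one' := by simp
      map_mul' π ρ := by simp [Finset.prod_mul_distrib] }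
  suffices f = g from DFunLike.congr_fun this π
  refine MonoidHom.pi_ext (M := fun i : Fin r => Equiv.Perm (Fin (k i))) fun i τ => ?_
  induction τ using Equiv.Perm.swap_induction_on' with
  | one => rw [Pi.mulSingle_one, map_one, map_one]
  | mul_swap τ x y hxy ih =>
    rw [Pi.mulSingle_mul, map_mul, map_mul, ih]
    congr 1
    have h1 : Equiv.sigmaCongrRight (Pi.mulSingle i (Equiv.swap x y) : PermGroup k) =
        Equiv.swap (⟨i, x⟩ : Var k) ⟨i, y⟩ := by
      refine Equiv.ext fun ⟨j, w⟩ => ?_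
      by_cases hj : j = i
      · subst hj
        have hi := @sigma_mk_injective (Fin r) (fun i => Fin (k i)) j
        simp [← hi.map_swap]
      · rw [Equiv.swap_apply_of_ne_of_ne] <;> simp [hj]
    have h2 : f (Pi.mulSingle i (Equiv.swap x y)) =
        Equiv.Perm.sign (Equiv.sigmaCongrRight (Pi.mulSingle i (Equiv.swap x y) : PermGroup k)) :=
      rfl
    rw [h2, h1, Equiv.Perm.sign_swap (by simpa using hxy)]
    change _ = ∏ j, Equiv.Perm.sign ((Pi.mulSingle i (Equiv.swap x y) : PermGroup k) j)
    rw [Finset.prod_eq_single i]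
    · simp [Equiv.Perm.sign_swap hxy]
    · intro j _ hj; simp [hj]
    · simp

theorem orderSign_trans (s : Fin (size k) ≃ Var k) (π : PermGroup k) :
    orderSign (s.trans (Equiv.sigmaCongrRight π)) = permSign π * orderSign s := by
  have h1 : (s.trans (Equiv.sigmaCongrRight π)).trans finSigmaFinEquiv =
      (s.trans finSigmaFinEquiv).trans
        ((finSigmaFinEquiv.symm.trans (Equiv.sigmaCongrRight π)).trans finSigmaFinEquiv) := by
    ext a
    simp
  rw [orderSign, h1, Equiv.Perm.sign_trans, Equiv.Perm.sign_symm_trans_trans,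
    sign_sigmaCongrRight, orderSign, permSign]
  push_cast
  rfl

/-- Permuting the vertices of a tree amounts to permuting the ordering. -/
theorem orderForm_permute (s : Fin (size k) ≃ Var k) (π : PermGroup k) (x : TreeSpace k) :
    orderForm (s.trans (Equiv.sigmaCongrRight π)) (permute π x) = permSign π * orderForm s x := by
  classical
  suffices orderForm (s.trans (Equiv.sigmaCongrRight π)) ∘ₗ permute π =
      permSign π • orderForm s from LinearMap.congr_fun this x
  refine TreeSpace.hom_ext fun P D hP E => ?_
  set σ : Equiv.Perm (Var k) := Equiv.sigmaCongrRight π with hσ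
  have hcancel : ∀ v : Option (Var k), Option.map σ.symm (Option.map σ v) = v := fun v => by
    rw [Option.map_map, Equiv.symm_comp_self, Option.map_id, id]
  have hP' : IsParent (fun x => (P (σ.symm x)).map σ) (fun v => D (v.map σ.symm)) :=
    ⟨hP.depth_none, fun x => by rw [hcancel, Option.map_some, hP.depth_some]⟩
  have hmap : (ofParent P hP E).map (vertexPerm π) = ofParent _ hP' (E.trans σ) := by
    ext1
    funext a
    rw [OrderedForest.map_edge, ofParent_edge, ofParent_edge, Sym2.map_mk, Equiv.trans_apply,
      Equiv.symm_apply_apply]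
    rfl
  rw [LinearMap.comp_apply, permute, ForestSpace.rename_mk, hmap, orderForm_ofParent,
    LinearMap.smul_apply, orderForm_ofParent, orderSign_trans, smul_eq_mul, mul_assoc]
  congr 2
  refine if_congr ⟨fun h x y hxy => ?_, fun h x y hxy => ?_⟩ rfl rfl
  · simpa using h (σ x) (σ y) (by simp [hxy])
  · simp only [Option.map_eq_some_iff] at hxy
    obtain ⟨y, hy, rfl⟩ := hxy
    simpa using h (σ.symm x) y hy

theorem orderForm_asym (s : Fin (size k) ≃ Var k) (x : TreeSpace k) :
    orderForm s (asym k x) =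
      ∑ π : PermGroup k, orderForm (s.trans (Equiv.sigmaCongrRight π)) x := by
  rw [← Equiv.sum_comp (Equiv.inv (PermGroup k))]
  simp only [asym, LinearMap.sum_apply, map_sum, LinearMap.smul_apply, map_smul]
  refine Finset.sum_congr rfl fun π _ => ?_
  have h1 : s = (s.trans (Equiv.sigmaCongrRight π⁻¹)).trans (Equiv.sigmaCongrRight π) := by
    refine Equiv.ext fun a => ?_
    rcases h : s a with ⟨i, j⟩
    simp [h]
  conv_lhs => rw [h1]
  rw [orderForm_permute, smul_eq_mul, ← mul_assoc, permSign_mul_self, one_mul]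
  rfl

theorem exists_eq_sigmaCongrRight (σ : Equiv.Perm (Var k)) (h : ∀ x, (σ x).1 = x.1) :
    ∃ π : PermGroup k, σ = Equiv.sigmaCongrRight π := by
  have h1 : ∀ i (j : Fin (k i)), ∃ j', σ ⟨i, j⟩ = ⟨i, j'⟩ := fun i j => by
    have := h ⟨i, j⟩
    generalize σ ⟨i, j⟩ = x at this ⊢
    obtain ⟨i', j'⟩ := x
    obtain rfl : i' = i := this
    exact ⟨j', rfl⟩
  choose g hg using h1
  have hinj : ∀ i, Function.Injective (g i) := fun i j j' hj => by
    have : σ ⟨i, j⟩ = σ ⟨i, j'⟩ := by rw [hg, hg, hj]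
    simpa using this
  exact ⟨fun i => Equiv.ofBijective (g i) (Finite.injective_iff_bijective.1 (hinj i)),
    Equiv.ext fun ⟨i, j⟩ => by simp [hg]⟩

theorem exists_perm_of_type_eq {s s' : Fin (size k) ≃ Var k} (h : ∀ a, (s a).1 = (s' a).1) :
    ∃ π : PermGroup k, s' = s.trans (Equiv.sigmaCongrRight π) := by
  obtain ⟨π, hπ⟩ := exists_eq_sigmaCongrRight (s.symm.trans s') (fun x => by
    rw [Equiv.trans_apply, ← h, Equiv.apply_symm_apply])
  exact ⟨π, by ext1 a; simp [← hπ]⟩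

/-- On `A(k)`, the form of an ordering only depends on the upper indices. -/
theorem orderForm_eq_of_type_eq {s s' : Fin (size k) ≃ Var k} (h : ∀ a, (s a).1 = (s' a).1)
    {x : TreeSpace k} (hx : x ∈ A k) : orderForm s x = orderForm s' x := by
  obtain ⟨π, rfl⟩ := exists_perm_of_type_eq h
  have h1 := orderForm_permute s π x
  rw [hx π, map_smul, smul_eq_mul] at h1
  refine (mul_left_cancel₀ (fun h0 => ?_) h1).symm
  simpa [h0] using permSign_mul_self π

/-! ### Multiindices as orderings -/

namespace Multiindex

theorem count_val (J : Multiindex k) (a : Fin (size k)) :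
    (J.count a : ℕ) = (Finset.univ.filter fun b => b < a ∧ J.1 b = J.1 a).card := rfl

theorem count_lt {J : Multiindex k} {a b : Fin (size k)} (hab : a < b) (h : J.1 a = J.1 b) :
    (J.count a : ℕ) < J.count b := by
  rw [count_val, count_val]
  refine Finset.card_lt_card ?_
  rw [Finset.ssubset_iff_of_subset fun c hc => ?_]
  · exact ⟨a, by simp [hab, h], by simp⟩
  · simp only [Finset.mem_filter, Finset.mem_univ, true_and] at hc ⊢
    exact ⟨hc.1.trans hab, hc.2.trans h⟩

/-- The ordering `t_{c(1)}^{(J(1))}, t_{c(2)}^{(J(2))}, …` attached to a multiindex `J`. -/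
def ordering (J : Multiindex k) : Fin (size k) ≃ Var k :=
  Equiv.ofBijective (fun a => ⟨J.1 a, J.count a⟩) (by
    rw [Fintype.bijective_iff_injective_and_card]
    refine ⟨fun a b hab => ?_, by simp [size]⟩
    simp only [Sigma.mk.injEq] at hab
    obtain ⟨h1, h2⟩ := hab
    have h3 : (J.count a : ℕ) = J.count b := by
      rw [Fin.heq_ext_iff (by rw [h1])] at h2
      exact h2
    rcases lt_trichotomy a b with h | h | h
    · exact absurd h3 (count_lt h h1).ne
    · exact h
    · exact absurd h3 (count_lt h h1.symm).ne')

/-- The multiindex of the upper indices of an ordering. -/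
def ofOrdering (s : Fin (size k) ≃ Var k) : Multiindex k :=
  ⟨fun a => (s a).1, fun i => by
    rw [← Fintype.card_subtype, Fintype.card_congr (s.subtypeEquiv (q := fun x => x.1 = i)
      fun a => Iff.rfl), Fintype.card_congr (Equiv.sigmaSubtype i), Fintype.card_fin]⟩

end Multiindex

theorem finSigmaFinEquiv_lt {x y : Var k} (h : x.1 < y.1) :
    finSigmaFinEquiv x < finSigmaFinEquiv y := by
  rw [Fin.lt_def, finSigmaFinEquiv_apply, finSigmaFinEquiv_apply]
  obtain ⟨⟨i, hi⟩, j⟩ := x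
  obtain ⟨⟨i', hi'⟩, j'⟩ := y
  simp only [Fin.mk_lt_mk] at h
  simp only
  have h1 : ∀ (a : ℕ) (ha : a ≤ r), ∑ c : Fin a, k (Fin.castLE ha c) =
      ∑ c ∈ Finset.range a, if hc : c < r then k ⟨c, hc⟩ else 0 := fun a ha => by
    rw [Finset.sum_range]
    refine Finset.sum_congr rfl fun c _ => ?_
    rw [dif_pos (c.2.trans_le ha)]
    rfl
  rw [h1 i, h1 i']
  have h2 := Finset.sum_le_sum_of_subset (f := fun c => if hc : c < r then k ⟨c, hc⟩ else 0)
    (Finset.range_subset_range.2 (Nat.succ_le_iff.2 h))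
  rw [Finset.sum_range_succ, dif_pos hi] at h2
  have := j.2
  omega

theorem finSigmaFinEquiv_lt_of_fst_eq {x y : Var k} (h : x.1 = y.1) (h' : (x.2 : ℕ) < y.2) :
    finSigmaFinEquiv x < finSigmaFinEquiv y := by
  rw [Fin.lt_def, finSigmaFinEquiv_apply, finSigmaFinEquiv_apply]
  obtain ⟨i, j⟩ := x
  obtain ⟨i', j'⟩ := y
  obtain rfl : i = i' := h
  simpa using h'

/-- The inversions of the permutation `J.ordering` are those of `J`: `c` increases on every fibre
of `J`. -/
theorem Multiindex.sgn_eq (J : Multiindex k) : J.sgn = orderSign J.ordering := by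
  have h1 : ∀ a b : Fin (size k), a < b →
      ((J.ordering.trans finSigmaFinEquiv) a < (J.ordering.trans finSigmaFinEquiv) b ↔
        ¬ J.1 b < J.1 a) := fun a b hab => by
    constructor
    · intro h h'
      exact (finSigmaFinEquiv_lt (x := J.ordering b) (y := J.ordering a) h').not_gt h
    · intro h
      rcases (not_lt.1 h).lt_or_eq with h | h
      · exact finSigmaFinEquiv_lt h
      · exact finSigmaFinEquiv_lt_of_fst_eq h (count_lt hab h)
  rw [orderSign, Equiv.Perm.sign_eq_prod_prod_Ioi, Multiindex.sgn, Finset.prod_sigma',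
    ← Finset.prod_filter_mul_prod_filter_not _ (fun x => J.1 x.2 < J.1 x.1)]
  rw [Finset.prod_congr rfl (g := fun _ => (-1 : ℤˣ)), Finset.prod_const,
    Finset.prod_eq_one, mul_one]
  · push_cast
    congr 1
    refine Finset.card_bij (fun x _ => ⟨x.1, x.2⟩) ?_ ?_ ?_
    · rintro ⟨a, b⟩ h; simpa using h
    · rintro ⟨a, b⟩ _ ⟨a', b'⟩ _ h; simpa using h
    · rintro ⟨a, b⟩ h; exact ⟨(a, b), by simpa using h, rfl⟩
  · rintro ⟨a, b⟩ h
    simp only [Finset.mem_filter, Finset.mem_sigma, Finset.mem_univ, Finset.mem_Ioi,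
      true_and] at h
    rw [if_pos ((h1 a b h.1).2 h.2)]
  · rintro ⟨a, b⟩ h
    simp only [Finset.mem_filter, Finset.mem_sigma, Finset.mem_univ, Finset.mem_Ioi,
      true_and] at h
    rw [if_neg (fun h' => (h1 a b h.1).1 h' h.2)]

theorem Multiindex.form_eq (J : Multiindex k) (x : A k) : J.form x = orderForm J.ordering x := by
  rw [Multiindex.form, orderForm, Multiindex.sgn_eq]
  rfl

/-- The orderings with the upper indices `J` all induce the form `⟨f̃_J, -⟩` on `A(k)`. -/
theorem orderForm_eq_form (s : Fin (size k) ≃ Var k) (x : A k) :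
    orderForm s x = (Multiindex.ofOrdering s).form x := by
  rw [Multiindex.form_eq]
  have h : ∀ a, (s a).1 = ((Multiindex.ofOrdering s).ordering a).1 := fun a => rfl
  exact orderForm_eq_of_type_eq h x.2

theorem A.ext_form {x y : A k} (h : ∀ J : Multiindex k, J.form x = J.form y) : x = y := by
  rw [← sub_eq_zero]
  refine Subtype.ext (TreeSpace.eq_zero_of_orderForm fun s => ?_)
  rw [orderForm_eq_form, map_sub, h, sub_self]

/-- The antisymmetrization of the path along the ordering of `J` is, up to a factor, dual to the
form of `J`. -/
theorem Multiindex.exists_dual (J : Multiindex k) :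
    ∃ x : A k, J.form x ≠ 0 ∧ ∀ J' : Multiindex k, J' ≠ J → J'.form x = 0 := by
  classical
  refine ⟨⟨asym k (ForestSpace.mk (pathTree J.ordering)), asym_mem k _⟩, ?_, fun J' hJ' => ?_⟩
  · rw [form_eq, orderForm_asym, Finset.sum_eq_single 1]
    · rw [orderForm_pathTree, if_pos (by ext1 a; rfl)]
      exact orderSign_ne_zero _
    · intro π _ hπ
      rw [orderForm_pathTree, if_neg]
      intro h
      refine hπ (funext fun i => Equiv.ext fun j => ?_)
      have := DFunLike.congr_fun h (J.ordering.symm ⟨i, j⟩)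
      simp only [Equiv.trans_apply, Equiv.apply_symm_apply] at this
      simpa using this
    · simp
  · rw [form_eq, orderForm_asym]
    refine Finset.sum_eq_zero fun π _ => ?_
    rw [orderForm_pathTree, if_neg]
    intro h
    refine hJ' (Subtype.ext (funext fun a => ?_))
    exact congrArg Sigma.fst (DFunLike.congr_fun h a)

end Ordering

/-! ### The canonical element -/

section Canonical

variable {r : ℕ} {k : Fin r → ℕ}

namespace Multiindex

/-- The basis of `A(k)` dual to the forms `⟨f̃_J, -⟩`. -/
def dual (J : Multiindex k) : A k := (J.form J.exists_dual.choose)⁻¹ • J.exists_dual.choose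

open Classical in
theorem form_dual (J J' : Multiindex k) : J'.form J.dual = if J' = J then 1 else 0 := by
  rw [dual, map_smul, smul_eq_mul]
  split_ifs with h
  · subst h
    exact inv_mul_cancel₀ J'.exists_dual.choose_spec.1
  · rw [J.exists_dual.choose_spec.2 J' h, mul_zero]

theorem sum_form_smul_dual (x : A k) : ∑ J : Multiindex k, J.form x • J.dual = x := by
  classical
  refine A.ext_form fun J => ?_
  simp [form_dual]

end Multiindex

theorem freePart.hom_ext {M : Type*} [AddCommGroup M] [Module ℂ M] {f g : freePart k →ₗ[ℂ] M}
    (h : ∀ J : Multiindex k, f ⟨J.monomial, monomial_mem J⟩ = g ⟨J.monomial, monomial_mem J⟩) :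
    f = g := by
  refine LinearMap.ext fun ⟨u, hu⟩ => ?_
  induction hu using Submodule.span_induction with
  | mem _ hx => obtain ⟨J, rfl⟩ := hx; exact h J
  | zero => exact (map_zero f).trans (map_zero g).symm
  | add x y hx hy h1 h2 =>
    exact (map_add f ⟨x, hx⟩ ⟨y, hy⟩).trans
      ((congrArg₂ (· + ·) h1 h2).trans (map_add g ⟨x, hx⟩ ⟨y, hy⟩).symm)
  | smul c x hx h1 =>
    exact (map_smul f c ⟨x, hx⟩).trans
      ((congrArg (c • ·) h1).trans (map_smul g c ⟨x, hx⟩).symm)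

/-- The contraction with a linear form on `A(k)`. -/
def contractLeft {U : Type*} [AddCommGroup U] [Module ℂ U] (ξ : Module.Dual ℂ (A k)) :
    A k ⊗[ℂ] U →ₗ[ℂ] U :=
  (TensorProduct.lid ℂ U).toLinearMap ∘ₗ ξ.rTensor U

@[simp] theorem contractLeft_tmul {U : Type*} [AddCommGroup U] [Module ℂ U]
    (ξ : Module.Dual ℂ (A k)) (x : A k) (u : U) : contractLeft ξ (x ⊗ₜ[ℂ] u) = ξ x • u := rfl

theorem sum_dual_tmul_contractLeft {U : Type*} [AddCommGroup U] [Module ℂ U] (ω : A k ⊗[ℂ] U) :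
    ∑ J : Multiindex k, J.dual ⊗ₜ[ℂ] contractLeft J.form ω = ω := by
  induction ω with
  | zero => simp
  | tmul x u =>
    simp only [contractLeft_tmul, TensorProduct.tmul_smul]
    simp only [TensorProduct.smul_tmul', ← TensorProduct.sum_tmul]
    rw [Multiindex.sum_form_smul_dual]
  | add ω₁ ω₂ h₁ h₂ =>
    simp only [map_add, TensorProduct.tmul_add, Finset.sum_add_distrib]
    rw [h₁, h₂]

theorem existsUnique_isCanonicalElement (k : Fin r → ℕ) :
    ∃! ω : A k ⊗[ℂ] freePart k, IsCanonicalElement ω := by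
  classical
  refine ⟨∑ J : Multiindex k, J.dual ⊗ₜ ⟨J.monomial, monomial_mem J⟩, fun u => ?_,
    fun ω hω => ?_⟩
  · let g : freePart k →ₗ[ℂ] freePart k :=
      ∑ J : Multiindex k, (LinearMap.applyₗ J.dual ∘ₗ pairing k).smulRight
        ⟨J.monomial, monomial_mem J⟩
    have hg : g = LinearMap.id := by
      refine freePart.hom_ext fun J => ?_
      simp only [g, LinearMap.sum_apply, LinearMap.smulRight_apply, LinearMap.comp_apply,
        LinearMap.applyₗ_apply_apply, pairing_monomial, Multiindex.form_dual, LinearMap.id_apply]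
      rw [Finset.sum_eq_single J, if_pos rfl, one_smul]
      · intro J' _ h
        rw [if_neg h.symm, zero_smul]
      · simp
    have := LinearMap.congr_fun hg u
    simpa [g] using this
  · rw [← sum_dual_tmul_contractLeft ω]
    refine Finset.sum_congr rfl fun J _ => ?_
    have := hω ⟨J.monomial, monomial_mem J⟩
    rw [pairing_monomial] at this
    exact congrArg _ this

end Canonical

/-! ### Elements of `A(k)` as linear forms on the free algebra -/

section Functional

variable {r : ℕ} {k : Fin r → ℕ}

/-- The monomial of a word in the free algebra. -/
def wordMonomial (w : List (Fin r)) : FreeAlgebra ℂ (Fin r) := (w.map (FreeAlgebra.ι ℂ)).prod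

theorem basisFreeMonoid_ofList (w : List (Fin r)) :
    FreeAlgebra.basisFreeMonoid ℂ (Fin r) (FreeMonoid.ofList w) = wordMonomial w := by
  simp [FreeAlgebra.basisFreeMonoid, wordMonomial, FreeAlgebra.equivMonoidAlgebraFreeMonoid]

theorem FreeAlgebra.hom_ext_word {M : Type*} [AddCommGroup M] [Module ℂ M]
    {f g : FreeAlgebra ℂ (Fin r) →ₗ[ℂ] M} (h : ∀ w, f (wordMonomial w) = g (wordMonomial w)) :
    f = g :=
  (FreeAlgebra.basisFreeMonoid ℂ (Fin r)).ext fun w => by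
    rw [show w = FreeMonoid.ofList w.toList from rfl, basisFreeMonoid_ofList, h]

theorem count_ofFn {N : ℕ} (J : Fin N → Fin r) (i : Fin r) :
    (List.ofFn J).count i = (Finset.univ.filter fun a => J a = i).card := by
  induction N with
  | zero => simp
  | succ N ih =>
    rw [List.ofFn_succ, List.count_cons, ih, Fin.univ_succ, Finset.filter_cons]
    split_ifs with h1 h2 h2
    · rw [Finset.card_cons, Finset.filter_map, Finset.card_map]
      rfl
    · simp_all
    · simp_all
    · rw [Finset.filter_map, Finset.card_map]
      rfl

theorem Multiindex.count_word (J : Multiindex k) (i : Fin r) : J.word.count i = k i := by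
  rw [Multiindex.word, List.count_reverse, count_ofFn, J.2]

theorem Multiindex.word_injective : Function.Injective (Multiindex.word (k := k)) := by
  intro J J' h
  rw [word, word, List.reverse_inj, List.ofFn_inj] at h
  exact Subtype.ext h

/-- An element `x` of `A(k)` as the linear form `u ↦ ⟨u, x⟩` on the free algebra, extended by zero
to the monomials whose degree is not `k`. -/
def functional (k : Fin r → ℕ) : A k →ₗ[ℂ] Module.Dual ℂ (FreeAlgebra ℂ (Fin r)) :=
  ∑ J : Multiindex k, J.form.smulRight
    ((FreeAlgebra.basisFreeMonoid ℂ (Fin r)).coord (FreeMonoid.ofList J.word))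

theorem functional_wordMonomial (x : A k) (w : List (Fin r)) :
    functional k x (wordMonomial w) = ∑ J : Multiindex k, if J.word = w then J.form x else 0 := by
  simp only [functional, LinearMap.sum_apply, LinearMap.smulRight_apply, LinearMap.smul_apply,
    Module.Basis.coord_apply, ← basisFreeMonoid_ofList, Module.Basis.repr_self]
  refine Finset.sum_congr rfl fun J _ => ?_
  by_cases h : J.word = w
  · rw [if_pos h, h, Finsupp.single_eq_same, smul_eq_mul, mul_one]
  · rw [if_neg h, Finsupp.single_eq_of_ne (fun h' => h (FreeMonoid.ofList.injective h')),
      smul_zero]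

theorem functional_word (x : A k) (J : Multiindex k) :
    functional k x (wordMonomial J.word) = J.form x := by
  rw [functional_wordMonomial, Finset.sum_eq_single J]
  · rw [if_pos rfl]
  · intro J' _ h
    rw [if_neg fun h' => h (Multiindex.word_injective h')]
  · simp

theorem functional_eq_zero (x : A k) {w : List (Fin r)} (h : ∃ i, w.count i ≠ k i) :
    functional k x (wordMonomial w) = 0 := by
  obtain ⟨i, hi⟩ := h
  rw [functional_wordMonomial]
  refine Finset.sum_eq_zero fun J _ => if_neg ?_
  rintro rfl
  exact hi (J.count_word i)

theorem Multiindex.exists_word_eq {w : List (Fin r)} (h : ∀ i, w.count i = k i) :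
    ∃ J : Multiindex k, J.word = w := by
  have hlen : w.length = size k := by
    rw [size, ← Finset.sum_congr rfl fun i _ => h i]
    have := Multiset.sum_count_eq_card (s := Finset.univ) (m := (w : Multiset (Fin r)))
      fun a _ => Finset.mem_univ a
    simpa using this.symm
  have hlen' : size k = w.reverse.length := by rw [List.length_reverse, hlen]
  have hw : List.ofFn (fun a : Fin (size k) => w.reverse.get (Fin.cast hlen' a)) = w.reverse := by
    refine List.ext_get (by simp [hlen]) fun n h1 h2 => by simp
  refine ⟨⟨fun a => w.reverse.get (Fin.cast hlen' a), fun i => ?_⟩, ?_⟩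
  · rw [← count_ofFn, hw, List.count_reverse, h]
  · rw [Multiindex.word, hw, List.reverse_reverse]

/-- The linear forms on the free algebra given by the elements of the direct sum of all `A(k)`. -/
def totalFunctional (r : ℕ) :
    (⨁ k : Fin r → ℕ, A k) →ₗ[ℂ] Module.Dual ℂ (FreeAlgebra ℂ (Fin r)) :=
  DirectSum.toModule ℂ _ _ functional

@[simp] theorem totalFunctional_of (x : A k) :
    totalFunctional r (DirectSum.of (fun k : Fin r → ℕ => A k) k x) = functional k x := by
  rw [totalFunctional, ← DirectSum.lof_eq_of ℂ, DirectSum.toModule_lof]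

theorem totalFunctional_word (z : ⨁ k : Fin r → ℕ, A k) (J : Multiindex k) :
    totalFunctional r z (wordMonomial J.word) = J.form (z k) := by
  induction z using DirectSum.induction_on with
  | zero => simp
  | of k' x =>
    rw [totalFunctional_of]
    by_cases h : k' = k
    · subst h
      rw [functional_word, DirectSum.of_eq_same]
    · rw [DirectSum.of_eq_of_ne _ _ _ (Ne.symm h), map_zero, functional_eq_zero]
      obtain ⟨i, hi⟩ := Function.ne_iff.1 h
      exact ⟨i, by rw [J.count_word]; exact hi.symm⟩
  | add z₁ z₂ h₁ h₂ => rw [map_add, LinearMap.add_apply, h₁, h₂, DirectSum.add_apply, map_add]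

theorem totalFunctional_injective (r : ℕ) : Function.Injective (totalFunctional r) := by
  intro z z' h
  refine DFinsupp.ext fun k => A.ext_form fun J => ?_
  have := LinearMap.congr_fun h (wordMonomial J.word)
  rwa [totalFunctional_word, totalFunctional_word] at this

end Functional

/-! ### The star-product of trees -/

section StarTrees

variable {r : ℕ} {k l : Fin r → ℕ}

@[simp] theorem varEquiv_symm_left (x : Var k) : (varEquiv k l).symm (varLeft k l x) = .inl x := by
  rw [Equiv.symm_apply_eq, varEquiv_inl]

@[simp] theorem varEquiv_symm_right (x : Var l) :
    (varEquiv k l).symm (varRight k l x) = .inr x := by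
  rw [Equiv.symm_apply_eq, varEquiv_inr]

/-- The parent function of the union of two trees. -/
def glueParent (P₁ : Var k → Option (Var k)) (P₂ : Var l → Option (Var l)) (y : Var (k + l)) :
    Option (Var (k + l)) :=
  Sum.elim (fun x => (P₁ x).map (varLeft k l)) (fun x => (P₂ x).map (varRight k l))
    ((varEquiv k l).symm y)

@[simp] theorem glueParent_left (P₁ : Var k → Option (Var k)) (P₂ : Var l → Option (Var l))
    (x : Var k) : glueParent P₁ P₂ (varLeft k l x) = (P₁ x).map (varLeft k l) := by
  simp [glueParent]

@[simp] theorem glueParent_right (P₁ : Var k → Option (Var k)) (P₂ : Var l → Option (Var l))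
    (x : Var l) : glueParent P₁ P₂ (varRight k l x) = (P₂ x).map (varRight k l) := by
  simp [glueParent]

theorem var_cases (y : Var (k + l)) : (∃ x, y = varLeft k l x) ∨ ∃ x, y = varRight k l x := by
  obtain ⟨x | x, rfl⟩ := (varEquiv k l).surjective y
  · exact .inl ⟨x, rfl⟩
  · exact .inr ⟨x, rfl⟩

theorem isParent_glueParent {P₁ : Var k → Option (Var k)} {P₂ : Var l → Option (Var l)}
    {D₁ : Option (Var k) → ℕ} {D₂ : Option (Var l) → ℕ} (h₁ : IsParent P₁ D₁)
    (h₂ : IsParent P₂ D₂) :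
    IsParent (glueParent P₁ P₂) (fun v => D₁ (collapseRight k l v) + D₂ (collapseLeft k l v)) where
  depth_none := by
    change D₁ none + D₂ none = 0
    rw [h₁.depth_none, h₂.depth_none]
  depth_some y := by
    rcases var_cases y with ⟨x, rfl⟩ | ⟨x, rfl⟩
    · rw [glueParent_left, ← Option.map_some, collapseRight_left, collapseLeft_left,
        collapseRight_left, collapseLeft_left, h₁.depth_some, h₂.depth_none]
    · rw [glueParent_right, ← Option.map_some, collapseRight_right, collapseLeft_right,
        collapseRight_right, collapseLeft_right, h₁.depth_none, h₂.depth_some]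
      omega

/-- The numbering of the edges of the union of two trees by their heads. -/
def glueOrder (E₁ : Fin (size k) ≃ Var k) (E₂ : Fin (size l) ≃ Var l) :
    Fin (size (k + l)) ≃ Var (k + l) :=
  (rowEquiv k l).symm.trans ((Equiv.sumCongr E₁ E₂).trans (varEquiv k l))

@[simp] theorem glueOrder_left (E₁ : Fin (size k) ≃ Var k) (E₂ : Fin (size l) ≃ Var l)
    (a : Fin (size k)) : glueOrder E₁ E₂ (idxLeft k l a) = varLeft k l (E₁ a) := by
  rw [show idxLeft k l a = rowEquiv k l (.inl a) from rfl]
  simp [glueOrder]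

@[simp] theorem glueOrder_right (E₁ : Fin (size k) ≃ Var k) (E₂ : Fin (size l) ≃ Var l)
    (a : Fin (size l)) : glueOrder E₁ E₂ (idxRight k l a) = varRight k l (E₂ a) := by
  rw [show idxRight k l a = rowEquiv k l (.inr a) from rfl]
  simp [glueOrder]

theorem glue_ofParent {P₁ : Var k → Option (Var k)} {P₂ : Var l → Option (Var l)}
    {D₁ : Option (Var k) → ℕ} {D₂ : Option (Var l) → ℕ} (h₁ : IsParent P₁ D₁)
    (h₂ : IsParent P₂ D₂) (E₁ : Fin (size k) ≃ Var k) (E₂ : Fin (size l) ≃ Var l) :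
    glue (ofParent P₁ h₁ E₁) (ofParent P₂ h₂ E₂) =
      ofParent (glueParent P₁ P₂) (isParent_glueParent h₁ h₂) (glueOrder E₁ E₂) := by
  ext1
  funext a
  rcases idx_cases a with ⟨c, rfl⟩ | ⟨c, rfl⟩
  · simp
  · simp

theorem shuffleSign_mul_self (k l : Fin r → ℕ) : shuffleSign k l * shuffleSign k l = 1 := by
  rw [shuffleSign, ← Int.cast_mul, ← Units.val_mul, Int.units_mul_self]
  simp

theorem orderSign_glueOrder (E₁ : Fin (size k) ≃ Var k) (E₂ : Fin (size l) ≃ Var l) :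
    orderSign (glueOrder E₁ E₂) = shuffleSign k l * (orderSign E₁ * orderSign E₂) := by
  have h1 : (glueOrder E₁ E₂).trans finSigmaFinEquiv =
      (((rowEquiv k l).symm.trans (Equiv.sumCongr (E₁.trans finSigmaFinEquiv)
          (E₂.trans finSigmaFinEquiv))).trans (rowEquiv k l)).trans
        (((rowEquiv k l).symm.trans ((colEquiv k l).trans (rowEquiv k l).symm)).trans
          (rowEquiv k l)) := by
    refine Equiv.ext fun a => ?_
    obtain ⟨b | b, rfl⟩ := (rowEquiv k l).surjective a <;> simp [glueOrder, colEquiv]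
  have h2 := Equiv.Perm.sign_sumCongr (E₁.trans finSigmaFinEquiv) (E₂.trans finSigmaFinEquiv)
  rw [orderSign, h1, Equiv.Perm.sign_trans, Equiv.Perm.sign_symm_trans_trans,
    Equiv.Perm.sign_symm_trans_trans]
  simp only [Equiv.Perm.sumCongr] at h2
  rw [h2, shuffleSign, orderSign, orderSign]
  push_cast
  rfl

/-- An ordering of a set `Y` restricts to an ordering of a subset, given by the injection `j` with
partial inverse `g`. -/
theorem exists_subordering {N : ℕ} {Y : Type*} (s : Fin N ≃ Y) (g : Y → Option (Var k))
    (j : Var k → Y) (hg : ∀ y x, g y = some x ↔ y = j x) :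
    ∃ s₁ : Fin (size k) ≃ Var k,
      (∀ x y, s₁.symm x < s₁.symm y ↔ s.symm (j x) < s.symm (j y)) ∧
      List.ofFn s₁ = (List.finRange N).filterMap fun a => g (s a) := by
  set L := (List.finRange N).filterMap fun a => g (s a) with hL
  have hnodup : L.Nodup := by
    refine (List.nodup_finRange N).filterMap fun a a' x hx hx' => ?_
    rw [Option.mem_def, hg] at hx hx'
    exact s.injective (hx.trans hx'.symm)
  have hmem : ∀ x, x ∈ L := fun x => by
    rw [hL, List.mem_filterMap]
    exact ⟨s.symm (j x), List.mem_finRange _, by rw [hg, Equiv.apply_symm_apply]⟩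
  have hlen : size k = L.length := by
    have := Fintype.card_congr (hnodup.getEquivOfForallMemList L hmem)
    simpa [size] using this.symm
  let s₁ : Fin (size k) ≃ Var k := (finCongr hlen).trans (hnodup.getEquivOfForallMemList L hmem)
  have hs₁ : List.ofFn s₁ = L := List.ext_get (by simp [hlen]) fun n h1 h2 => by simp [s₁]
  have hpair : L.Pairwise fun x y => s.symm (j x) < s.symm (j y) := by
    rw [hL, List.pairwise_filterMap]
    refine (List.pairwise_lt_finRange N).imp fun {a b} hab x hx y hy => ?_
    rw [hg] at hx hy
    rwa [← hx, ← hy, Equiv.symm_apply_apply, Equiv.symm_apply_apply]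
  rw [← hs₁, List.pairwise_ofFn] at hpair
  have hmono : StrictMono fun a => s.symm (j (s₁ a)) := fun a b hab => hpair hab
  refine ⟨s₁, fun x y => ?_, hs₁⟩
  have := hmono.lt_iff_lt (a := s₁.symm x) (b := s₁.symm y)
  simpa using this.symm

/-- Whether a symbol of `T(k + l)` belongs to the first part `T(k)`. -/
def colour (k l : Fin r → ℕ) (y : Var (k + l)) : Bool := ((varEquiv k l).symm y).isLeft

@[simp] theorem colour_left (x : Var k) : colour k l (varLeft k l x) = true := by
  simp [colour]

@[simp] theorem colour_right (x : Var l) : colour k l (varRight k l x) = false := by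
  simp [colour]

theorem exists_leftOrdering (s : Fin (size (k + l)) ≃ Var (k + l)) :
    ∃ s₁ : Fin (size k) ≃ Var k,
      (∀ x y, s₁.symm x < s₁.symm y ↔ s.symm (varLeft k l x) < s.symm (varLeft k l y)) ∧
      List.ofFn s₁ = (List.finRange (size (k + l))).filterMap
        fun a => ((varEquiv k l).symm (s a)).getLeft? :=
  exists_subordering s (fun y => ((varEquiv k l).symm y).getLeft?) _ fun y x => by
    rw [Sum.getLeft?_eq_some_iff, Equiv.symm_apply_eq, varEquiv_inl]

theorem exists_rightOrdering (s : Fin (size (k + l)) ≃ Var (k + l)) :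
    ∃ s₁ : Fin (size l) ≃ Var l,
      (∀ x y, s₁.symm x < s₁.symm y ↔ s.symm (varRight k l x) < s.symm (varRight k l y)) ∧
      List.ofFn s₁ = (List.finRange (size (k + l))).filterMap
        fun a => ((varEquiv k l).symm (s a)).getRight? :=
  exists_subordering s (fun y => ((varEquiv k l).symm y).getRight?) _ fun y x => by
    rw [Sum.getRight?_eq_some_iff, Equiv.symm_apply_eq, varEquiv_inr]

/-- The restriction to `T(k)` of an ordering of `T(k + l)`. -/
def leftOrdering (s : Fin (size (k + l)) ≃ Var (k + l)) : Fin (size k) ≃ Var k :=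
  (exists_leftOrdering s).choose

/-- The restriction to `T(l)` of an ordering of `T(k + l)`. -/
def rightOrdering (s : Fin (size (k + l)) ≃ Var (k + l)) : Fin (size l) ≃ Var l :=
  (exists_rightOrdering s).choose

/-- The linear extensions of the union of two trees are the shuffles of those of the two trees. -/
theorem isLinearExtension_glueParent (s : Fin (size (k + l)) ≃ Var (k + l))
    (P₁ : Var k → Option (Var k)) (P₂ : Var l → Option (Var l)) :
    IsLinearExtension (glueParent P₁ P₂) s ↔
      IsLinearExtension P₁ (leftOrdering s) ∧ IsLinearExtension P₂ (rightOrdering s) := by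
  have hl := (exists_leftOrdering s).choose_spec.1
  have hr := (exists_rightOrdering s).choose_spec.1
  constructor
  · refine fun h => ⟨fun x y hxy => ?_, fun x y hxy => ?_⟩
    · exact (hl y x).2 (h _ _ (by simp [hxy]))
    · exact (hr y x).2 (h _ _ (by simp [hxy]))
  · rintro ⟨h₁, h₂⟩ x y hxy
    rcases var_cases x with ⟨x, rfl⟩ | ⟨x, rfl⟩
    · rw [glueParent_left, Option.map_eq_some_iff] at hxy
      obtain ⟨y, hy, rfl⟩ := hxy
      exact (hl y x).1 (h₁ _ _ hy)
    · rw [glueParent_right, Option.map_eq_some_iff] at hxy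
      obtain ⟨y, hy, rfl⟩ := hxy
      exact (hr y x).1 (h₂ _ _ hy)

theorem orderForm_glue (s : Fin (size (k + l)) ≃ Var (k + l))
    {P₁ : Var k → Option (Var k)} {P₂ : Var l → Option (Var l)}
    {D₁ : Option (Var k) → ℕ} {D₂ : Option (Var l) → ℕ} (h₁ : IsParent P₁ D₁)
    (h₂ : IsParent P₂ D₂) (E₁ : Fin (size k) ≃ Var k) (E₂ : Fin (size l) ≃ Var l) :
    orderForm s (ForestSpace.mk (glue (ofParent P₁ h₁ E₁) (ofParent P₂ h₂ E₂))) =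
      shuffleSign k l * (orderForm (leftOrdering s) (ForestSpace.mk (ofParent P₁ h₁ E₁)) *
        orderForm (rightOrdering s) (ForestSpace.mk (ofParent P₂ h₂ E₂))) := by
  classical
  rw [glue_ofParent, orderForm_ofParent, orderForm_ofParent, orderForm_ofParent,
    orderSign_glueOrder, isLinearExtension_glueParent]
  by_cases h : IsLinearExtension P₁ (leftOrdering s)
  · by_cases h' : IsLinearExtension P₂ (rightOrdering s)
    · simp [h, h']
    · simp [h']
  · simp [h]

/-- The forms of orderings of a star-product: the sum over all ways to split the permuted ordering
into an ordering of the first and an ordering of the second part. -/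
theorem orderForm_starBilin (s : Fin (size (k + l)) ≃ Var (k + l)) (x : TreeSpace k)
    (y : TreeSpace l) :
    orderForm s (starBilin k l x y) = (∏ i, (((k i).factorial * (l i).factorial : ℕ) : ℂ))⁻¹ *
      ∑ π : PermGroup (k + l), orderForm (leftOrdering (s.trans (Equiv.sigmaCongrRight π))) x *
        orderForm (rightOrdering (s.trans (Equiv.sigmaCongrRight π))) y := by
  suffices (starBilin k l).compr₂ (orderForm s) =
      (∏ i, (((k i).factorial * (l i).factorial : ℕ) : ℂ))⁻¹ • ∑ π : PermGroup (k + l),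
        (LinearMap.mul ℂ ℂ).compl₁₂ (orderForm (leftOrdering (s.trans (Equiv.sigmaCongrRight π))))
          (orderForm (rightOrdering (s.trans (Equiv.sigmaCongrRight π)))) by
    have := LinearMap.congr_fun₂ this x y
    simpa [LinearMap.sum_apply] using this
  refine TreeSpace.hom_ext fun P₁ D₁ h₁ E₁ => TreeSpace.hom_ext fun P₂ D₂ h₂ E₂ => ?_
  rw [LinearMap.compr₂_apply, starBilin_mk, starTree, treeSign_glue, map_smul, orderForm_asym]
  simp only [orderForm_glue, ← Finset.mul_sum, LinearMap.smul_apply, LinearMap.sum_apply,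
    LinearMap.compl₁₂_apply, LinearMap.mul_apply', smul_eq_mul]
  rw [← mul_assoc, div_mul_eq_mul_div, shuffleSign_mul_self, one_div]

end StarTrees

/-! ### The coproduct of the free algebra -/

section Coproduct

variable {r : ℕ}

/-- The coproduct of the free algebra for which the generators are primitive. -/
def freeComul (r : ℕ) :
    FreeAlgebra ℂ (Fin r) →ₐ[ℂ] FreeAlgebra ℂ (Fin r) ⊗[ℂ] FreeAlgebra ℂ (Fin r) :=
  FreeAlgebra.lift ℂ fun i => FreeAlgebra.ι ℂ i ⊗ₜ 1 + 1 ⊗ₜ FreeAlgebra.ι ℂ i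

/-- The subword of the letters `J a` with `c a = true`, in reversed order as in
`Multiindex.word`. -/
def subword {N : ℕ} (J : Fin N → Fin r) (c : Fin N → Bool) : List (Fin r) :=
  (((List.finRange N).filter c).map J).reverse

theorem subword_cons {N : ℕ} (J : Fin (N + 1) → Fin r) (b : Bool) (c : Fin N → Bool) :
    subword J (Fin.cons b c) =
      subword (fun a => J a.succ) c ++ if b = true then [J 0] else [] := by
  have h : ((List.finRange N).map Fin.succ).filter (Fin.cons b c : Fin (N + 1) → Bool) =
      ((List.finRange N).filter c).map Fin.succ := by
    rw [List.filter_map]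
    rfl
  rw [subword, List.finRange_succ, List.filter_cons, h]
  cases b <;> simp [subword, Function.comp_def]

theorem wordMonomial_append (w w' : List (Fin r)) :
    wordMonomial (w ++ w') = wordMonomial w * wordMonomial w' := by
  simp [wordMonomial]

@[simp] theorem wordMonomial_singleton (i : Fin r) : wordMonomial [i] = FreeAlgebra.ι ℂ i := by
  simp [wordMonomial]

@[simp] theorem wordMonomial_nil : wordMonomial ([] : List (Fin r)) = 1 := rfl

theorem freeComul_wordMonomial {N : ℕ} (J : Fin N → Fin r) :
    freeComul r (wordMonomial (List.ofFn J).reverse) =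
      ∑ c : Fin N → Bool,
        wordMonomial (subword J c) ⊗ₜ[ℂ] wordMonomial (subword J fun a => !c a) := by
  induction N with
  | zero => simp [subword, Algebra.TensorProduct.one_def]
  | succ N ih =>
    rw [List.ofFn_succ, List.reverse_cons, wordMonomial_append, map_mul, ih,
      ← Equiv.sum_comp (Fin.consEquiv fun _ => Bool), Fintype.sum_prod_type, Fintype.sum_bool,
      wordMonomial_singleton, freeComul, FreeAlgebra.lift_ι_apply, mul_add, Finset.sum_mul,
      Finset.sum_mul]
    have hnot : ∀ (b : Bool) (c : Fin N → Bool),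
        (fun a => !(Fin.consEquiv (fun _ => Bool) (b, c)) a) = Fin.cons (!b) fun a => !c a := by
      intro b c
      funext a
      refine Fin.cases ?_ (fun a => ?_) a <;> simp [Fin.consEquiv]
    have hcons : ∀ (b : Bool) (c : Fin N → Bool),
        Fin.consEquiv (fun _ => Bool) (b, c) = (Fin.cons b c : Fin (N + 1) → Bool) :=
      fun _ _ => rfl
    congr 1 <;> refine Finset.sum_congr rfl fun c _ => ?_
    · rw [hnot, hcons, subword_cons, subword_cons]
      simp [wordMonomial_append]
    · rw [hnot, hcons, subword_cons, subword_cons]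
      simp [wordMonomial_append]

theorem count_subword {N : ℕ} (J : Fin N → Fin r) (c : Fin N → Bool) (i : Fin r) :
    (subword J c).count i = Fintype.card {a // J a = i ∧ c a = true} := by
  have h : ∀ p : Fin N → Bool, Fintype.card {a // p a = true} = (List.finRange N).countP p :=
    fun p => by
      rw [Fintype.card_subtype, List.countP_eq_length_filter]
      simp [Finset.card, Finset.filter, Finset.univ, Fintype.elems]
  rw [subword, List.count_reverse, List.count, List.countP_map, List.countP_filter, ← h]
  exact Fintype.card_congr (Equiv.subtypeEquivRight fun a => by simp)

theorem count_subword_add {N : ℕ} (J : Fin N → Fin r) (c : Fin N → Bool) (i : Fin r) :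
    (subword J c).count i + (subword J fun a => !c a).count i = (List.ofFn J).count i := by
  rw [subword, subword, List.count_reverse, List.count_reverse, ← List.count_append,
    ← List.map_append, List.ofFn_eq_map]
  exact ((List.filter_append_perm c (List.finRange N)).map J).count_eq i

/-- The convolution of linear forms on the free algebra. -/
def convolution (φ ψ : Module.Dual ℂ (FreeAlgebra ℂ (Fin r))) :
    Module.Dual ℂ (FreeAlgebra ℂ (Fin r)) :=
  LinearMap.mul' ℂ ℂ ∘ₗ TensorProduct.map φ ψ ∘ₗ (freeComul r).toLinearMap

theorem convolution_wordMonomial (φ ψ : Module.Dual ℂ (FreeAlgebra ℂ (Fin r))) {N : ℕ}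
    (J : Fin N → Fin r) :
    convolution φ ψ (wordMonomial (List.ofFn J).reverse) =
      ∑ c : Fin N → Bool,
        φ (wordMonomial (subword J c)) * ψ (wordMonomial (subword J fun a => !c a)) := by
  simp only [convolution, LinearMap.comp_apply, AlgHom.toLinearMap_apply, freeComul_wordMonomial,
    map_sum, TensorProduct.map_tmul, LinearMap.mul'_apply]

end Coproduct

/-! ### The star-product is dual to the coproduct -/

section Duality

variable {r : ℕ} {k l : Fin r → ℕ}

theorem map_fst_filterMap {N : ℕ} {Y : Type*} (t : Fin N → Y) (J : Fin N → Fin r)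
    (g : Y → Option (Var k)) (c : Fin N → Bool)
    (h : ∀ a, (g (t a)).map Sigma.fst = if c a = true then some (J a) else none)
    (L : List (Fin N)) :
    (L.filterMap fun a => g (t a)).map Sigma.fst = (L.filter c).map J := by
  induction L with
  | nil => rfl
  | cons a L ih =>
    have ha := h a
    rw [List.filterMap_cons, List.filter_cons]
    rcases hg : g (t a) with _ | x
    · rw [hg] at ha
      split_ifs at ha with hc
      · simp at ha
      · rw [if_neg hc, ih]
    · rw [hg] at ha
      split_ifs at ha with hc
      · rw [if_pos hc, List.map_cons, List.map_cons, ih]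
        exact congrArg (· :: _) (Option.some_injective _ ha)
      · simp at ha

/-- On `A(k)`, only the subword of the letters of the first colour matters. -/
theorem orderForm_leftOrdering (s : Fin (size (k + l)) ≃ Var (k + l)) (x : A k) :
    orderForm (leftOrdering s) x = functional k x (wordMonomial
      (subword (fun a => (s a).1) fun a => colour k l (s a))) := by
  rw [orderForm_eq_form, ← functional_word]
  congr 2
  rw [Multiindex.word, subword]
  congr 1
  change List.ofFn (Sigma.fst ∘ leftOrdering s) = _
  rw [← List.map_ofFn, leftOrdering, (exists_leftOrdering s).choose_spec.2]
  refine map_fst_filterMap s _ (fun y => ((varEquiv k l).symm y).getLeft?) _ (fun a => ?_) _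
  rcases var_cases (s a) with ⟨y, hy⟩ | ⟨y, hy⟩
  · rw [hy, colour_left, varEquiv_symm_left]
    rfl
  · rw [hy, colour_right, varEquiv_symm_right]
    rfl

theorem orderForm_rightOrdering (s : Fin (size (k + l)) ≃ Var (k + l)) (x : A l) :
    orderForm (rightOrdering s) x = functional l x (wordMonomial
      (subword (fun a => (s a).1) fun a => !colour k l (s a))) := by
  rw [orderForm_eq_form, ← functional_word]
  congr 2
  rw [Multiindex.word, subword]
  congr 1
  change List.ofFn (Sigma.fst ∘ rightOrdering s) = _
  rw [← List.map_ofFn, rightOrdering, (exists_rightOrdering s).choose_spec.2]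
  refine map_fst_filterMap s _ (fun y => ((varEquiv k l).symm y).getRight?) _ (fun a => ?_) _
  rcases var_cases (s a) with ⟨y, hy⟩ | ⟨y, hy⟩
  · rw [hy, colour_left, varEquiv_symm_left]
    rfl
  · rw [hy, colour_right, varEquiv_symm_right]
    rfl

theorem card_colour_true (k l : Fin r → ℕ) (i : Fin r) :
    Fintype.card {y : Var (k + l) // (y.1, colour k l y) = (i, true)} = k i := by
  rw [← Fintype.card_fin (k i)]
  symm
  refine Fintype.card_of_bijective
    (f := fun j => ⟨varLeft k l ⟨i, j⟩, by rw [colour_left]; rfl⟩) ⟨fun j j' h => ?_, ?_⟩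
  · have := (varEquiv k l).injective (a₁ := .inl ⟨i, j⟩) (a₂ := .inl ⟨i, j'⟩)
      (congrArg Subtype.val h)
    simpa using this
  · rintro ⟨y, hy⟩
    rcases var_cases y with ⟨⟨i', j⟩, rfl⟩ | ⟨x, rfl⟩
    · obtain rfl : i' = i := congrArg Prod.fst hy
      exact ⟨j, rfl⟩
    · simp at hy

theorem card_colour_false (k l : Fin r → ℕ) (i : Fin r) :
    Fintype.card {y : Var (k + l) // (y.1, colour k l y) = (i, false)} = l i := by
  rw [← Fintype.card_fin (l i)]
  symm
  refine Fintype.card_of_bijective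
    (f := fun j => ⟨varRight k l ⟨i, j⟩, by rw [colour_right]; rfl⟩) ⟨fun j j' h => ?_, ?_⟩
  · have := (varEquiv k l).injective (a₁ := .inr ⟨i, j⟩) (a₂ := .inr ⟨i, j'⟩)
      (congrArg Subtype.val h)
    simpa using this
  · rintro ⟨y, hy⟩
    rcases var_cases y with ⟨x, rfl⟩ | ⟨⟨i', j⟩, rfl⟩
    · simp at hy
    · obtain rfl : i' = i := congrArg Prod.fst hy
      exact ⟨j, rfl⟩

/-- If the colouring `c` of the letters of `J` splits `J` into words of the degrees `k` and `l`,
then it is induced by exactly `∏ᵢ kᵢ! lᵢ!` permutations of the standard ordering of `J`. -/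
theorem card_colouring (J : Multiindex (k + l)) (c : Fin (size (k + l)) → Bool)
    (hk : ∀ i, (subword J.1 c).count i = k i)
    (hl : ∀ i, (subword J.1 fun a => !c a).count i = l i) :
    (Finset.univ.filter fun π : PermGroup (k + l) =>
      (fun a => colour k l ((J.ordering.trans (Equiv.sigmaCongrRight π)) a)) = c).card =
      ∏ i, ((k i).factorial * (l i).factorial) := by
  classical
  let p : Var (k + l) → Fin r × Bool := fun y => (y.1, colour k l y)
  let q : Fin (size (k + l)) → Fin r × Bool := fun a => (J.1 a, c a)
  have hq : ∀ b, Fintype.card {a // q a = b} = Fintype.card {y // p y = b} := by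
    rintro ⟨i, _ | _⟩
    · rw [card_colour_false, ← hl i, count_subword]
      exact Fintype.card_congr (Equiv.subtypeEquivRight fun a => by simp [q])
    · rw [card_colour_true, ← hk i, count_subword]
      exact Fintype.card_congr (Equiv.subtypeEquivRight fun a => by simp [q])
  let e : ∀ b, {a // q a = b} ≃ {y // p y = b} := fun b => Fintype.equivOfCardEq (hq b)
  -- one ordering `s'` with the upper indices `J` and the colouring `c`; the others arise from it by
  -- the permutations that preserve the upper indices and the colours
  let s' : Fin (size (k + l)) ≃ Var (k + l) := Equiv.ofFiberEquiv e
  have hs' : ∀ a, p (s' a) = q a := Equiv.ofFiberEquiv_map e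
  have hcard : Fintype.card {g : Equiv.Perm (Var (k + l)) // p ∘ g = p} =
      ∏ i, ((k i).factorial * (l i).factorial) := by
    rw [DomMulAct.stabilizer_card, Fintype.prod_prod_type]
    refine Finset.prod_congr rfl fun i _ => ?_
    rw [Fintype.prod_bool]
    exact congrArg₂ (fun a b => a.factorial * b.factorial) (card_colour_true k l i)
      (card_colour_false k l i)
  rw [← hcard, ← Fintype.card_subtype]
  refine Fintype.card_of_bijective
    (f := fun π => ⟨s'.symm.trans (J.ordering.trans (Equiv.sigmaCongrRight π.1)), ?_⟩) ⟨?_, ?_⟩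
  · funext y
    obtain ⟨a, rfl⟩ := s'.surjective y
    rw [hs' a]
    have := congrFun π.2 a
    simp only [Function.comp_apply, Equiv.trans_apply, Equiv.symm_apply_apply, p, q] at this ⊢
    rw [this]
    rfl
  · rintro ⟨π, hπ⟩ ⟨π', hπ'⟩ h
    have h1 := congrArg Subtype.val h
    refine Subtype.ext (funext fun i => Equiv.ext fun j => ?_)
    have h2 := DFunLike.congr_fun h1 (s' (J.ordering.symm ⟨i, j⟩))
    simp only [Equiv.trans_apply, Equiv.symm_apply_apply, Equiv.apply_symm_apply] at h2
    simpa using h2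
  · rintro ⟨g, hg⟩
    have hsg : ∀ a, p (g (s' a)) = q a := fun a => (congrFun hg (s' a)).trans (hs' a)
    obtain ⟨π, hπ⟩ := exists_perm_of_type_eq (s := J.ordering) (s' := s'.trans g)
      (fun a => (congrArg Prod.fst (hsg a)).symm)
    refine ⟨⟨π, ?_⟩, ?_⟩
    · rw [← hπ]
      exact funext fun a => congrArg Prod.snd (hsg a)
    · refine Subtype.ext ?_
      simp only
      rw [← hπ]
      ext1 y
      simp

/-- The star-product is dual to the coproduct of the free algebra. The factors `kᵢ! lᵢ!` in its
definition cancel the number of permutations that induce a given splitting of a word. -/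
theorem functional_starMul (x : A k) (y : A l) :
    functional (k + l) (starMul x y) = convolution (functional k x) (functional l y) := by
  classical
  refine FreeAlgebra.hom_ext_word fun w => ?_
  have vanish : ∀ {N : ℕ} (J : Fin N → Fin r) (c : Fin N → Bool),
      ¬ ((∀ i, (subword J c).count i = k i) ∧ ∀ i, (subword J fun a => !c a).count i = l i) →
      functional k x (wordMonomial (subword J c)) *
        functional l y (wordMonomial (subword J fun a => !c a)) = 0 := by
    intro N J c h
    rw [not_and_or, not_forall, not_forall] at h
    rcases h with h | h
    · rw [functional_eq_zero x h, zero_mul]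
    · rw [functional_eq_zero y h, mul_zero]
  by_cases hw : ∀ i, w.count i = (k + l) i
  · obtain ⟨J, rfl⟩ := Multiindex.exists_word_eq hw
    rw [functional_word, Multiindex.word, convolution_wordMonomial, Multiindex.form_eq]
    change orderForm J.ordering (starBilin k l x y) = _
    rw [orderForm_starBilin]
    simp only [orderForm_leftOrdering, orderForm_rightOrdering]
    rw [inv_mul_eq_iff_eq_mul₀ (Finset.prod_ne_zero_iff.2 fun i _ =>
      Nat.cast_ne_zero.2 (mul_ne_zero (Nat.factorial_ne_zero _) (Nat.factorial_ne_zero _))),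
      Finset.mul_sum]
    -- the permutations are collected according to the colouring that they induce
    rw [← Finset.sum_fiberwise Finset.univ (fun π : PermGroup (k + l) =>
      (fun a => colour k l ((J.ordering.trans (Equiv.sigmaCongrRight π)) a)))]
    refine Finset.sum_congr rfl fun c _ => ?_
    rw [Finset.sum_congr rfl (g := fun _ => functional k x (wordMonomial (subword J.1 c)) *
      functional l y (wordMonomial (subword J.1 fun a => !c a)))]
    · rw [Finset.sum_const, nsmul_eq_mul]
      by_cases hc : (∀ i, (subword J.1 c).count i = k i) ∧
          ∀ i, (subword J.1 fun a => !c a).count i = l i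
      · rw [card_colouring J c hc.1 hc.2]
        push_cast
        rfl
      · rw [vanish J.1 c hc, mul_zero, mul_zero]
    · intro π hπ
      have h := (Finset.mem_filter.1 hπ).2
      rw [← h]
      rfl
  · -- if the degree of `w` is not `k + l`, then both sides vanish
    rw [functional_eq_zero _ (not_forall.1 hw)]
    have hwJ : w = (List.ofFn w.reverse.get).reverse := by
      rw [List.ofFn_get, List.reverse_reverse]
    rw [hwJ, convolution_wordMonomial]
    refine (Finset.sum_eq_zero fun c _ => vanish _ c fun hc => hw fun i => ?_).symm
    have := count_subword_add w.reverse.get c i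
    rw [List.ofFn_get, List.count_reverse, hc.1 i, hc.2 i] at this
    exact this.symm

end Duality

/-! ### Ordered monomials in primitive elements -/

section OrderedMonomial

variable {B : Type*} [Ring B] {m : ℕ}

/-- The ordered monomial `x_1^{p_1} ⋯ x_m^{p_m}`. -/
def orderedMonomial (x : Fin m → B) (p : Fin m → ℕ) : B := (List.ofFn fun j => x j ^ p j).prod

@[simp] theorem orderedMonomial_zero (x : Fin m → B) : orderedMonomial x 0 = 1 := by
  simp [orderedMonomial]

theorem orderedMonomial_succ (x : Fin (m + 1) → B) (p : Fin (m + 1) → ℕ) :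
    orderedMonomial x p =
      x 0 ^ p 0 * orderedMonomial (fun j => x j.succ) fun j => p j.succ := by
  simp [orderedMonomial]

theorem orderedMonomial_single (x : Fin m → B) (j : Fin m) :
    orderedMonomial x (Pi.single j 1) = x j := by
  induction m with
  | zero => exact j.elim0
  | succ m ih =>
    rw [orderedMonomial_succ]
    refine Fin.cases ?_ (fun i => ?_) j
    · rw [show (fun i : Fin m => (Pi.single 0 1 : Fin (m + 1) → ℕ) i.succ) = 0 from
        funext fun i => by simp]
      simp
    · rw [show (fun c : Fin m => (Pi.single i.succ 1 : Fin (m + 1) → ℕ) c.succ) = Pi.single i 1 from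
        funext fun c => by simp [Pi.single_apply], ih]
      simp

variable [Algebra ℂ B]

/-- The divided power `x_1^{p_1} ⋯ x_m^{p_m} / (p_1! ⋯ p_m!)`. -/
def dividedMonomial (x : Fin m → B) (p : Fin m → ℕ) : B :=
  (∏ j, ((p j).factorial : ℂ))⁻¹ • orderedMonomial x p

theorem prod_factorial_ne_zero (p : Fin m → ℕ) : ∏ j, ((p j).factorial : ℂ) ≠ 0 :=
  Finset.prod_ne_zero_iff.2 fun _ _ => Nat.cast_ne_zero.2 (Nat.factorial_ne_zero _)

@[simp] theorem dividedMonomial_zero (x : Fin m → B) : dividedMonomial x 0 = 1 := by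
  simp [dividedMonomial]

theorem dividedMonomial_succ (x : Fin (m + 1) → B) (p : Fin (m + 1) → ℕ) :
    dividedMonomial x p = (((p 0).factorial : ℂ)⁻¹ • x 0 ^ p 0) *
      dividedMonomial (fun j => x j.succ) fun j => p j.succ := by
  rw [dividedMonomial, dividedMonomial, orderedMonomial_succ, Fin.prod_univ_succ, mul_inv,
    smul_mul_smul_comm]

theorem dividedMonomial_single (x : Fin m → B) (j : Fin m) :
    dividedMonomial x (Pi.single j 1) = x j := by
  rw [dividedMonomial, orderedMonomial_single, Finset.prod_eq_one, inv_one, one_smul]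
  intro i _
  by_cases h : i = j
  · subst h; simp
  · simp [h]

variable {Δ : B →ₐ[ℂ] B ⊗[ℂ] B}

theorem comul_dividedPower {y : B} (hy : Δ y = y ⊗ₜ 1 + 1 ⊗ₜ y) (n : ℕ) :
    Δ ((n.factorial : ℂ)⁻¹ • y ^ n) = ∑ i : Fin (n + 1),
      (((i : ℕ).factorial : ℂ)⁻¹ • y ^ (i : ℕ)) ⊗ₜ[ℂ]
        (((n - i : ℕ).factorial : ℂ)⁻¹ • y ^ (n - i : ℕ)) := by
  have hcomm : Commute (y ⊗ₜ[ℂ] (1 : B)) ((1 : B) ⊗ₜ[ℂ] y) := by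
    rw [Commute, SemiconjBy]
    simp
  rw [map_smul, map_pow, hy, hcomm.add_pow, Finset.sum_range, Finset.smul_sum]
  refine Finset.sum_congr rfl fun i _ => ?_
  rw [Algebra.TensorProduct.tmul_pow, Algebra.TensorProduct.tmul_pow, one_pow, one_pow,
    Algebra.TensorProduct.tmul_mul_tmul, mul_one, one_mul, TensorProduct.smul_tmul_smul,
    ← nsmul_eq_mul', ← Nat.cast_smul_eq_nsmul ℂ, smul_smul,
    Nat.cast_choose ℂ (Nat.lt_succ_iff.1 i.2)]
  congr 1
  have := Nat.cast_ne_zero (R := ℂ).2 (Nat.factorial_ne_zero n)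
  field_simp

/-- The divided powers of primitive elements form a sequence of divided powers: the coproduct of one
of them is the sum of all its decompositions. -/
theorem comul_dividedMonomial {x : Fin m → B} (hx : ∀ j, Δ (x j) = x j ⊗ₜ 1 + 1 ⊗ₜ x j)
    (p : Fin m → ℕ) :
    Δ (dividedMonomial x p) = ∑ c : ∀ j, Fin (p j + 1),
      dividedMonomial x (fun j => c j) ⊗ₜ[ℂ] dividedMonomial x fun j => p j - c j := by
  induction m with
  | zero =>
    have h : ∀ p : Fin 0 → ℕ, dividedMonomial x p = 1 := fun p => by
      rw [Subsingleton.elim p 0, dividedMonomial_zero]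
    simp [h, Algebra.TensorProduct.one_def]
  | succ m ih =>
    rw [dividedMonomial_succ, map_mul, comul_dividedPower (hx 0),
      ih (fun j => hx j.succ), Finset.sum_mul_sum,
      ← Equiv.sum_comp (Fin.consEquiv fun j => Fin (p j + 1)), Fintype.sum_prod_type]
    refine Finset.sum_congr rfl fun a _ => Finset.sum_congr rfl fun c _ => ?_
    rw [Algebra.TensorProduct.tmul_mul_tmul, dividedMonomial_succ x, dividedMonomial_succ x]
    rfl

/-- Linear forms on the divided powers that are triangular with respect to the total degree,
constructed as convolution products of linear forms that are dual to the `x_j`. -/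
theorem exists_triangular_form {ε : B →ₐ[ℂ] ℂ} {x : Fin m → B}
    (hx : ∀ j, Δ (x j) = x j ⊗ₜ 1 + 1 ⊗ₜ x j) (hε : ∀ j, ε (x j) = 0)
    (hind : LinearIndependent ℂ x) (n : ℕ) (q : Fin m → ℕ) (hq : ∑ j, q j = n) :
    ∃ χ : B →ₗ[ℂ] ℂ, ∀ p : Fin m → ℕ, ∑ j, p j ≤ n →
      χ (dividedMonomial x p) = if p = q then 1 else 0 := by
  classical
  obtain ⟨g, hg⟩ := LinearMap.exists_leftInverse_of_injective _
    (LinearMap.ker_eq_bot.2 hind)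
  have hgx : ∀ j, g (x j) = Finsupp.single j 1 := fun j => by
    have := LinearMap.congr_fun hg (Finsupp.single j 1)
    simpa using this
  induction n generalizing q with
  | zero =>
    refine ⟨ε.toLinearMap, fun p hp => ?_⟩
    have h0 : ∀ p : Fin m → ℕ, ∑ j, p j = 0 → p = 0 := fun p hp =>
      funext fun j => (Finset.sum_eq_zero_iff.1 hp) j (Finset.mem_univ j)
    rw [h0 q hq, h0 p (Nat.le_zero.1 hp), if_pos rfl, dividedMonomial_zero]
    exact map_one ε
  | succ n ih =>
    obtain ⟨j, -, hj⟩ : ∃ j ∈ Finset.univ, q j ≠ 0 := by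
      by_contra! h
      rw [Finset.sum_eq_zero h] at hq
      omega
    obtain ⟨q', rfl⟩ : ∃ q' : Fin m → ℕ, q = (Pi.single j 1 : Fin m → ℕ) + q' := by
      refine ⟨q - (Pi.single j 1 : Fin m → ℕ), funext fun i => ?_⟩
      by_cases h : i = j
      · subst h
        rw [Pi.add_apply, Pi.sub_apply, Pi.single_eq_same]
        omega
      · rw [Pi.add_apply, Pi.sub_apply, Pi.single_eq_of_ne h, Nat.sub_zero, Nat.zero_add]
    have hsum : ∀ c : Fin m → ℕ, ∑ i, ((Pi.single j 1 : Fin m → ℕ) + c) i = 1 + ∑ i, c i :=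
      fun c => by simp [Finset.sum_add_distrib]
    rw [hsum] at hq
    obtain ⟨χ, hχ⟩ := ih q' (by omega)
    let μ : B →ₗ[ℂ] ℂ := Finsupp.lapply j ∘ₗ g
    -- the correction makes the linear form vanish at `1`
    let ν : B →ₗ[ℂ] ℂ := μ - μ 1 • ε.toLinearMap
    have hν1 : ν 1 = 0 := by simp [ν]
    have hνx : ∀ i, ν (x i) = if i = j then 1 else 0 := fun i => by
      simp [ν, μ, hgx, hε, Finsupp.single_apply]
    refine ⟨LinearMap.mul' ℂ ℂ ∘ₗ TensorProduct.map ν χ ∘ₗ Δ.toLinearMap, fun p hp => ?_⟩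
    simp only [LinearMap.comp_apply, AlgHom.toLinearMap_apply, comul_dividedMonomial hx, map_sum,
      TensorProduct.map_tmul, LinearMap.mul'_apply]
    have hc : ∀ c : ∀ i, Fin (p i + 1), ∑ i, p i = ∑ i, (c i : ℕ) + ∑ i, (p i - c i) := fun c => by
      rw [← Finset.sum_add_distrib]
      exact Finset.sum_congr rfl fun i _ => by have := (c i).2; omega
    have hterm : ∀ c : ∀ i, Fin (p i + 1),
        ν (dividedMonomial x fun i => c i) * χ (dividedMonomial x fun i => p i - c i) =
          if (fun i => (c i : ℕ)) = Pi.single j 1 ∧ (fun i => p i - (c i : ℕ)) = q' then 1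
          else 0 := by
      intro c
      have hpc := hc c
      rcases Nat.lt_trichotomy (∑ i, (c i : ℕ)) 1 with h | h | h
      · have h0 : (fun i => (c i : ℕ)) = 0 := funext fun i =>
          (Finset.sum_eq_zero_iff.1 (Nat.lt_one_iff.1 h)) i (Finset.mem_univ i)
        rw [h0, dividedMonomial_zero, hν1, zero_mul, if_neg]
        rintro ⟨h1, -⟩
        have := congrFun h1 j
        simp at this
      · obtain ⟨i, hi⟩ : ∃ i, (fun i => (c i : ℕ)) = Pi.single i 1 := by
          obtain ⟨i, -, hi⟩ : ∃ i ∈ Finset.univ, (c i : ℕ) ≠ 0 := by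
            by_contra! h'
            rw [Finset.sum_eq_zero h'] at h
            omega
          have h2 : (c i : ℕ) + ∑ i ∈ Finset.univ.erase i, (c i : ℕ) = ∑ i, (c i : ℕ) :=
            Finset.add_sum_erase Finset.univ (fun i => (c i : ℕ)) (Finset.mem_univ i)
          have h3 : ∑ i ∈ Finset.univ.erase i, (c i : ℕ) = 0 := by omega
          rw [Finset.sum_eq_zero_iff] at h3
          refine ⟨i, funext fun i' => ?_⟩
          by_cases h4 : i' = i
          · subst h4
            rw [Pi.single_eq_same]
            have h5 : ∑ i ∈ Finset.univ.erase i', (c i : ℕ) = 0 := Finset.sum_eq_zero h3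
            omega
          · rw [Pi.single_eq_of_ne h4]
            exact h3 i' (by simp [h4])
        rw [hi, dividedMonomial_single, hνx, hχ _ (by omega), ite_mul, one_mul, zero_mul, ite_and]
        refine if_congr ⟨fun h => by rw [h], fun h => ?_⟩ rfl rfl
        have := congrFun h j
        by_contra hne
        rw [Pi.single_eq_same, Pi.single_eq_of_ne (Ne.symm hne)] at this
        omega
      · rw [hχ _ (by omega), if_neg, mul_zero, if_neg]
        · rintro ⟨-, h2⟩
          have : ∑ i, (p i - (c i : ℕ)) = ∑ i, q' i := Finset.sum_congr rfl fun i _ => congrFun h2 i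
          omega
        · intro h2
          have : ∑ i, (p i - (c i : ℕ)) = ∑ i, q' i := Finset.sum_congr rfl fun i _ => congrFun h2 i
          omega
    rw [Finset.sum_congr rfl fun c _ => hterm c]
    by_cases hpq : p = Pi.single j 1 + q'
    · rw [if_pos hpq]
      have hle : ∀ i, (Pi.single j 1 : Fin m → ℕ) i < p i + 1 := fun i => by
        rw [hpq, Pi.add_apply]; omega
      rw [Finset.sum_eq_single (fun i => ⟨(Pi.single j 1 : Fin m → ℕ) i, hle i⟩)]
      · exact if_pos ⟨rfl, funext fun i => by simp [hpq]⟩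
      · intro c _ hne
        refine if_neg fun h => hne (funext fun i => Fin.ext ?_)
        exact congrFun h.1 i
      · simp
    · rw [if_neg hpq]
      refine Finset.sum_eq_zero fun c _ => if_neg fun h => hpq (funext fun i => ?_)
      have h1 : (c i : ℕ) = _ := congrFun h.1 i
      have h2 : p i - (c i : ℕ) = _ := congrFun h.2 i
      have := (c i).2
      rw [Pi.add_apply, ← h1, ← h2]
      omega

/-- The triangular forms at an exponent of maximal total degree contradict a linear relation. -/
theorem linearIndependent_dividedMonomial {ε : B →ₐ[ℂ] ℂ} {x : Fin m → B}
    (hx : ∀ j, Δ (x j) = x j ⊗ₜ 1 + 1 ⊗ₜ x j) (hε : ∀ j, ε (x j) = 0)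
    (hind : LinearIndependent ℂ x) : LinearIndependent ℂ (dividedMonomial x) := by
  classical
  rw [linearIndependent_iff']
  intro s g hsum
  by_contra! h
  obtain ⟨i, hi, hgi⟩ := h
  obtain ⟨q, hq, hmax⟩ := Finset.exists_max_image (s.filter fun p => g p ≠ 0) (fun p => ∑ j, p j)
    ⟨i, by simp [hi, hgi]⟩
  rw [Finset.mem_filter] at hq
  obtain ⟨χ, hχ⟩ := exists_triangular_form hx hε hind _ q rfl
  have h1 := congrArg χ hsum
  rw [map_sum, map_zero, Finset.sum_eq_single q] at h1
  · rw [map_smul, hχ q le_rfl, if_pos rfl, smul_eq_mul, mul_one] at h1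
    exact hq.2 h1
  · intro p hp hpq
    rw [map_smul]
    by_cases hgp : g p = 0
    · rw [hgp, zero_smul]
    · rw [hχ p (hmax p (by simp [hp, hgp])), if_neg hpq, smul_zero]
  · exact fun h => absurd hq.1 h

end OrderedMonomial

/-! ### Straightening of words into ordered monomials -/

section Straightening

variable {B : Type*} [Ring B] {m : ℕ} {K : Type*} [AddCommMonoid K]

/-- The nondecreasing word in which the letter `j` occurs `p j` times. -/
def sortedWord (p : Fin m → ℕ) : List (Fin m) :=
  (List.ofFn fun j => List.replicate (p j) j).flatten

theorem prod_map_flatten_replicate {N : ℕ} {M : Type*} [Monoid M] (p : Fin N → ℕ) (y : Fin N → M) :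
    ((List.ofFn fun j => List.replicate (p j) (y j)).flatten).prod =
      (List.ofFn fun j => y j ^ p j).prod := by
  rw [List.prod_flatten, List.map_ofFn]
  congr 2
  funext j
  simp

theorem map_sortedWord {Y : Type*} (y : Fin m → Y) (p : Fin m → ℕ) :
    (sortedWord p).map y = (List.ofFn fun j => List.replicate (p j) (y j)).flatten := by
  rw [sortedWord, List.map_flatten, List.map_ofFn]
  congr 2
  funext j
  simp

theorem prod_map_sortedWord (x : Fin m → B) (p : Fin m → ℕ) :
    ((sortedWord p).map x).prod = orderedMonomial x p := by
  rw [map_sortedWord, prod_map_flatten_replicate, orderedMonomial]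

theorem count_sortedWord (p : Fin m → ℕ) (i : Fin m) : (sortedWord p).count i = p i := by
  rw [sortedWord, List.count_flatten, List.map_ofFn, List.sum_ofFn, Finset.sum_eq_single i]
  · simp
  · intro j _ hj
    simp [List.count_replicate, hj]
  · simp

theorem sum_map_sortedWord (d : Fin m → K) (p : Fin m → ℕ) :
    ((sortedWord p).map d).sum = ∑ j, p j • d j := by
  rw [map_sortedWord, List.sum_flatten, List.map_ofFn, List.sum_ofFn]
  simp

variable [Algebra ℂ B]

/-- The span of the words in the `x_j` of degree `e` and length less than `n`. -/
def wordSpan (x : Fin m → B) (d : Fin m → K) (e : K) (n : ℕ) : Submodule ℂ B :=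
  Submodule.span ℂ {y | ∃ v : List (Fin m), v.length < n ∧ (v.map d).sum = e ∧ (v.map x).prod = y}

/-- Exchanging letters only changes a word by shorter words of the same degree. -/
theorem sub_mem_wordSpan_of_perm {x : Fin m → B} {d : Fin m → K}
    (hcomm : ∀ i j, x i * x j - x j * x i ∈ Submodule.span ℂ {y | ∃ l, d l = d i + d j ∧ x l = y})
    {v w : List (Fin m)} (h : v.Perm w) :
    (v.map x).prod - (w.map x).prod ∈ wordSpan x d (v.map d).sum v.length := by
  induction h with
  | nil => simp
  | @cons a v w _ ih =>
    rw [List.map_cons (f := x), List.map_cons (f := x), List.prod_cons, List.prod_cons, ← mul_sub]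
    have := Submodule.mem_map_of_mem (f := LinearMap.mulLeft ℂ (x a)) ih
    rw [wordSpan, Submodule.map_span] at this
    refine Submodule.span_mono ?_ this
    rintro _ ⟨_, ⟨u, hu, hud, rfl⟩, rfl⟩
    exact ⟨a :: u, by simpa using hu, by simp [hud], by simp⟩
  | swap a b v =>
    have h1 : ((b :: a :: v).map x).prod - ((a :: b :: v).map x).prod =
        LinearMap.mulRight ℂ (v.map x).prod (x b * x a - x a * x b) := by
      simp [sub_mul, mul_assoc]
    rw [h1]
    have := Submodule.mem_map_of_mem (f := LinearMap.mulRight ℂ (v.map x).prod) (hcomm b a)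
    rw [Submodule.map_span] at this
    refine Submodule.span_mono ?_ this
    rintro _ ⟨_, ⟨l, hl, rfl⟩, rfl⟩
    exact ⟨l :: v, by simp, by simp [hl, add_assoc], by simp⟩
  | @trans u v w h₁ _ ih₁ ih₂ =>
    rw [← (h₁.map d).sum_eq, ← h₁.length_eq] at ih₂
    simpa using add_mem ih₁ ih₂

/-- Every word is a linear combination of ordered monomials of the same degree. -/
theorem prod_map_mem_span_orderedMonomial {x : Fin m → B} {d : Fin m → K}
    (hcomm : ∀ i j, x i * x j - x j * x i ∈ Submodule.span ℂ {y | ∃ l, d l = d i + d j ∧ x l = y})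
    (w : List (Fin m)) :
    (w.map x).prod ∈ Submodule.span ℂ
      {y | ∃ p : Fin m → ℕ, ∑ j, p j • d j = (w.map d).sum ∧ orderedMonomial x p = y} := by
  induction hn : w.length using Nat.strong_induction_on generalizing w with
  | _ n ih =>
  have hperm : w.Perm (sortedWord fun j => w.count j) :=
    List.perm_iff_count.2 fun i => (count_sortedWord (fun j => w.count j) i).symm
  rw [← sub_add_cancel (w.map x).prod ((sortedWord fun j => w.count j).map x).prod]
  refine add_mem ?_ (Submodule.subset_span ⟨fun j => w.count j, ?_, ?_⟩)
  · refine (Submodule.span_le.2 ?_ : wordSpan x d _ _ ≤ _) (sub_mem_wordSpan_of_perm hcomm hperm)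
    rintro _ ⟨v, hv, hvd, rfl⟩
    rw [← hvd]
    exact ih _ (hn ▸ hv) v rfl
  · rw [← sum_map_sortedWord, (hperm.map d).sum_eq]
  · rw [prod_map_sortedWord]

end Straightening

/-! ### The universal enveloping algebra of the nilpotent part -/

section Enveloping

attribute [local instance] LieRing.ofAssociativeRing

variable (N : Type*) [LieRing N] [LieAlgebra ℂ N]

open UniversalEnvelopingAlgebra (ι)

/-- The coproduct of the universal enveloping algebra for which the elements of the Lie algebra are
primitive. -/
def envComul :
    UniversalEnvelopingAlgebra ℂ N →ₐ[ℂ]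
      UniversalEnvelopingAlgebra ℂ N ⊗[ℂ] UniversalEnvelopingAlgebra ℂ N :=
  UniversalEnvelopingAlgebra.lift ℂ
    { toFun x := ι ℂ x ⊗ₜ 1 + 1 ⊗ₜ ι ℂ x
      map_add' x y := by
        simp only [map_add, TensorProduct.add_tmul, TensorProduct.tmul_add]
        abel
      map_smul' c x := by
        simp only [map_smul, TensorProduct.tmul_smul, TensorProduct.smul_tmul', smul_add,
          RingHom.id_apply]
      map_lie' {x y} := by
        simp only [LieHom.map_lie, LieRing.of_associative_ring_bracket, mul_add, add_mul,
          Algebra.TensorProduct.tmul_mul_tmul, mul_one, one_mul, TensorProduct.sub_tmul,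
          TensorProduct.tmul_sub]
        abel }

theorem envComul_ι (x : N) : envComul N (ι ℂ x) = ι ℂ x ⊗ₜ 1 + 1 ⊗ₜ ι ℂ x :=
  UniversalEnvelopingAlgebra.lift_ι_apply ℂ _ x

/-- The counit of the universal enveloping algebra. -/
def envCounit :
    UniversalEnvelopingAlgebra ℂ N →ₐ[ℂ] ℂ :=
  UniversalEnvelopingAlgebra.lift ℂ (0 : N →ₗ⁅ℂ⁆ ℂ)

theorem envCounit_ι (x : N) : envCounit N (ι ℂ x) = 0 :=
  UniversalEnvelopingAlgebra.lift_ι_apply ℂ _ x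

end Enveloping

section RootVectors

attribute [local instance] LieRing.ofAssociativeRing

open LieAlgebra LieAlgebra.IsKilling

variable {L : Type*} [LieRing L] [LieAlgebra ℂ L] [FiniteDimensional ℂ L] [LieAlgebra.IsSimple ℂ L]
  {H : LieSubalgebra ℂ L} [H.IsCartanSubalgebra] {b : (rootSystem H).Base} {r m : ℕ}

/-- The canonical map from the nilpotent part to its enveloping algebra is injective on linearly
independent families: the adjoint representation of the simple Lie algebra is faithful. -/
theorem linearIndependent_ι {F : Fin m → nilpotentPart b}
    (hF : LinearIndependent ℂ fun j => (F j : L)) :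
    LinearIndependent ℂ fun j => UniversalEnvelopingAlgebra.ι ℂ (F j) := by
  let ρ : nilpotentPart b →ₗ⁅ℂ⁆ Module.End ℂ L := (LieAlgebra.ad ℂ L).comp (nilpotentPart b).incl
  refine LinearIndependent.of_comp (UniversalEnvelopingAlgebra.lift ℂ ρ).toLinearMap ?_
  have h1 : ((UniversalEnvelopingAlgebra.lift ℂ ρ).toLinearMap ∘ fun j =>
      UniversalEnvelopingAlgebra.ι ℂ (F j)) = fun j => LieAlgebra.ad ℂ L (F j : L) := by
    funext j
    exact UniversalEnvelopingAlgebra.lift_ι_apply ℂ ρ (F j)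
  rw [h1]
  exact hF.map' (LieAlgebra.ad ℂ L : L →ₗ[ℂ] Module.End ℂ L) <| LinearMap.ker_eq_bot.2 <|
    (LieHom.ker_eq_bot _).1 (LieAlgebra.ad_ker_eq_bot_of_hasTrivialRadical ℂ L)

theorem linearIndependent_rootVectors (β : Fin m ≃ PositiveRoot b) {F : Fin m → nilpotentPart b}
    (hF : ∀ j, F j ≠ 0 ∧ (F j : L) ∈ rootSpace H (-((β j).1.1 : H → ℂ))) :
    LinearIndependent ℂ fun j => (F j : L) := by
  have h := LieSubmodule.iSupIndep_toSubmodule.2 (LieModule.iSupIndep_genWeightSpace ℂ H L)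
  have hinj : Function.Injective fun j => -((β j).1.1 : H → ℂ) := fun i j hij => by
    refine β.injective (Subtype.ext (Subtype.ext (DFunLike.coe_injective ?_)))
    exact neg_injective hij
  exact (h.comp hinj).linearIndependent _ (fun j => (hF j).2)
    (fun j h0 => (hF j).1 (Subtype.ext h0))

theorem exists_smul_of_mem_rootSpace (γ : H.root) {x y : L}
    (hx : x ∈ rootSpace H (-(γ.1 : H → ℂ))) (hy : y ∈ rootSpace H (-(γ.1 : H → ℂ))) (h0 : y ≠ 0) :
    ∃ c : ℂ, x = c • y := by
  have hγ : (-γ.1).IsNonZero := by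
    have := γ.2
    simp only [LieSubalgebra.root, Finset.mem_filter, Finset.mem_univ, true_and] at this
    simpa using this
  have h1 := finrank_rootSpace_eq_one (-γ.1) hγ
  rw [LieModule.Weight.coe_neg] at h1
  obtain ⟨c, hc⟩ := (finrank_eq_one_iff_of_nonzero'
    (⟨y, hy⟩ : rootSpace H (-(γ.1 : H → ℂ))) (fun h => h0 (congrArg Subtype.val h))).1 h1 ⟨x, hx⟩
  exact ⟨c, (congrArg Subtype.val hc).symm⟩

/-- The bracket of root vectors of two negative roots is zero or a root vector of the sum. -/
theorem exists_positiveRoot_of_lie_ne_zero (γ δ : PositiveRoot b) {x y : L}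
    (hx : x ∈ rootSpace H (-(γ.1.1 : H → ℂ))) (hy : y ∈ rootSpace H (-(δ.1.1 : H → ℂ)))
    (h0 : ⁅x, y⁆ ≠ 0) :
    ∃ ε : PositiveRoot b,
      (rootSystem H).root ε.1 = (rootSystem H).root γ.1 + (rootSystem H).root δ.1 ∧
      ⁅x, y⁆ ∈ rootSpace H (-(ε.1.1 : H → ℂ)) := by
  have hxy : ⁅x, y⁆ ∈ rootSpace H (-(γ.1.1 : H → ℂ) + -(δ.1.1 : H → ℂ)) :=
    lie_mem_genWeightSpace_of_mem_genWeightSpace hx hy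
  have hbot : rootSpace H (-(γ.1.1 : H → ℂ) + -(δ.1.1 : H → ℂ)) ≠ ⊥ := fun hbot => by
    rw [hbot, LieSubmodule.mem_bot] at hxy
    exact h0 hxy
  let w : LieModule.Weight ℂ H L := ⟨_, hbot⟩
  have hw : ∀ h : H, (-w) h = γ.1.1 h + δ.1.1 h := by
    intro h
    rw [LieModule.Weight.coe_neg]
    change -(-(γ.1.1 h) + -(δ.1.1 h)) = _
    ring
  have hw0 : (-w).IsNonZero := by
    intro h0
    have h1 : (rootSystem H).root γ.1 = -(rootSystem H).root δ.1 := by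
      ext h
      have h2 := hw h
      rw [h0] at h2
      simpa [eq_neg_iff_add_eq_zero] using h2.symm
    let := (rootSystem H).indexNeg
    have h3 : γ.1 = -δ.1 := by
      apply (rootSystem H).root.injective
      rw [h1, RootPairing.indexNeg_neg, RootPairing.root_reflectionPerm,
        RootPairing.reflection_apply_self]
    have h4 := (RootPairing.Base.IsPos.neg_iff_not b δ.1).1 (h3 ▸ γ.2)
    exact h4 δ.2
  let w' : H.root := ⟨-w, by simpa using hw0⟩
  have hroot : (rootSystem H).root w' = (rootSystem H).root γ.1 + (rootSystem H).root δ.1 := by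
    ext h
    simpa [w'] using hw h
  refine ⟨⟨w', γ.2.add δ.2 hroot⟩, hroot, ?_⟩
  have h5 : -(w'.1 : H → ℂ) = -(γ.1.1 : H → ℂ) + -(δ.1.1 : H → ℂ) := by
    funext h
    have h2 := hw h
    simp only [w', Pi.neg_apply, Pi.add_apply, h2]
    ring
  change ⁅x, y⁆ ∈ rootSpace H (-(w'.1 : H → ℂ))
  rw [h5]
  exact hxy

/-- The coordinates of a degree are determined since the simple roots are linearly independent. -/
theorem degree_injective (α : Fin r ≃ b.support) {c c' : Fin r → ℕ}
    (h : ∑ i, c i • (rootSystem H).root (α i).1 = ∑ i, c' i • (rootSystem H).root (α i).1) :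
    c = c' := by
  have hind : LinearIndependent ℂ fun i => (rootSystem H).root (α i).1 :=
    b.linearIndepOn_root.linearIndependent.comp α α.injective
  funext i
  have h1 : ∑ i, ((c i : ℂ) - c' i) • (rootSystem H).root (α i).1 = 0 := by
    simp only [sub_smul, Nat.cast_smul_eq_nsmul, Finset.sum_sub_distrib, h, sub_self]
  have := Fintype.linearIndependent_iff.1 hind _ h1 i
  exact_mod_cast sub_eq_zero.1 this

variable (α : Fin r ≃ b.support) (β : Fin m ≃ PositiveRoot b) {F : Fin m → nilpotentPart b}
  (hF : ∀ j, F j ≠ 0 ∧ (F j : L) ∈ rootSpace H (-((β j).1.1 : H → ℂ)))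
  {d : Fin m → Fin r → ℕ}
  (hd : ∀ j, (rootSystem H).root (β j).1 = ∑ i, d j i • (rootSystem H).root (α i).1)

include hF hd

theorem commutator_mem_span (i j : Fin m) :
    UniversalEnvelopingAlgebra.ι ℂ (F i) * UniversalEnvelopingAlgebra.ι ℂ (F j) -
        UniversalEnvelopingAlgebra.ι ℂ (F j) * UniversalEnvelopingAlgebra.ι ℂ (F i) ∈
      Submodule.span ℂ {y | ∃ l, d l = d i + d j ∧ UniversalEnvelopingAlgebra.ι ℂ (F l) = y} := by
  rw [← LieRing.of_associative_ring_bracket, ← LieHom.map_lie]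
  by_cases h0 : ⁅(F i : L), (F j : L)⁆ = 0
  · have : ⁅F i, F j⁆ = 0 := Subtype.ext h0
    rw [this, map_zero]
    exact zero_mem _
  obtain ⟨ε, hε, hmem⟩ := exists_positiveRoot_of_lie_ne_zero (β i) (β j) (hF i).2 (hF j).2 h0
  obtain ⟨l, rfl⟩ := β.surjective ε
  obtain ⟨c, hc⟩ := exists_smul_of_mem_rootSpace _ hmem (hF l).2
    (fun h => (hF l).1 (Subtype.ext h))
  have : ⁅F i, F j⁆ = c • F l := Subtype.ext hc
  rw [this, map_smul]
  refine Submodule.smul_mem _ _ (Submodule.subset_span ⟨l, degree_injective α ?_, rfl⟩)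
  rw [← hd, hε, hd, hd]
  simp only [Pi.add_apply, add_smul, Finset.sum_add_distrib]

theorem generator_mem_span {f : Fin r → nilpotentPart b}
    (hf : ∀ i, f i ≠ 0 ∧ (f i : L) ∈ rootSpace H (-((α i).1.1 : H → ℂ))) (i : Fin r) :
    UniversalEnvelopingAlgebra.ι ℂ (f i) ∈
      Submodule.span ℂ {y | ∃ l, d l = Pi.single i 1 ∧
        UniversalEnvelopingAlgebra.ι ℂ (F l) = y} := by
  obtain ⟨l, hl⟩ := β.surjective ⟨(α i).1, b.isPos_of_mem_support (α i).2⟩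
  have hl' : (β l).1 = (α i).1 := congrArg Subtype.val hl
  have hmem := (hF l).2
  rw [hl'] at hmem
  obtain ⟨c, hc⟩ := exists_smul_of_mem_rootSpace _ (hf i).2 hmem
    (fun h => (hF l).1 (Subtype.ext h))
  have : f i = c • F l := Subtype.ext hc
  rw [this, map_smul]
  refine Submodule.smul_mem _ _ (Submodule.subset_span ⟨l, degree_injective α ?_, rfl⟩)
  rw [← hd, hl', Finset.sum_eq_single i]
  · simp
  · intro j _ hj
    simp [hj]
  · simp

end RootVectors

/-! ### Coefficients of ordered monomials -/

section Coefficients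

variable {B : Type*} [Ring B] [Algebra ℂ B] {m r : ℕ} {x : Fin m → B}

/-- Linearly independent monomials admit coefficient forms, defined on the whole algebra. -/
theorem exists_coefficients (hx : LinearIndependent ℂ (dividedMonomial x)) :
    ∃ C : B →ₗ[ℂ] (Fin m → ℕ) →₀ ℂ, ∀ p, C (orderedMonomial x p) = Finsupp.single p 1 := by
  obtain ⟨g, hg⟩ := LinearMap.exists_leftInverse_of_injective _ (LinearMap.ker_eq_bot.2 hx)
  refine ⟨(Finsupp.lsum ℂ fun p => (∏ j, ((p j).factorial : ℂ))⁻¹ • Finsupp.lsingle p) ∘ₗ g,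
    fun p => ?_⟩
  have h1 : orderedMonomial x p = (∏ j, ((p j).factorial : ℂ)) • dividedMonomial x p := by
    rw [dividedMonomial, smul_inv_smul₀ (prod_factorial_ne_zero p)]
  have h2 : g (dividedMonomial x p) = Finsupp.single p 1 := by
    have := LinearMap.congr_fun hg (Finsupp.single p 1)
    simpa using this
  rw [h1, map_smul, LinearMap.comp_apply, h2]
  simp [prod_factorial_ne_zero p]

variable (C : B →ₗ[ℂ] (Fin m → ℕ) →₀ ℂ)

/-- The linear form that takes the coefficient of the divided power with exponent `p`. -/
def dividedCoeff (p : Fin m → ℕ) : B →ₗ[ℂ] ℂ :=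
  (∏ j, ((p j).factorial : ℂ)) • (Finsupp.lapply p ∘ₗ C)

theorem dividedCoeff_apply (p : Fin m → ℕ) (u : B) :
    dividedCoeff C p u = (∏ j, ((p j).factorial : ℂ)) * C u p := rfl

variable {C}

open Classical in
theorem dividedCoeff_dividedMonomial
    (hC : ∀ p, C (orderedMonomial x p) = Finsupp.single p 1) (p p' : Fin m → ℕ) :
    dividedCoeff C p (dividedMonomial x p') = if p' = p then 1 else 0 := by
  rw [dividedCoeff_apply, dividedMonomial, map_smul, hC, Finsupp.smul_single, smul_eq_mul,
    mul_one, Finsupp.single_apply]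
  split_ifs with h
  · rw [h, mul_inv_cancel₀ (prod_factorial_ne_zero p)]
  · rw [mul_zero]

/-- The coefficients of divided powers are multiplicative for the convolution product. -/
theorem convolution_dividedCoeff (hC : ∀ p, C (orderedMonomial x p) = Finsupp.single p 1)
    {Δ : B →ₐ[ℂ] B ⊗[ℂ] B} (hΔ : ∀ j, Δ (x j) = x j ⊗ₜ 1 + 1 ⊗ₜ x j) (p p' : Fin m → ℕ) {u : B}
    (hu : u ∈ Submodule.span ℂ (Set.range (orderedMonomial x))) :
    LinearMap.mul' ℂ ℂ (TensorProduct.map (dividedCoeff C p) (dividedCoeff C p') (Δ u)) =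
      dividedCoeff C (p + p') u := by
  classical
  suffices Set.EqOn (LinearMap.mul' ℂ ℂ ∘ₗ
      TensorProduct.map (dividedCoeff C p) (dividedCoeff C p') ∘ₗ Δ.toLinearMap)
      (dividedCoeff C (p + p')) (Set.range (orderedMonomial x)) from
    LinearMap.eqOn_span this hu
  rintro _ ⟨q, rfl⟩
  have h1 : orderedMonomial x q = (∏ j, ((q j).factorial : ℂ)) • dividedMonomial x q := by
    rw [dividedMonomial, smul_inv_smul₀ (prod_factorial_ne_zero q)]
  rw [h1, map_smul, map_smul]
  congr 1
  simp only [LinearMap.comp_apply, AlgHom.toLinearMap_apply, comul_dividedMonomial hΔ, map_sum,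
    TensorProduct.map_tmul, LinearMap.mul'_apply, dividedCoeff_dividedMonomial hC]
  by_cases hq : q = p + p'
  · subst hq
    have hle : ∀ i, p i < (p + p') i + 1 := fun i => by rw [Pi.add_apply]; omega
    rw [if_pos rfl, Finset.sum_eq_single (fun i => ⟨p i, hle i⟩)]
    · simp
    · intro c _ hc
      rw [if_neg, zero_mul]
      exact fun h => hc (funext fun i => Fin.ext (congrFun h i))
    · simp
  · rw [if_neg hq]
    refine Finset.sum_eq_zero fun c _ => ?_
    rw [ite_mul, one_mul, zero_mul, ← ite_and, if_neg]
    rintro ⟨h1, h2⟩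
    refine hq (funext fun i => ?_)
    have h3 : (c i : ℕ) = p i := congrFun h1 i
    have h4 : q i - (c i : ℕ) = p' i := congrFun h2 i
    have := (c i).2
    rw [Pi.add_apply]
    omega

theorem coeff_eq_zero_of_degree_ne (hC : ∀ p, C (orderedMonomial x p) = Finsupp.single p 1)
    {K : Type*} [AddCommMonoid K] {d : Fin m → K} {e : K} {u : B}
    (hu : u ∈ Submodule.span ℂ {y | ∃ p : Fin m → ℕ, ∑ j, p j • d j = e ∧ orderedMonomial x p = y})
    {p : Fin m → ℕ} (hp : ∑ j, p j • d j ≠ e) : C u p = 0 := by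
  suffices Set.EqOn (Finsupp.lapply p ∘ₗ C) (0 : B →ₗ[ℂ] ℂ)
      {y | ∃ p : Fin m → ℕ, ∑ j, p j • d j = e ∧ orderedMonomial x p = y} from
    LinearMap.eqOn_span this hu
  rintro _ ⟨q, hq, rfl⟩
  rw [LinearMap.comp_apply, hC, Finsupp.lapply_apply, Finsupp.single_apply, if_neg]
  · rfl
  · rintro rfl
    exact hp hq

theorem linearCombination_coeff (hC : ∀ p, C (orderedMonomial x p) = Finsupp.single p 1) {u : B}
    (hu : u ∈ Submodule.span ℂ (Set.range (orderedMonomial x))) :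
    Finsupp.linearCombination ℂ (orderedMonomial x) (C u) = u := by
  suffices Set.EqOn (Finsupp.linearCombination ℂ (orderedMonomial x) ∘ₗ C) LinearMap.id
      (Set.range (orderedMonomial x)) from LinearMap.eqOn_span this hu
  rintro _ ⟨q, rfl⟩
  simp [hC]

/-- If the generators are mapped into the span of the elements `x_j` of the same degree, then words
are mapped into the span of the ordered monomials of the same degree. -/
theorem map_wordMonomial_mem_span {x : Fin m → B} {d : Fin m → Fin r → ℕ}
    (hcomm : ∀ i j, x i * x j - x j * x i ∈ Submodule.span ℂ {y | ∃ l, d l = d i + d j ∧ x l = y})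
    {q : FreeAlgebra ℂ (Fin r) →ₐ[ℂ] B}
    (hq : ∀ i, q (FreeAlgebra.ι ℂ i) ∈ Submodule.span ℂ {y | ∃ l, d l = Pi.single i 1 ∧ x l = y})
    (w : List (Fin r)) :
    q (wordMonomial w) ∈ Submodule.span ℂ
      {y | ∃ p : Fin m → ℕ, ∑ j, p j • d j = (fun i => w.count i) ∧ orderedMonomial x p = y} := by
  have h1 : q (wordMonomial w) ∈ Submodule.span ℂ
      {y | ∃ v : List (Fin m), (v.map d).sum = (fun i => w.count i) ∧ (v.map x).prod = y} := by
    induction w with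
    | nil =>
      refine Submodule.subset_span ⟨[], ?_, ?_⟩
      · funext i; simp
      · simp
    | cons i w ih =>
      have h2 := Submodule.mul_mem_mul (hq i) ih
      rw [← map_mul, Submodule.span_mul_span] at h2
      refine Submodule.span_mono ?_ h2
      rintro _ ⟨_, ⟨l, hl, rfl⟩, _, ⟨v, hv, rfl⟩, rfl⟩
      refine ⟨l :: v, ?_, by simp⟩
      rw [List.map_cons, List.sum_cons, hl, hv]
      funext j
      by_cases hj : j = i
      · subst hj; simp [add_comm]
      · simp [hj, Ne.symm hj]
  refine (Submodule.span_le.2 ?_ : _ ≤ _) h1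
  rintro _ ⟨v, hv, rfl⟩
  rw [← hv]
  exact prod_map_mem_span_orderedMonomial hcomm v

/-- The coefficients of divided powers, as linear forms on the free algebra, are multiplicative. -/
theorem convolution_dividedCoeff_comp
    (hC : ∀ p, C (orderedMonomial x p) = Finsupp.single p 1)
    {Δ : B →ₐ[ℂ] B ⊗[ℂ] B} (hΔ : ∀ j, Δ (x j) = x j ⊗ₜ 1 + 1 ⊗ₜ x j)
    {q : FreeAlgebra ℂ (Fin r) →ₐ[ℂ] B}
    (hq : ∀ i, Δ (q (FreeAlgebra.ι ℂ i)) =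
      q (FreeAlgebra.ι ℂ i) ⊗ₜ 1 + 1 ⊗ₜ q (FreeAlgebra.ι ℂ i))
    (hspan : ∀ w, q (wordMonomial w) ∈ Submodule.span ℂ (Set.range (orderedMonomial x)))
    (p p' : Fin m → ℕ) :
    convolution (dividedCoeff C p ∘ₗ q.toLinearMap) (dividedCoeff C p' ∘ₗ q.toLinearMap) =
      dividedCoeff C (p + p') ∘ₗ q.toLinearMap := by
  have h1 : (Algebra.TensorProduct.map q q).comp (freeComul r) = Δ.comp q := by
    refine FreeAlgebra.hom_ext (funext fun i => ?_)
    simp [freeComul, hq]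
  refine FreeAlgebra.hom_ext_word fun w => ?_
  have h2 := congrArg (TensorProduct.map (dividedCoeff C p) (dividedCoeff C p'))
    (AlgHom.congr_fun h1 (wordMonomial w))
  rw [convolution, TensorProduct.map_comp, LinearMap.comp_apply, LinearMap.comp_apply,
    LinearMap.comp_apply, LinearMap.comp_apply]
  exact (congrArg (LinearMap.mul' ℂ ℂ) h2).trans (convolution_dividedCoeff hC hΔ p p' (hspan w))

end Coefficients

/-! ### Star-products of homogeneous elements -/

section StarProducts

variable {r m : ℕ}

theorem functional_one_wordMonomial (w : List (Fin r)) :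
    functional 0 (GradedMonoid.GOne.one (A := fun k : Fin r → ℕ => A k)) (wordMonomial w) =
      if w = [] then 1 else 0 := by
  classical
  split_ifs with h
  · subst h
    obtain ⟨J, hJ⟩ := Multiindex.exists_word_eq (k := (0 : Fin r → ℕ)) (w := []) (by simp)
    rw [← hJ, functional_word, Multiindex.form_eq]
    have hP : IsParent (fun _ => none : Var (0 : Fin r → ℕ) → _) (fun v => v.elim 0 fun _ => 1) :=
      ⟨rfl, fun _ => rfl⟩
    have h1 : emptyTree (r := r) = ofParent _ hP J.ordering := by
      ext1
      funext a
      exact isEmptyElim a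
    change orderForm J.ordering (ForestSpace.mk emptyTree) = 1
    rw [h1, orderForm_ofParent, if_pos (show IsLinearExtension (fun _ => none) J.ordering by
      intro a; simp), mul_one, orderSign,
      Subsingleton.elim (J.ordering.trans finSigmaFinEquiv) (Equiv.refl _)]
    simp
  · refine functional_eq_zero _ ?_
    obtain ⟨i, hi⟩ := List.exists_mem_of_ne_nil w h
    exact ⟨i, (List.count_pos_iff.2 hi).ne'⟩

theorem totalFunctional_of_mul_of {k l : Fin r → ℕ} (x : A k) (y : A l) :
    totalFunctional r (DirectSum.of (fun k : Fin r → ℕ => A k) k x *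
      DirectSum.of (fun k : Fin r → ℕ => A k) l y) =
        convolution (functional k x) (functional l y) := by
  rw [DirectSum.of_mul_of, totalFunctional_of, ← functional_starMul]
  rfl

theorem totalFunctional_one (w : List (Fin r)) :
    totalFunctional r 1 (wordMonomial w) = if w = [] then 1 else 0 := by
  rw [← functional_one_wordMonomial]
  exact LinearMap.congr_fun (totalFunctional_of _) _

/-- The linear forms `G p` are multiplicative for the convolution product and represented by the
elements `t p` of the spaces `A(k)`; then the star-products of the elements `t (1_j)` are again
represented by the linear forms `G p`. -/
theorem prod_map_of {d : Fin m → Fin r → ℕ}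
    {G : (Fin m → ℕ) → Module.Dual ℂ (FreeAlgebra ℂ (Fin r))}
    (hmul : ∀ p p', convolution (G p) (G p') = G (p + p'))
    (hone : ∀ w, G 0 (wordMonomial w) = if w = [] then 1 else 0)
    {t : ∀ p : Fin m → ℕ, A (pbwDegree d p)} (ht : ∀ p, functional _ (t p) = G p)
    {η : ∀ j, A (d j)} (hη : ∀ j, functional _ (η j) = G (Pi.single j 1)) (v : List (Fin m)) :
    (v.map fun j => DirectSum.of (fun k : Fin r → ℕ => A k) (d j) (η j)).prod =
      DirectSum.of (fun k : Fin r → ℕ => A k) _ (t fun j => v.count j) := by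
  induction v with
  | nil =>
    refine totalFunctional_injective r (FreeAlgebra.hom_ext_word fun w => ?_)
    rw [List.map_nil, List.prod_nil, totalFunctional_one, totalFunctional_of, ht, ← hone]
    rfl
  | cons j v ih =>
    rw [List.map_cons, List.prod_cons, ih]
    refine totalFunctional_injective r ?_
    rw [totalFunctional_of_mul_of, totalFunctional_of, hη, ht, ht, hmul]
    congr 1
    funext i
    rw [Pi.add_apply, List.count_cons, add_comm]
    by_cases h : i = j
    · subst h; simp
    · simp [h, Ne.symm h]

theorem starMonomial_eq {d : Fin m → Fin r → ℕ} (η : ∀ j, A (d j)) (p : Fin m → ℕ) :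
    starMonomial η p = ((sortedWord p).map fun j =>
      DirectSum.of (fun k : Fin r → ℕ => A k) (d j) (η j)).prod := by
  rw [map_sortedWord]
  rfl

theorem pbwDegree_single (d : Fin m → Fin r → ℕ) (j : Fin m) :
    pbwDegree d (Pi.single j 1) = d j := by
  rw [pbwDegree, Finset.sum_eq_single j]
  · simp
  · intro i _ hi; simp [hi]
  · simp

end StarProducts

/-! ### The coefficients of the canonical element -/

section Expansion

open LieAlgebra LieAlgebra.IsKilling

variable {r m : ℕ}

theorem convolution_one (φ : Module.Dual ℂ (FreeAlgebra ℂ (Fin r))) :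
    convolution φ (totalFunctional r 1) = φ := by
  have h1 : totalFunctional r 1 =
      (FreeAlgebra.lift ℂ fun _ : Fin r => (0 : ℂ)).toLinearMap := by
    refine FreeAlgebra.hom_ext_word fun w => ?_
    rw [totalFunctional_one]
    cases w <;> simp [wordMonomial]
  have h2 : (Algebra.TensorProduct.map (AlgHom.id ℂ _)
      (FreeAlgebra.lift ℂ fun _ : Fin r => (0 : ℂ))).comp (freeComul r) =
        Algebra.TensorProduct.includeLeft := by
    refine FreeAlgebra.hom_ext (funext fun i => ?_)
    simp [freeComul]
  have h3 : TensorProduct.map φ (totalFunctional r 1) =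
      TensorProduct.map φ LinearMap.id ∘ₗ TensorProduct.map LinearMap.id (totalFunctional r 1) := by
    rw [← TensorProduct.map_comp, LinearMap.comp_id, LinearMap.id_comp]
  refine LinearMap.ext fun u => ?_
  rw [convolution, h3, h1]
  have h4 := congrArg (fun v => LinearMap.mul' ℂ ℂ (TensorProduct.map φ LinearMap.id v))
    (AlgHom.congr_fun h2 u)
  refine h4.trans ?_
  simp

/-- The class of `T₀` is a right unit of the star-product: it represents the counit of the free
algebra. -/
theorem of_mul_one {k : Fin r → ℕ} (x : A k) :
    DirectSum.of (fun k : Fin r → ℕ => A k) k x * 1 =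
      DirectSum.of (fun k : Fin r → ℕ => A k) k x := by
  refine totalFunctional_injective r ?_
  have h := totalFunctional_of_mul_of x (GradedMonoid.GOne.one (A := fun k : Fin r → ℕ => A k))
  rw [← totalFunctional_of (GradedMonoid.GOne.one (A := fun k : Fin r → ℕ => A k))] at h
  rw [totalFunctional_of]
  exact h.trans (convolution_one _)

theorem starMonomial_single {d : Fin m → Fin r → ℕ} (η : ∀ j, A (d j)) (j : Fin m) :
    starMonomial η (Pi.single j 1) = DirectSum.of (fun k : Fin r → ℕ => A k) (d j) (η j) := by
  have h : sortedWord (Pi.single j 1) = [j] := by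
    refine List.perm_singleton.1 (List.perm_iff_count.2 fun i => ?_)
    rw [count_sortedWord]
    by_cases h : i = j
    · subst h; simp
    · simp [h, Ne.symm h]
  rw [starMonomial_eq, h, List.map_singleton, List.prod_cons, List.prod_nil, of_mul_one]

variable {L : Type*} [LieRing L] [LieAlgebra ℂ L] [FiniteDimensional ℂ L] [LieAlgebra.IsSimple ℂ L]
  {H : LieSubalgebra ℂ L} [H.IsCartanSubalgebra] {b : (rootSystem H).Base}
  {f : Fin r → nilpotentPart b} {F : Fin m → nilpotentPart b} {d : Fin m → Fin r → ℕ}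

theorem contractLeft_projectTensor {k : Fin r → ℕ} {ω : A k ⊗[ℂ] freePart k}
    (hω : IsCanonicalElement ω) (J : Multiindex k) :
    contractLeft J.form (projectTensor f ω) = quotientMap f J.monomial := by
  have h1 : contractLeft J.form (projectTensor f ω) =
      quotientMap f (contractLeft J.form ω : freePart k) := by
    clear hω
    rw [projectTensor]
    induction ω with
    | zero => simp
    | tmul x u => simp
    | add ω₁ ω₂ h₁ h₂ => simp only [map_add, Submodule.coe_add, h₁, h₂]
  rw [h1]
  have h2 := hω ⟨J.monomial, monomial_mem J⟩
  rw [pairing_monomial] at h2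
  exact congrArg (fun u : freePart k => quotientMap f u) h2

variable {C : UniversalEnvelopingAlgebra ℂ (nilpotentPart b) →ₗ[ℂ] (Fin m → ℕ) →₀ ℂ}

/-- The coefficients of the expansion, evaluated by the forms of the multiindices, are the
coefficients of the images of the words in `U(𝔫)`. -/
theorem IsPBWExpansion.form_eq (hC : ∀ p, C (pbwMonomial F p) = Finsupp.single p 1)
    {Ω : ∀ k : Fin r → ℕ, A k ⊗[ℂ] freePart k} (hΩ : ∀ k, IsCanonicalElement (Ω k))
    {T : ∀ k : Fin r → ℕ, (Fin m → ℕ) →₀ A k} (hT : IsPBWExpansion f F d Ω T)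
    {k : Fin r → ℕ} (J : Multiindex k) (p : Fin m → ℕ) :
    J.form (T k p) = C (quotientMap f J.monomial) p := by
  rw [← contractLeft_projectTensor (hΩ k), (hT k).2, Finsupp.sum, map_sum, map_sum,
    Finsupp.finsetSum_apply]
  simp only [contractLeft_tmul, map_smul, hC, Finsupp.smul_single, smul_eq_mul, mul_one]
  simp only [Finsupp.single_apply]
  rw [Finset.sum_ite_eq']
  split_ifs with h
  · rfl
  · rw [Finsupp.notMem_support_iff.1 h, map_zero]

/-- The coefficient `T_p` is the combination of the dual family of `A(k)` whose factors are the
coefficients of the words in `U(𝔫)`. -/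
theorem exists_isPBWExpansion (hC : ∀ p, C (pbwMonomial F p) = Finsupp.single p 1)
    (hspan : ∀ w, quotientMap f (wordMonomial w) ∈ Submodule.span ℂ
      {y | ∃ p : Fin m → ℕ, pbwDegree d p = (fun i => w.count i) ∧ pbwMonomial F p = y})
    {Ω : ∀ k : Fin r → ℕ, A k ⊗[ℂ] freePart k} (hΩ : ∀ k, IsCanonicalElement (Ω k)) :
    ∃ T : ∀ k : Fin r → ℕ, (Fin m → ℕ) →₀ A k, IsPBWExpansion f F d Ω T := by
  classical
  let T : ∀ k : Fin r → ℕ, (Fin m → ℕ) →₀ A k := fun k => ∑ J : Multiindex k,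
    Finsupp.mapRange.linearMap (LinearMap.toSpanSingleton ℂ (A k) J.dual)
      (C (quotientMap f J.monomial))
  have hT : ∀ (k : Fin r → ℕ) (J : Multiindex k) p,
      J.form (T k p) = C (quotientMap f J.monomial) p := by
    intro k J p
    simp only [T, Finsupp.finsetSum_apply, map_sum, Finsupp.mapRange.linearMap_apply,
      Finsupp.mapRange_apply, LinearMap.toSpanSingleton_apply, map_smul, Multiindex.form_dual]
    rw [Finset.sum_eq_single J]
    · simp
    · intro J' _ h
      rw [if_neg (Ne.symm h), smul_zero]
    · simp
  refine ⟨T, fun k => ⟨fun p hp => A.ext_form fun J => ?_, ?_⟩⟩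
  · rw [hT, map_zero]
    refine coeff_eq_zero_of_degree_ne hC (d := d) (hspan J.word) ?_
    refine fun h => hp (h.trans (funext J.count_word))
  · rw [← sum_dual_tmul_contractLeft (projectTensor f (Ω k)),
      ← sum_dual_tmul_contractLeft ((T k).sum _)]
    refine Finset.sum_congr rfl fun J _ => congrArg _ ?_
    have h1 : Finsupp.mapRange.linearMap J.form (T k) = C (quotientMap f J.monomial) :=
      Finsupp.ext fun p => hT k J p
    have h2 := linearCombination_coeff hC (u := quotientMap f J.monomial)
      (Submodule.span_mono (by rintro _ ⟨p, _, rfl⟩; exact ⟨p, rfl⟩) (hspan J.word))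
    rw [contractLeft_projectTensor (hΩ k), ← h2, ← h1, Finsupp.mapRange.linearMap_apply,
      Finsupp.linearCombination_apply, Finsupp.sum_mapRange_index (by simp), Finsupp.sum,
      Finsupp.sum, map_sum]
    rfl

theorem IsPBWExpansion.unique (hC : ∀ p, C (pbwMonomial F p) = Finsupp.single p 1)
    {Ω : ∀ k : Fin r → ℕ, A k ⊗[ℂ] freePart k} (hΩ : ∀ k, IsCanonicalElement (Ω k))
    {T T' : ∀ k : Fin r → ℕ, (Fin m → ℕ) →₀ A k} (hT : IsPBWExpansion f F d Ω T)
    (hT' : IsPBWExpansion f F d Ω T') : T = T' :=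
  funext fun _ => Finsupp.ext fun p => A.ext_form fun J => by
    rw [hT.form_eq hC hΩ, hT'.form_eq hC hΩ]

theorem ProductFormula.unique {T : ∀ k : Fin r → ℕ, (Fin m → ℕ) →₀ A k} {η η' : ∀ j, A (d j)}
    (h : ProductFormula T η) (h' : ProductFormula T η') : η = η' := by
  funext j
  have h1 := (h (Pi.single j 1)).symm.trans (h' (Pi.single j 1))
  rw [starMonomial_single, starMonomial_single] at h1
  refine DirectSum.of_injective (d j) (smul_right_injective _ ?_ h1)
  exact one_div_ne_zero (prod_factorial_ne_zero _)

/-- The linear form on the free algebra represented by the coefficient `T_p` is, up to the product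
of the factorials `p_j!`, the coefficient of the divided power with exponent `p`. -/
theorem IsPBWExpansion.functional_eq (hC : ∀ p, C (pbwMonomial F p) = Finsupp.single p 1)
    (hspan : ∀ w, quotientMap f (wordMonomial w) ∈ Submodule.span ℂ
      {y | ∃ p : Fin m → ℕ, pbwDegree d p = (fun i => w.count i) ∧ pbwMonomial F p = y})
    {Ω : ∀ k : Fin r → ℕ, A k ⊗[ℂ] freePart k} (hΩ : ∀ k, IsCanonicalElement (Ω k))
    {T : ∀ k : Fin r → ℕ, (Fin m → ℕ) →₀ A k} (hT : IsPBWExpansion f F d Ω T)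
    (p : Fin m → ℕ) {k : Fin r → ℕ} (hk : pbwDegree d p = k) :
    functional k ((∏ j, ((p j).factorial : ℂ)) • T k p) =
      dividedCoeff C p ∘ₗ (quotientMap f).toLinearMap := by
  refine FreeAlgebra.hom_ext_word fun w => ?_
  rw [LinearMap.comp_apply, AlgHom.toLinearMap_apply, dividedCoeff_apply]
  by_cases hw : ∀ i, w.count i = k i
  · obtain ⟨J, rfl⟩ := Multiindex.exists_word_eq hw
    rw [functional_word, map_smul, hT.form_eq hC hΩ]
    rfl
  · rw [functional_eq_zero _ (not_forall.1 hw), coeff_eq_zero_of_degree_ne hC (d := d) (hspan w),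
      mul_zero]
    refine fun h => hw fun i => ?_
    rw [← hk]
    exact (congrFun h i).symm

/-- The coefficients of divided powers are multiplicative and represented by `(∏ p_j!) T_p`. -/
theorem IsPBWExpansion.productFormula (hC : ∀ p, C (pbwMonomial F p) = Finsupp.single p 1)
    (hspan : ∀ w, quotientMap f (wordMonomial w) ∈ Submodule.span ℂ
      {y | ∃ p : Fin m → ℕ, pbwDegree d p = (fun i => w.count i) ∧ pbwMonomial F p = y})
    {Ω : ∀ k : Fin r → ℕ, A k ⊗[ℂ] freePart k} (hΩ : ∀ k, IsCanonicalElement (Ω k))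
    {T : ∀ k : Fin r → ℕ, (Fin m → ℕ) →₀ A k} (hT : IsPBWExpansion f F d Ω T) :
    ProductFormula T fun j => T (d j) (Pi.single j 1) := by
  have hspan' : ∀ w, quotientMap f (wordMonomial w) ∈
      Submodule.span ℂ (Set.range (pbwMonomial F)) := fun w =>
    Submodule.span_mono (by rintro _ ⟨p, _, rfl⟩; exact ⟨p, rfl⟩) (hspan w)
  have hmul := convolution_dividedCoeff_comp hC (fun j => envComul_ι (nilpotentPart b) (F j))
    (q := quotientMap f)
    (fun i => by
      rw [quotientMap, FreeAlgebra.lift_ι_apply]; exact envComul_ι (nilpotentPart b) (f i)) hspan'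
  have hone : ∀ w, (dividedCoeff C 0 ∘ₗ (quotientMap f).toLinearMap) (wordMonomial w) =
      if w = [] then 1 else 0 := by
    intro w
    rw [LinearMap.comp_apply, AlgHom.toLinearMap_apply, dividedCoeff_apply]
    split_ifs with h
    · have h0 : quotientMap f (wordMonomial []) = pbwMonomial F 0 :=
        (map_one _).trans (orderedMonomial_zero _).symm
      rw [h, h0, hC]
      simp
    · rw [coeff_eq_zero_of_degree_ne hC (d := d) (hspan w), mul_zero]
      intro h0
      obtain ⟨i, hi⟩ := List.exists_mem_of_ne_nil w h
      have h1 := congrFun h0 i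
      simp only [Pi.zero_apply, zero_smul, Finset.sum_const_zero] at h1
      exact (List.count_pos_iff.2 hi).ne h1
  have hη : ∀ j, functional (d j) (T (d j) (Pi.single j 1)) =
      dividedCoeff C (Pi.single j 1) ∘ₗ (quotientMap f).toLinearMap := by
    intro j
    rw [← hT.functional_eq hC hspan hΩ _ (pbwDegree_single d j), Finset.prod_eq_one, one_smul]
    intro i _
    by_cases h : i = j
    · subst h; simp
    · simp [h]
  intro p
  have h1 := prod_map_of hmul hone (fun p => hT.functional_eq hC hspan hΩ p rfl) hη (sortedWord p)
  have h2 : (fun j => (sortedWord p).count j) = p := funext (count_sortedWord p)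
  rw [starMonomial_eq, h1, h2, ← DirectSum.lof_eq_of ℂ, ← DirectSum.lof_eq_of ℂ, map_smul,
    one_div, inv_smul_smul₀ (prod_factorial_ne_zero p)]

end Expansion

end CanonicalElement

end

theorem mainTheorem2 {L : Type*} [LieRing L] [LieAlgebra ℂ L] [FiniteDimensional ℂ L]
    [LieAlgebra.IsSimple ℂ L] (H : LieSubalgebra ℂ L) [H.IsCartanSubalgebra]
    (b : (LieAlgebra.IsKilling.rootSystem H).Base) {r m : ℕ}
    -- the simple roots and the Chevalley generators
    (α : Fin r ≃ b.support) (f : Fin r → nilpotentPart b)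
    (hf : ∀ i, f i ≠ 0 ∧ (f i : L) ∈ LieAlgebra.rootSpace H (-((α i).1.1 : H → ℂ)))
    -- the ordering of the positive roots and the root vectors
    (β : Fin m ≃ PositiveRoot b) (F : Fin m → nilpotentPart b)
    (hF : ∀ j, F j ≠ 0 ∧ (F j : L) ∈ LieAlgebra.rootSpace H (-((β j).1.1 : H → ℂ)))
    -- the degrees of the root vectors
    (d : Fin m → Fin r → ℕ)
    (hd : ∀ j, (LieAlgebra.IsKilling.rootSystem H).root (β j).1 =
      ∑ i, d j i • (LieAlgebra.IsKilling.rootSystem H).root (α i).1) :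
    (∀ k : Fin r → ℕ, ∃! ω : A k ⊗[ℂ] freePart k, IsCanonicalElement ω) ∧
    ∀ Ω : ∀ k : Fin r → ℕ, A k ⊗[ℂ] freePart k, (∀ k, IsCanonicalElement (Ω k)) →
      (∃! T : ∀ k : Fin r → ℕ, (Fin m → ℕ) →₀ A k, IsPBWExpansion f F d Ω T) ∧
      ∀ T : ∀ k : Fin r → ℕ, (Fin m → ℕ) →₀ A k, IsPBWExpansion f F d Ω T →
        (∃! η : ∀ j, A (d j), ProductFormula T η) ∧
        ProductFormula T (fun j => T (d j) (Pi.single j 1)) := by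
  obtain ⟨C, hC⟩ := exists_coefficients (linearIndependent_dividedMonomial
    (Δ := envComul (nilpotentPart b)) (ε := envCounit (nilpotentPart b))
    (x := fun j => UniversalEnvelopingAlgebra.ι ℂ (F j)) (fun j => envComul_ι _ (F j))
    (fun j => envCounit_ι _ (F j)) (linearIndependent_ι (linearIndependent_rootVectors β hF)))
  have hspan := map_wordMonomial_mem_span (q := quotientMap f)
    (commutator_mem_span α β hF hd) (fun i => by
      rw [quotientMap, FreeAlgebra.lift_ι_apply]; exact generator_mem_span α β hF hd hf i)
  refine ⟨existsUnique_isCanonicalElement, fun Ω hΩ => ⟨?_, fun T hT => ?_⟩⟩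
  · obtain ⟨T, hT⟩ := exists_isPBWExpansion hC hspan hΩ
    exact ⟨T, hT, fun T' hT' => hT'.unique hC hΩ hT⟩
  · have h := hT.productFormula hC hspan hΩ
    exact ⟨⟨_, h, fun η hη => hη.unique h⟩, h⟩
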